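/- Let $\mathbb T^2=[0,2\pi]^2$ with periodic boundary conditions, $\hat u(\xi)=(2\pi)^{-2}\int_{\mathbb T^2}e^{-i\xi\cdot(x,y)}u(x,y)\,dx\,dy$ for $\xi\in\mathbb Z^2$, and let $\Lambda$ be the Fourier multiplier $\widehat{\Lambda u}(\xi)=|\xi|\hat u(\xi)$. Let $\varepsilon>0$, $\beta>0$, $\delta\ge 0$ and consider $$\eta_t+\eta\,\eta_x+(\beta-1)\eta_{xx}-\eta_{yy}-\delta\Lambda^3\eta+\varepsilon\Delta^2\eta=0,\quad (x,y)\in\mathbb T^2,\ t>0,\qquad \eta(0)=\eta_0 .\tag{1}$$ By a solution of (1) we mean a real-valued function $\eta\in C([0,T];H^2(\mathbb T^2))\cap L^2(0,T;H^4(\mathbb T^2))$ for every $T>0$ which satisfies the equation in the sense of distributions and the initial condition. **Theorem.** Let $\eta_0\in H^2(\mathbb T^2)$ be real-valued and odd in $x$, i.e. $\eta_0(-x,y)=-\eta_0(x,y)$. Then there are $T_0>0$ and a constant $C$, both depending only on $\eta_0,\varepsilon,\beta,\delta$, such that the solution $\eta$ of (1) satisfies $\|\eta(t)\|_{L^2}\le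 C$ for all $t\ge 0$ and $$\|e^{\sigma(t)\Lambda}\eta(t)\|_{L^2}^2=4\pi^2\sum_{\xi\in\mathbb Z^2}e^{2\sigma(t)|\xi|}|\hat\eta(\xi,t)|^2\le 1+2C^2\quad\text{for all }t>0,\qquad \sigma(t)=\min\{\tanh t,\tanh(T_0/2)\}.$$ In particular, for every $t>0$ the function $\eta(t)$ extends to a complex analytic function on the strip $\{(x,y)+i(x',y'):(x,y),(x',y')\in\mathbb R^2,\ |(x',y')|<\sigma(t)\}$, which has the fixed width $\tanh(T_0/2)$ for all $t\ge T_0/2$. -/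

import Mathlib

open MeasureTheory Filter Topology
open scoped ENNReal

noncomputable section

instance fact_two_pi_pos : Fact (0 < 2 * Real.pi) := ⟨Real.two_pi_pos⟩

/-- The torus `[0, 2π]²` with periodic boundary conditions, with Lebesgue measure (total mass
`4π²`). -/
abbrev Torus2 : Type := AddCircle (2 * Real.pi) × AddCircle (2 * Real.pi)

/-- Real-valued `L²` functions on the torus. -/
abbrev L2Torus : Type := Lp ℝ 2 (volume : Measure Torus2)

/-- Fourier coefficient `(2π)⁻² ∫ e^{-i ξ₁ x - i ξ₂ y} f(x, y) dx dy`. -/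
def fourierCoeff2 (f : Torus2 → ℝ) (ξ : ℤ × ℤ) : ℂ :=
  (((2 * Real.pi) ^ 2)⁻¹ : ℝ) *
    ∫ p : Torus2, fourier (-ξ.1) p.1 * fourier (-ξ.2) p.2 * (f p : ℂ)

/-- Euclidean length `|ξ|` of a frequency: the symbol of `Λ`. -/
def freqNorm (ξ : ℤ × ℤ) : ℝ := Real.sqrt ((ξ.1 : ℝ) ^ 2 + (ξ.2 : ℝ) ^ 2)

/-- The squared Sobolev norm `4π² ∑ (1 + |ξ|²)^s |û(ξ)|²`, with value `∞` when `u ∉ H^s`. -/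
def sobolevSq (s : ℕ) (u : L2Torus) : ℝ≥0∞ :=
  ∑' ξ : ℤ × ℤ, ENNReal.ofReal
    ((2 * Real.pi) ^ 2 * ((1 + freqNorm ξ ^ 2) ^ s * ‖fourierCoeff2 u ξ‖ ^ 2))

/-- The squared Gevrey norm `‖e^{σΛ} u‖²_{L²} = 4π² ∑ e^{2σ|ξ|} |û(ξ)|²`, with value `∞` when
`e^{σΛ} u ∉ L²`. -/
def gevreySq (σ : ℝ) (u : L2Torus) : ℝ≥0∞ :=
  ∑' ξ : ℤ × ℤ, ENNReal.ofReal
    ((2 * Real.pi) ^ 2 * (Real.exp (2 * σ * freqNorm ξ) * ‖fourierCoeff2 u ξ‖ ^ 2))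

/-- The space `H²_od`: functions in `H²` of the torus that are odd in `x`. -/
def IsH2Odd (u : L2Torus) : Prop :=
  sobolevSq 2 u < ⊤ ∧ ∀ᵐ p : Torus2, u (-p.1, p.2) = -u p

/-- Fourier symbol of the linear operator
`η ↦ -(β - 1) η_xx + η_yy + δ Λ³ η - ε Δ² η`. -/
def linearSymbol (ε β δ : ℝ) (ξ : ℤ × ℤ) : ℝ :=
  (β - 1) * (ξ.1 : ℝ) ^ 2 - (ξ.2 : ℝ) ^ 2 + δ * freqNorm ξ ^ 3 - ε * freqNorm ξ ^ 4

/-- `η` is a global solution, in `C([0,T]; H²) ∩ L²(0,T; H⁴)` for every `T > 0`, of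
`η_t + η η_x + (β - 1) η_xx - η_yy - δ Λ³ η + ε Δ² η = 0`, `η(0) = η₀`.
The equation holds in the sense of distributions on the torus, integrated in time: it is tested
against every character `e^{-i ξ·x}`, with `η η_x = (η²)_x / 2`. -/
structure IsSolution (ε β δ : ℝ) (η₀ : L2Torus) (η : ℝ → L2Torus) : Prop where
  initial : η 0 = η₀
  mem_H2 : ∀ t, 0 ≤ t → sobolevSq 2 (η t) < ⊤
  continuous_H2 : ∀ t, 0 ≤ t →
    Tendsto (fun s => sobolevSq 2 (η s - η t)) (𝓝[Set.Ici 0] t) (𝓝 0)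
  memL2_H4 : ∀ T, 0 < T → ∫⁻ t in Set.Ioc 0 T, sobolevSq 4 (η t) < ⊤
  equation : ∀ t, 0 ≤ t → ∀ ξ : ℤ × ℤ,
    fourierCoeff2 (η t) ξ = fourierCoeff2 η₀ ξ +
      ∫ s in (0 : ℝ)..t,
        (-(Complex.I * (ξ.1 : ℂ) / 2) * fourierCoeff2 (fun p => (η s p) ^ 2) ξ
          + (linearSymbol ε β δ ξ : ℂ) * fourierCoeff2 (η s) ξ)

/-- The strip `{(x, y) + i (x', y') : |(x', y')| < r}` in `ℂ²`. -/
def complexStrip (r : ℝ) : Set (ℂ × ℂ) :=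
  {z | Real.sqrt (z.1.im ^ 2 + z.2.im ^ 2) < r}

/-- `u` has a (complex) analytic extension to the strip of width `r`. -/
def AnalyticInStrip (r : ℝ) (u : L2Torus) : Prop :=
  ∃ F : ℂ × ℂ → ℂ, AnalyticOnNhd ℂ F (complexStrip r) ∧
    ∀ᵐ p : ℝ × ℝ, F ((p.1 : ℂ), (p.2 : ℂ)) =
      ((u ((p.1 : AddCircle (2 * Real.pi)), (p.2 : AddCircle (2 * Real.pi))) : ℝ) : ℂ)

/-- The width `σ(t) = min {tanh t, tanh (T₀ / 2)}`. -/
def stripWidth (T₀ t : ℝ) : ℝ := min (Real.tanh t) (Real.tanh (T₀ / 2))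

end

/-! On the Fourier side the equation is an ODE system for the coefficients a(ξ), with the real
symbol `linearSymbol` and the convolution q = a * a. Two things carry the theorem: an L² bound
uniform in time, and analytic smoothing over a time step that depends only on this bound and the
parameters.

L² bound (`exists_energy_le`). The nonlinearity drops out of the energy balance
(`hasSum_mul_conj_conv`), but low modes may be linearly unstable. Oddness, which Grönwall's lemma
propagates (`odd`), compensates. Put φ(x) = -2γ ∑_{1≤k≤L} sin(kx)/k, so that φ' = γ - γ D_L with D_L
the Dirichlet kernel. The nonlinearity contributes -γ mean(η²) + γ mean(η² D_L) to the rate of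
mean(η² - 2ηφ). For large L the last term is close to γ times the y-mean of η(0,y)², which vanishes
by oddness. Quantitatively, `exists_norm_sum_conv_le` bounds mean(η² D_L) by κ ∑ |ξ|⁴|a(ξ)|² with κ
as small as desired. With γ above the linear growth rate and κ = ε/γ the fourth order dissipation
absorbs this error, and the functional cannot grow while the L² norm is large.

Smoothing (`exists_gevrey_le`). Let b(ξ) = e^{s|ξ|}|a(t₀+s,ξ)|. As |ξ| ≤ |ζ| + |ξ-ζ|, the weighted
convolution is dominated by b * b, and Young's inequality bounds the nonlinear term by
‖Λb‖₂‖b‖₁‖b‖₂. The ℓ¹ norm is controlled by ∑ (1+|ξ|)³ b², because (1+|ξ|)⁻³ is summable on ℤ². So,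
while ‖b‖₂² ≤ B, everything destabilising has order at most |ξ|³ and is absorbed by ε|ξ|⁴ up to a
constant. Starting below B, the norm stays below B for a time τ independent of t₀. The truncated
weights min(|ξ|, n) make the computation legitimate before any analyticity is known.

Restarting at t - min(t, τ) gives radius min(t, τ) at time t. Since tanh x ≤ x, this dominates σ(t)
for T₀ = 2τ. The decay of the coefficients makes the Fourier series analytic on the strip
(`analyticInStrip_of_summable`). -/

open scoped ComplexConjugate

/-! ### Fourier analysis on the torus: Parseval, convolution, inversion -/

section FourierBasis

open Submodule

/-- The character `(x, y) ↦ e^{i ξ₁ x + i ξ₂ y}` of the torus. -/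
noncomputable def torusChar (ξ : ℤ × ℤ) : C(Torus2, ℂ) where
  toFun p := fourier ξ.1 p.1 * fourier ξ.2 p.2
  continuous_toFun := by fun_prop

theorem torusChar_apply (ξ : ℤ × ℤ) (p : Torus2) :
    torusChar ξ p = fourier ξ.1 p.1 * fourier ξ.2 p.2 := rfl

theorem torusChar_neg (ξ : ℤ × ℤ) (p : Torus2) : torusChar (-ξ) p = conj (torusChar ξ p) := by
  simp only [torusChar_apply, Prod.fst_neg, Prod.snd_neg, fourier_neg, map_mul]

theorem torusChar_add (ξ ζ : ℤ × ℤ) (p : Torus2) :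
    torusChar (ξ + ζ) p = torusChar ξ p * torusChar ζ p := by
  simp only [torusChar_apply, Prod.fst_add, Prod.snd_add, fourier_add]
  ring

theorem norm_torusChar_apply (ξ : ℤ × ℤ) (p : Torus2) : ‖torusChar ξ p‖ = 1 := by
  simp only [torusChar_apply, fourier_apply, norm_mul, Circle.norm_coe, one_mul]

theorem norm_torusChar_le (ξ : ℤ × ℤ) : ‖torusChar ξ‖ ≤ 1 :=
  (ContinuousMap.norm_le _ zero_le_one).mpr fun p ↦ (norm_torusChar_apply ξ p).le

theorem fourierCoeff2_eq (f : Torus2 → ℝ) (ξ : ℤ × ℤ) :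
    fourierCoeff2 f ξ = (((2 * Real.pi) ^ 2)⁻¹ : ℝ) * ∫ p, torusChar (-ξ) p * (f p : ℂ) := rfl

theorem integral_fourier (n : ℤ) :
    ∫ x : AddCircle (2 * Real.pi), fourier n x = if n = 0 then ((2 * Real.pi : ℝ) : ℂ) else 0 := by
  have h := congrFun (fourierCoeff_fourier (T := 2 * Real.pi) n) 0
  rw [fourierCoeff, AddCircle.integral_haarAddCircle] at h
  simp only [neg_zero, fourier_zero, one_smul] at h
  have hpi : (2 * Real.pi) ≠ 0 := Real.two_pi_pos.ne'
  rw [inv_smul_eq_iff₀ hpi] at h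
  rw [h]
  by_cases hn : n = 0
  · subst hn; simp
  · rw [if_neg hn, Pi.single_eq_of_ne (Ne.symm hn), smul_zero]

theorem integral_torusChar (ξ : ℤ × ℤ) :
    ∫ p : Torus2, torusChar ξ p = if ξ = 0 then (((2 * Real.pi) ^ 2 : ℝ) : ℂ) else 0 := by
  simp only [torusChar_apply]
  have := integral_prod_mul (μ := (volume : Measure (AddCircle (2 * Real.pi))))
    (ν := (volume : Measure (AddCircle (2 * Real.pi))))
    (fun x ↦ (fourier ξ.1 x : ℂ)) (fun x ↦ (fourier ξ.2 x : ℂ))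
  rw [Measure.volume_eq_prod, this, integral_fourier, integral_fourier]
  rcases ξ with ⟨m, n⟩
  by_cases hm : m = 0 <;> by_cases hn : n = 0 <;> simp [hm, hn, pow_two]

/-- The characters as a star subalgebra of the continuous functions on the torus. -/
noncomputable def torusCharSubalgebra : StarSubalgebra ℂ C(Torus2, ℂ) where
  toSubalgebra := Algebra.adjoin ℂ (Set.range torusChar)
  star_mem' := by
    change Algebra.adjoin ℂ (Set.range torusChar) ≤ star (Algebra.adjoin ℂ (Set.range torusChar))
    refine Algebra.adjoin_le ?_
    rintro _ ⟨n, rfl⟩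
    refine Algebra.subset_adjoin ⟨-n, ?_⟩
    ext1 x
    simp only [torusChar_neg, starRingEnd_apply, ContinuousMap.star_apply]

theorem torusCharSubalgebra_coe :
    torusCharSubalgebra.toSubalgebra.toSubmodule = span ℂ (Set.range torusChar) := by
  apply Algebra.adjoin_eq_span_of_subset
  refine .trans (fun x ↦ Submonoid.closure_induction (fun _ ↦ id) ⟨0, ?_⟩ ?_) subset_span
  · ext z
    simp [torusChar_apply]
  · rintro _ _ _ _ ⟨m, rfl⟩ ⟨n, rfl⟩
    refine ⟨m + n, ?_⟩
    ext z
    simp [torusChar_add]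

theorem torusCharSubalgebra_separatesPoints : torusCharSubalgebra.SeparatesPoints := by
  intro x y hxy
  have hpi : (2 * Real.pi) ≠ 0 := Real.two_pi_pos.ne'
  by_cases h1 : x.1 = y.1
  · have h2 : x.2 ≠ y.2 := fun h ↦ hxy (Prod.ext h1 h)
    refine ⟨_, ⟨torusChar (0, 1), Algebra.subset_adjoin ⟨(0, 1), rfl⟩, rfl⟩, ?_⟩
    simp only [torusChar_apply, fourier_zero, fourier_one, one_mul, ne_eq]
    exact fun h ↦ h2 (AddCircle.injective_toCircle hpi (Subtype.coe_injective h))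
  · refine ⟨_, ⟨torusChar (1, 0), Algebra.subset_adjoin ⟨(1, 0), rfl⟩, rfl⟩, ?_⟩
    simp only [torusChar_apply, fourier_zero, fourier_one, mul_one, ne_eq]
    exact fun h ↦ h1 (AddCircle.injective_toCircle hpi (Subtype.coe_injective h))

/-- Stone–Weierstrass for the star algebra of trigonometric polynomials. -/
theorem span_torusChar_closure_eq_top :
    (span ℂ (Set.range torusChar)).topologicalClosure = ⊤ := by
  rw [← torusCharSubalgebra_coe]
  exact congr_arg (Subalgebra.toSubmodule <| StarSubalgebra.toSubalgebra ·)
    (ContinuousMap.starSubalgebra_topologicalClosure_eq_top_of_separatesPoints _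
      torusCharSubalgebra_separatesPoints)

/-- The characters normalised in `L²` of the torus. -/
noncomputable def torusCharLp (ξ : ℤ × ℤ) : Lp ℂ 2 (volume : Measure Torus2) :=
  ContinuousMap.toLp (E := ℂ) 2 volume ℂ (((2 * Real.pi : ℝ) : ℂ)⁻¹ • torusChar ξ)

theorem span_torusCharLp_closure_eq_top :
    (span ℂ (Set.range torusCharLp)).topologicalClosure = ⊤ := by
  have h := (ContinuousMap.toLp_denseRange ℂ (volume : Measure Torus2) ℂ
    (p := 2) (by simp)).topologicalClosure_map_submodule span_torusChar_closure_eq_top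
  rw [map_span, ← Set.range_comp] at h
  rw [← h]
  congr 1
  have hpi : ((2 * Real.pi : ℝ) : ℂ) ≠ 0 := by
    simp [Real.pi_ne_zero]
  apply le_antisymm
  · rw [span_le]
    rintro _ ⟨ξ, rfl⟩
    rw [torusCharLp, map_smul]
    exact smul_mem _ _ (subset_span ⟨ξ, rfl⟩)
  · rw [span_le]
    rintro _ ⟨ξ, rfl⟩
    have : (ContinuousMap.toLp (E := ℂ) 2 (volume : Measure Torus2) ℂ) (torusChar ξ) =
        (((2 * Real.pi : ℝ) : ℂ)) • torusCharLp ξ := by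
      rw [torusCharLp, map_smul, smul_smul, mul_inv_cancel₀ hpi, one_smul]
    show (ContinuousMap.toLp (E := ℂ) 2 (volume : Measure Torus2) ℂ) (torusChar ξ) ∈ _
    rw [this]
    exact smul_mem _ _ (subset_span ⟨ξ, rfl⟩)

theorem orthonormal_torusCharLp : Orthonormal ℂ torusCharLp := by
  rw [orthonormal_iff_ite]
  intro m n
  have hpi : ((2 * Real.pi : ℝ) : ℂ) ≠ 0 := by simp [Real.pi_ne_zero]
  rw [torusCharLp, torusCharLp, map_smul, map_smul, inner_smul_left, inner_smul_right,
    ContinuousMap.inner_toLp]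
  simp only [← torusChar_neg, ← torusChar_add]
  rw [integral_torusChar]
  by_cases h : m = n
  · subst h
    simp only [add_neg_cancel, if_true, map_inv₀, Complex.conj_ofReal]
    rw [Complex.ofReal_pow]
    field_simp
  · rw [if_neg h, if_neg]
    · simp
    · intro h'
      exact h (by rw [add_neg_eq_zero] at h'; exact h'.symm)

/-- The Hilbert basis of normalised characters of `L²` of the torus. -/
noncomputable def torusBasis : HilbertBasis (ℤ × ℤ) ℂ (Lp ℂ 2 (volume : Measure Torus2)) :=
  HilbertBasis.mk orthonormal_torusCharLp span_torusCharLp_closure_eq_top.ge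

theorem torusBasis_apply (ξ : ℤ × ℤ) : torusBasis ξ = torusCharLp ξ := by
  rw [torusBasis, HilbertBasis.coe_mk]

theorem coeFn_torusBasis (ξ : ℤ × ℤ) :
    torusBasis ξ =ᵐ[volume] fun p ↦ ((2 * Real.pi : ℝ) : ℂ)⁻¹ * torusChar ξ p := by
  rw [torusBasis_apply]
  exact ContinuousMap.coeFn_toLp (E := ℂ) (𝕜 := ℂ) (p := 2) (volume : Measure Torus2) _

theorem inner_torusBasis (ξ : ℤ × ℤ) (U : Lp ℂ 2 (volume : Measure Torus2)) :
    inner ℂ (torusBasis ξ) U = ((2 * Real.pi : ℝ) : ℂ)⁻¹ * ∫ p, torusChar (-ξ) p * U p := by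
  rw [L2.inner_def, ← integral_const_mul]
  apply integral_congr_ae
  filter_upwards [coeFn_torusBasis ξ] with p hp
  rw [hp, RCLike.inner_apply, map_mul, map_inv₀, Complex.conj_ofReal, torusChar_neg]
  ring

/-- A real `L²` function on the torus, viewed as a complex one. -/
noncomputable def complexify (u : L2Torus) : Lp ℂ 2 (volume : Measure Torus2) :=
  Complex.ofRealCLM.compLp u

theorem coeFn_complexify (u : L2Torus) : complexify u =ᵐ[volume] fun p ↦ ((u p : ℝ) : ℂ) :=
  Complex.ofRealCLM.coeFn_compLp u

theorem two_pi_ne_zero_complex : ((2 * Real.pi : ℝ) : ℂ) ≠ 0 := by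
  simp [Real.pi_ne_zero]

/-- The basis vectors carry the factor (2π)⁻¹ and the Fourier coefficients (2π)⁻², hence the
quotient 2π. -/
theorem fourierCoeff2_eq_inner (u : L2Torus) (ξ : ℤ × ℤ) :
    inner ℂ (torusBasis ξ) (complexify u) = ((2 * Real.pi : ℝ) : ℂ) * fourierCoeff2 u ξ := by
  rw [inner_torusBasis, fourierCoeff2_eq]
  have : ∫ p, torusChar (-ξ) p * complexify u p = ∫ p, torusChar (-ξ) p * ((u p : ℝ) : ℂ) := by
    apply integral_congr_ae
    filter_upwards [coeFn_complexify u] with p hp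
    rw [hp]
  rw [this, ← mul_assoc]
  congr 1
  have := two_pi_ne_zero_complex
  rw [Complex.ofReal_inv, Complex.ofReal_pow]
  field_simp

theorem fourierCoeff2_neg (f : Torus2 → ℝ) (ξ : ℤ × ℤ) :
    fourierCoeff2 f (-ξ) = conj (fourierCoeff2 f ξ) := by
  rw [fourierCoeff2_eq, fourierCoeff2_eq, map_mul, Complex.conj_ofReal, ← integral_conj]
  congr 2
  ext p
  rw [map_mul, Complex.conj_ofReal, torusChar_neg (-ξ)]

theorem complexify_sub (u v : L2Torus) : complexify (u - v) = complexify u - complexify v :=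
  map_sub (Complex.ofRealCLM.compLpL 2 volume) u v

theorem continuous_complexify : Continuous complexify :=
  (Complex.ofRealCLM.compLpL 2 (volume : Measure Torus2)).continuous

theorem fourierCoeff2_sub (u v : L2Torus) (ξ : ℤ × ℤ) :
    fourierCoeff2 (u - v : L2Torus) ξ = fourierCoeff2 u ξ - fourierCoeff2 v ξ := by
  apply mul_left_cancel₀ two_pi_ne_zero_complex
  rw [mul_sub, ← fourierCoeff2_eq_inner, ← fourierCoeff2_eq_inner, ← fourierCoeff2_eq_inner,
    complexify_sub, inner_sub_right]

theorem continuous_fourierCoeff2 (ξ : ℤ × ℤ) : Continuous fun u : L2Torus ↦ fourierCoeff2 u ξ := by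
  have h : Continuous fun u : L2Torus ↦
      (((2 * Real.pi : ℝ) : ℂ))⁻¹ * inner ℂ (torusBasis ξ) (complexify u) :=
    continuous_const.mul (continuous_const.inner continuous_complexify)
  refine h.congr fun u ↦ ?_
  rw [fourierCoeff2_eq_inner, ← mul_assoc, inv_mul_cancel₀ two_pi_ne_zero_complex, one_mul]

theorem norm_complexify (u : L2Torus) : ‖complexify u‖ = ‖u‖ := by
  rw [Lp.norm_def, Lp.norm_def]
  congr 1
  apply eLpNorm_congr_norm_ae
  filter_upwards [coeFn_complexify u] with p hp
  rw [hp, Complex.norm_real]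

theorem hasSum_sq_fourierCoeff2 (u : L2Torus) :
    HasSum (fun ξ ↦ ‖fourierCoeff2 u ξ‖ ^ 2) (((2 * Real.pi) ^ 2)⁻¹ * ‖u‖ ^ 2) := by
  have h := torusBasis.hasSum_inner_mul_inner (complexify u) (complexify u)
  rw [inner_self_eq_norm_sq_to_K, norm_complexify] at h
  have h2 : HasSum (fun ξ ↦ (((2 * Real.pi) ^ 2 * ‖fourierCoeff2 u ξ‖ ^ 2 : ℝ) : ℂ))
      ((‖u‖ ^ 2 : ℝ) : ℂ) := by
    rw [Complex.ofReal_pow]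
    refine h.congr_fun fun ξ ↦ ?_
    · rw [← inner_conj_symm, fourierCoeff2_eq_inner, map_mul, Complex.conj_ofReal]
      rw [mul_mul_mul_comm, mul_comm (conj _), Complex.mul_conj, Complex.normSq_eq_norm_sq]
      push_cast
      ring
  have h3 := (Complex.hasSum_ofReal.mp h2).mul_left (((2 * Real.pi) ^ 2)⁻¹)
  refine h3.congr_fun fun ξ ↦ ?_
  have : (2 * Real.pi) ≠ 0 := Real.two_pi_pos.ne'
  field_simp

theorem torusChar_memLp_mul (ξ : ℤ × ℤ) (u : L2Torus) :
    MemLp (fun p ↦ torusChar ξ p * ((u p : ℝ) : ℂ)) 2 (volume : Measure Torus2) := by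
  have hu : MemLp (fun p ↦ ((u p : ℝ) : ℂ)) 2 (volume : Measure Torus2) := (Lp.memLp u).ofReal
  refine hu.of_le ((torusChar ξ).continuous.aestronglyMeasurable.mul hu.1) ?_
  exact Eventually.of_forall fun p ↦ by rw [norm_mul, norm_torusChar_apply, one_mul]

/-- The Fourier coefficients of a square are the convolution of the Fourier coefficients. -/
theorem hasSum_fourierCoeff2_sq (u : L2Torus) (ξ : ℤ × ℤ) :
    HasSum (fun ζ ↦ fourierCoeff2 u ζ * fourierCoeff2 u (ξ - ζ))
      (fourierCoeff2 (fun p ↦ u p ^ 2) ξ) := by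
  -- Parseval for the pair (e^{iξ·x} u, u): their inner product is the integral of e^{-iξ·x} u², and
  -- the coefficients of the first factor are shifted coefficients of u.
  set G : Lp ℂ 2 (volume : Measure Torus2) := (torusChar_memLp_mul ξ u).toLp _ with hG
  have hGae : G =ᵐ[volume] fun p ↦ torusChar ξ p * ((u p : ℝ) : ℂ) := MemLp.coeFn_toLp _
  have hGc : ∀ ζ, inner ℂ G (torusBasis ζ) =
      ((2 * Real.pi : ℝ) : ℂ) * fourierCoeff2 u (ξ - ζ) := by
    intro ζ
    rw [← inner_conj_symm, inner_torusBasis, map_mul, map_inv₀, Complex.conj_ofReal,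
      ← neg_sub ζ ξ, fourierCoeff2_neg, fourierCoeff2_eq, map_mul, Complex.conj_ofReal, ← mul_assoc]
    congr 1
    · have := two_pi_ne_zero_complex
      rw [Complex.ofReal_inv, Complex.ofReal_pow]
      field_simp
    · congr 1
      apply integral_congr_ae
      filter_upwards [hGae] with p hp
      rw [hp, ← mul_assoc, ← torusChar_add]
      congr 3
      abel
  have h := torusBasis.hasSum_inner_mul_inner G (complexify u)
  have hI : inner ℂ G (complexify u) = ((2 * Real.pi : ℝ) : ℂ) ^ 2 *
      fourierCoeff2 (fun p ↦ u p ^ 2) ξ := by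
    have := two_pi_ne_zero_complex
    rw [fourierCoeff2_eq, ← mul_assoc, Complex.ofReal_inv, Complex.ofReal_pow,
      mul_inv_cancel₀ (pow_ne_zero 2 this), one_mul, L2.inner_def]
    apply integral_congr_ae
    filter_upwards [hGae, coeFn_complexify u] with p hp hp'
    rw [hp, hp', RCLike.inner_apply, map_mul, torusChar_neg, Complex.conj_ofReal]
    push_cast
    ring
  rw [hI] at h
  have h2 := h.mul_left ((((2 * Real.pi : ℝ) : ℂ) ^ 2)⁻¹)
  have hne := two_pi_ne_zero_complex
  rw [← mul_assoc, inv_mul_cancel₀ (pow_ne_zero 2 hne), one_mul] at h2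
  refine h2.congr_fun fun ζ ↦ ?_
  rw [hGc, fourierCoeff2_eq_inner]
  field_simp

theorem fourierCoeff2_odd (u : L2Torus) (hu : ∀ᵐ p : Torus2, u (-p.1, p.2) = -u p) (ξ : ℤ × ℤ) :
    fourierCoeff2 u (-ξ.1, ξ.2) = -fourierCoeff2 u ξ := by
  rw [fourierCoeff2_eq, fourierCoeff2_eq, ← mul_neg, ← integral_neg]
  congr 1
  have hmp : MeasurePreserving (fun p : Torus2 ↦ (-p.1, p.2)) volume volume := by
    have := (Measure.measurePreserving_neg (volume : Measure (AddCircle (2 * Real.pi)))).prod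
      (MeasurePreserving.id (volume : Measure (AddCircle (2 * Real.pi))))
    exact this
  have hemb : MeasurableEmbedding (fun p : Torus2 ↦ (-p.1, p.2)) :=
    ((MeasurableEquiv.neg (AddCircle (2 * Real.pi))).prodCongr
      (MeasurableEquiv.refl (AddCircle (2 * Real.pi)))).measurableEmbedding
  rw [← hmp.integral_comp hemb]
  apply integral_congr_ae
  filter_upwards [hu] with p hp
  rw [hp]
  push_cast
  rw [← mul_neg]
  congr 1
  simp [torusChar_apply, fourier_apply]

theorem summable_norm_torusChar {c : ℤ × ℤ → ℂ} (hc : Summable fun ξ ↦ ‖c ξ‖) :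
    Summable fun ξ ↦ c ξ • torusChar ξ := by
  refine Summable.of_norm_bounded hc fun ξ ↦ ?_
  rw [norm_smul]
  exact mul_le_of_le_one_right (norm_nonneg _) (norm_torusChar_le ξ)

/-- A function with absolutely summable Fourier coefficients is the sum of its Fourier series. -/
theorem ae_eq_tsum_torusChar (u : L2Torus) (hu : Summable fun ξ ↦ ‖fourierCoeff2 u ξ‖) :
    ∀ᵐ p : Torus2, ((u p : ℝ) : ℂ) = ∑' ξ, fourierCoeff2 u ξ * torusChar ξ p := by
  have h1 : HasSum (fun ξ ↦ torusBasis.repr (complexify u) ξ • torusBasis ξ) (complexify u) :=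
    torusBasis.hasSum_repr (complexify u)
  have hs := summable_norm_torusChar hu
  have h2 := (ContinuousMap.toLp (E := ℂ) 2 (volume : Measure Torus2) ℂ).hasSum hs.hasSum
  have h3 : ∀ ξ, (ContinuousMap.toLp (E := ℂ) 2 (volume : Measure Torus2) ℂ)
      (fourierCoeff2 u ξ • torusChar ξ) = torusBasis.repr (complexify u) ξ • torusBasis ξ := by
    intro ξ
    rw [HilbertBasis.repr_apply_apply, fourierCoeff2_eq_inner, torusBasis_apply, torusCharLp,
      map_smul, map_smul, smul_smul]
    congr 1
    have := two_pi_ne_zero_complex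
    field_simp
  simp only [h3] at h2
  -- The same series converges to u in L² and uniformly to a continuous function, so the two limits
  -- agree almost everywhere.
  have h4 := h1.unique h2
  have h5 := ContinuousMap.coeFn_toLp (E := ℂ) (𝕜 := ℂ) (p := 2) (volume : Measure Torus2)
    (∑' ξ, fourierCoeff2 u ξ • torusChar ξ)
  rw [← h4] at h5
  filter_upwards [coeFn_complexify u, h5] with p hp hp'
  rw [← hp, hp']
  exact ((ContinuousMap.evalCLM ℂ p).hasSum hs.hasSum).tsum_eq.symm

end FourierBasis

/-! ### Frequency weights, the embedding into ℓ¹ and the trilinear estimate -/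

theorem freqNorm_eq_norm (ξ : ℤ × ℤ) : freqNorm ξ = ‖((ξ.1 : ℝ) : ℂ) + ((ξ.2 : ℝ) : ℂ) * Complex.I‖ := by
  rw [Complex.norm_add_mul_I, freqNorm]

theorem freqNorm_nonneg (ξ : ℤ × ℤ) : 0 ≤ freqNorm ξ := Real.sqrt_nonneg _

theorem freqNorm_add_le (ξ ζ : ℤ × ℤ) : freqNorm (ξ + ζ) ≤ freqNorm ξ + freqNorm ζ := by
  rw [freqNorm_eq_norm, freqNorm_eq_norm, freqNorm_eq_norm]
  refine le_trans (le_of_eq ?_) (norm_add_le _ _)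
  congr 1
  simp only [Prod.fst_add, Prod.snd_add]
  push_cast
  ring

theorem abs_fst_le_freqNorm (ξ : ℤ × ℤ) : |(ξ.1 : ℝ)| ≤ freqNorm ξ :=
  Real.abs_le_sqrt (by nlinarith [sq_nonneg (ξ.2 : ℝ)])

theorem abs_snd_le_freqNorm (ξ : ℤ × ℤ) : |(ξ.2 : ℝ)| ≤ freqNorm ξ :=
  Real.abs_le_sqrt (by nlinarith [sq_nonneg (ξ.1 : ℝ)])

/-- The inhomogeneous frequency weight `1 + |ξ|`. -/
noncomputable def freqWeight (ξ : ℤ × ℤ) : ℝ := 1 + freqNorm ξ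

theorem one_le_freqWeight (ξ : ℤ × ℤ) : 1 ≤ freqWeight ξ := by
  have := freqNorm_nonneg ξ
  unfold freqWeight; linarith

theorem freqWeight_pos (ξ : ℤ × ℤ) : 0 < freqWeight ξ := zero_lt_one.trans_le (one_le_freqWeight ξ)

theorem freqNorm_le_freqWeight (ξ : ℤ × ℤ) : freqNorm ξ ≤ freqWeight ξ := by
  unfold freqWeight; linarith

theorem summable_one_add_abs_int_rpow {p : ℝ} (hp : p < -1) :
    Summable fun m : ℤ ↦ (1 + |(m : ℝ)|) ^ p := by
  have h : Summable fun n : ℕ ↦ (1 + (n : ℝ)) ^ p := by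
    have := (summable_nat_add_iff 1).mpr (Real.summable_nat_rpow.mpr hp)
    refine this.congr fun n ↦ ?_
    push_cast
    rw [add_comm]
  refine Summable.of_nat_of_neg ?_ ?_ <;> simpa using h

/-- The weight dominates both 1 + |ξ₁| and 1 + |ξ₂|, so its power -3 splits into a product of two
summable powers -3/2. The exponent 3 exceeds the dimension 2 but stays below the order 4 of the
dissipation. -/
theorem summable_freqWeight_inv_cube : Summable fun ξ : ℤ × ℤ ↦ (freqWeight ξ ^ 3)⁻¹ := by
  have h1 := summable_one_add_abs_int_rpow (p := -(3 / 2)) (by norm_num)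
  have h2 := h1.mul_of_nonneg h1 (fun m ↦ by positivity) (fun m ↦ by positivity)
  refine Summable.of_nonneg_of_le (fun ξ ↦ by have := freqWeight_pos ξ; positivity) (fun ξ ↦ ?_) h2
  have hm : 1 + |(ξ.1 : ℝ)| ≤ freqWeight ξ := by
    have := abs_fst_le_freqNorm ξ; unfold freqWeight; linarith
  have hn : 1 + |(ξ.2 : ℝ)| ≤ freqWeight ξ := by
    have := abs_snd_le_freqNorm ξ; unfold freqWeight; linarith
  have hW := freqWeight_pos ξ
  have e : (freqWeight ξ ^ 3)⁻¹ =
      freqWeight ξ ^ (-(3 / 2) : ℝ) * freqWeight ξ ^ (-(3 / 2) : ℝ) := by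
    rw [← Real.rpow_add hW, ← Real.rpow_natCast, ← Real.rpow_neg hW.le]
    norm_num
  rw [e]
  gcongr ?_ * ?_
  · exact Real.rpow_le_rpow_of_nonpos (by positivity) hm (by norm_num)
  · exact Real.rpow_le_rpow_of_nonpos (by positivity) hn (by norm_num)

section CauchySchwarz

variable {ι : Type*}

theorem summable_mul_of_sq {f g : ι → ℝ} (hf : Summable fun i ↦ f i ^ 2)
    (hg : Summable fun i ↦ g i ^ 2) : Summable fun i ↦ f i * g i := by
  refine Summable.of_norm_bounded (hf.add hg) fun i ↦ ?_
  rw [Real.norm_eq_abs, abs_mul, ← sq_abs (f i), ← sq_abs (g i)]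
  nlinarith [sq_nonneg (|f i| - |g i|), sq_nonneg (|f i|), sq_nonneg (|g i|)]

theorem tsum_mul_le_sqrt_mul_sqrt {f g : ι → ℝ} (hf : Summable fun i ↦ f i ^ 2)
    (hg : Summable fun i ↦ g i ^ 2) :
    ∑' i, f i * g i ≤ √(∑' i, f i ^ 2) * √(∑' i, g i ^ 2) := by
  refine (summable_mul_of_sq hf hg).tsum_le_of_sum_le fun s ↦ ?_
  refine (Real.sum_mul_le_sqrt_mul_sqrt s f g).trans ?_
  gcongr
  · exact hf.sum_le_tsum s fun i _ ↦ sq_nonneg _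
  · exact hg.sum_le_tsum s fun i _ ↦ sq_nonneg _

end CauchySchwarz

/-- The sum `∑ (1 + |ξ|)⁻³`. -/
noncomputable def weightConst : ℝ := ∑' ξ : ℤ × ℤ, (freqWeight ξ ^ 3)⁻¹

theorem sqrt_weight_aux (b : ℤ × ℤ → ℝ) (ξ : ℤ × ℤ) :
    √((freqWeight ξ ^ 3)⁻¹) * (√(freqWeight ξ ^ 3) * b ξ) = b ξ := by
  have h : 0 < √(freqWeight ξ ^ 3) := Real.sqrt_pos.mpr (pow_pos (freqWeight_pos ξ) 3)
  rw [Real.sqrt_inv, ← mul_assoc, inv_mul_cancel₀ h.ne', one_mul]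

theorem summable_of_summable_weight {b : ℤ × ℤ → ℝ}
    (hb : Summable fun ξ ↦ freqWeight ξ ^ 3 * b ξ ^ 2) : Summable b := by
  have h1 : Summable fun ξ ↦ √((freqWeight ξ ^ 3)⁻¹) ^ 2 :=
    summable_freqWeight_inv_cube.congr fun ξ ↦ by
      have := freqWeight_pos ξ
      rw [Real.sq_sqrt (by positivity)]
  have h2 : Summable fun ξ ↦ (√(freqWeight ξ ^ 3) * b ξ) ^ 2 := hb.congr fun ξ ↦ by
    have := freqWeight_pos ξ
    rw [mul_pow, Real.sq_sqrt (by positivity)]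
  exact (summable_mul_of_sq h1 h2).congr fun ξ ↦ sqrt_weight_aux b ξ

/-- Cauchy–Schwarz against the summable weight: the embedding of H^{3/2} into functions with
absolutely convergent Fourier series. -/
theorem tsum_le_sqrt_weight {b : ℤ × ℤ → ℝ}
    (hb : Summable fun ξ ↦ freqWeight ξ ^ 3 * b ξ ^ 2) :
    ∑' ξ, b ξ ≤ √weightConst * √(∑' ξ, freqWeight ξ ^ 3 * b ξ ^ 2) := by
  have e1 : ∀ ξ, √((freqWeight ξ ^ 3)⁻¹) ^ 2 = (freqWeight ξ ^ 3)⁻¹ := fun ξ ↦ by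
    have := freqWeight_pos ξ
    rw [Real.sq_sqrt (by positivity)]
  have e2 : ∀ ξ, (√(freqWeight ξ ^ 3) * b ξ) ^ 2 = freqWeight ξ ^ 3 * b ξ ^ 2 := fun ξ ↦ by
    have := freqWeight_pos ξ
    rw [mul_pow, Real.sq_sqrt (by positivity)]
  have h := tsum_mul_le_sqrt_mul_sqrt (f := fun ξ ↦ √((freqWeight ξ ^ 3)⁻¹))
    (g := fun ξ ↦ √(freqWeight ξ ^ 3) * b ξ) (summable_freqWeight_inv_cube.congr fun ξ ↦ (e1 ξ).symm)
    (hb.congr fun ξ ↦ (e2 ξ).symm)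
  rw [weightConst]
  simpa only [e1, e2, sqrt_weight_aux] using h

section Trilinear

variable {f d g : ℤ × ℤ → ℝ}

theorem summable_shift_sq (hg : Summable fun ξ ↦ g ξ ^ 2) (ζ : ℤ × ℤ) :
    Summable fun ξ ↦ g (ξ - ζ) ^ 2 :=
  (Equiv.subRight ζ).summable_iff.mpr hg

theorem tsum_shift_sq (ζ : ℤ × ℤ) : ∑' ξ, g (ξ - ζ) ^ 2 = ∑' ξ, g ξ ^ 2 :=
  (Equiv.subRight ζ).tsum_eq fun ξ ↦ g ξ ^ 2

theorem tsum_mul_shift_le (hf : Summable fun ξ ↦ f ξ ^ 2) (hg : Summable fun ξ ↦ g ξ ^ 2)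
    (ζ : ℤ × ℤ) : ∑' ξ, f ξ * g (ξ - ζ) ≤ √(∑' ξ, f ξ ^ 2) * √(∑' ξ, g ξ ^ 2) := by
  have h := tsum_mul_le_sqrt_mul_sqrt hf (summable_shift_sq hg ζ)
  rwa [tsum_shift_sq] at h

theorem summable_trilinear_swap (hf0 : ∀ ξ, 0 ≤ f ξ) (hd0 : ∀ ξ, 0 ≤ d ξ) (hg0 : ∀ ξ, 0 ≤ g ξ)
    (hf : Summable fun ξ ↦ f ξ ^ 2) (hd : Summable d) (hg : Summable fun ξ ↦ g ξ ^ 2) :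
    Summable fun p : (ℤ × ℤ) × (ℤ × ℤ) ↦ d p.1 * (f p.2 * g (p.2 - p.1)) := by
  rw [summable_prod_of_nonneg fun p ↦ mul_nonneg (hd0 _) (mul_nonneg (hf0 _) (hg0 _))]
  refine ⟨fun ζ ↦ ?_, ?_⟩
  · exact Summable.mul_left (d ζ) (summable_mul_of_sq hf (summable_shift_sq hg ζ))
  dsimp only
  refine Summable.of_nonneg_of_le (fun ζ ↦ tsum_nonneg fun ξ ↦
    mul_nonneg (hd0 _) (mul_nonneg (hf0 _) (hg0 _))) (fun ζ ↦ ?_)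
    (hd.mul_right (√(∑' ξ, f ξ ^ 2) * √(∑' ξ, g ξ ^ 2)))
  rw [tsum_mul_left]
  exact mul_le_mul_of_nonneg_left (tsum_mul_shift_le hf hg ζ) (hd0 ζ)

theorem summable_trilinear (hf0 : ∀ ξ, 0 ≤ f ξ) (hd0 : ∀ ξ, 0 ≤ d ξ) (hg0 : ∀ ξ, 0 ≤ g ξ)
    (hf : Summable fun ξ ↦ f ξ ^ 2) (hd : Summable d) (hg : Summable fun ξ ↦ g ξ ^ 2) :
    Summable fun p : (ℤ × ℤ) × (ℤ × ℤ) ↦ f p.1 * (d p.2 * g (p.1 - p.2)) := by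
  have h := (Equiv.prodComm _ _).summable_iff.mpr (summable_trilinear_swap hf0 hd0 hg0 hf hd hg)
  refine h.congr fun p ↦ ?_
  simp only [Function.comp, Equiv.prodComm_apply, Prod.fst_swap, Prod.snd_swap]
  ring

/-- Young's inequality in trilinear form: `∑ f (d * g) ≤ ‖f‖₂ ‖d‖₁ ‖g‖₂`. -/
theorem tsum_trilinear_le (hf0 : ∀ ξ, 0 ≤ f ξ) (hd0 : ∀ ξ, 0 ≤ d ξ) (hg0 : ∀ ξ, 0 ≤ g ξ)
    (hf : Summable fun ξ ↦ f ξ ^ 2) (hd : Summable d) (hg : Summable fun ξ ↦ g ξ ^ 2) :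
    ∑' ξ, f ξ * ∑' ζ, d ζ * g (ξ - ζ) ≤
      √(∑' ξ, f ξ ^ 2) * (∑' ξ, d ξ) * √(∑' ξ, g ξ ^ 2) := by
  have h1 := summable_trilinear hf0 hd0 hg0 hf hd hg
  have h2 := summable_trilinear_swap hf0 hd0 hg0 hf hd hg
  -- Summing over ξ first leaves, for each fixed ζ, a Cauchy–Schwarz estimate independent of ζ.
  have e : ∑' ξ, f ξ * ∑' ζ, d ζ * g (ξ - ζ) = ∑' ζ, d ζ * ∑' ξ, f ξ * g (ξ - ζ) := by
    simp only [← tsum_mul_left]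
    rw [← h1.tsum_prod, ← h2.tsum_prod, ← (Equiv.prodComm _ _).tsum_eq]
    refine tsum_congr fun p ↦ ?_
    simp only [Equiv.prodComm_apply, Prod.fst_swap, Prod.snd_swap]
    ring
  rw [e]
  have hle : ∀ ζ, d ζ * ∑' ξ, f ξ * g (ξ - ζ) ≤
      d ζ * (√(∑' ξ, f ξ ^ 2) * √(∑' ξ, g ξ ^ 2)) := fun ζ ↦
    mul_le_mul_of_nonneg_left (tsum_mul_shift_le hf hg ζ) (hd0 ζ)
  have h3 : Summable fun ζ ↦ d ζ * ∑' ξ, f ξ * g (ξ - ζ) := by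
    refine h2.prod.congr fun ζ ↦ ?_
    simp only [tsum_mul_left]
  refine (h3.tsum_le_tsum hle (hd.mul_right _)).trans (le_of_eq ?_)
  rw [tsum_mul_right]
  ring

theorem summable_mul_conv (hf0 : ∀ ξ, 0 ≤ f ξ) (hd0 : ∀ ξ, 0 ≤ d ξ) (hg0 : ∀ ξ, 0 ≤ g ξ)
    (hf : Summable fun ξ ↦ f ξ ^ 2) (hd : Summable d) (hg : Summable fun ξ ↦ g ξ ^ 2) :
    Summable fun ξ ↦ f ξ * ∑' ζ, d ζ * g (ξ - ζ) := by
  refine (summable_trilinear hf0 hd0 hg0 hf hd hg).prod.congr fun ξ ↦ ?_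
  simp only [tsum_mul_left]

end Trilinear

/-! ### Bounds on the linear symbol -/

theorem exists_cube_le (P : ℝ) (hP : 0 ≤ P) {ε : ℝ} (hε : 0 < ε) :
    ∃ K : ℝ, 0 ≤ K ∧ ∀ x : ℝ, 0 ≤ x → P * (1 + x) ^ 3 ≤ K + ε * x ^ 4 := by
  -- The first summand covers 1 + x ≤ 8P/ε. Beyond that, P(1+x)³ ≤ (ε/8)(1+x)⁴ ≤ ε(1+x⁴), which
  -- accounts for the second.
  refine ⟨P * (8 * P / ε) ^ 3 + ε, by positivity, fun x hx ↦ ?_⟩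
  have h4 : (1 + x) ^ 4 ≤ 8 * (1 + x ^ 4) := by
    nlinarith [sq_nonneg (x - 1), sq_nonneg (x ^ 2 - 1), sq_nonneg (x ^ 2 - x),
      mul_nonneg hx (sq_nonneg (x - 1))]
  rcases le_or_gt (1 + x) (8 * P / ε) with h | h
  · have : P * (1 + x) ^ 3 ≤ P * (8 * P / ε) ^ 3 := by gcongr
    have : 0 ≤ ε * x ^ 4 := by positivity
    linarith
  · rw [div_lt_iff₀ hε] at h
    have h1 : P * (1 + x) ^ 3 ≤ ((1 + x) * ε / 8) * (1 + x) ^ 3 := by gcongr; linarith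
    have h2 : ε * (1 + x) ^ 4 ≤ ε * (8 * (1 + x ^ 4)) := by gcongr
    have : 0 ≤ P * (8 * P / ε) ^ 3 := by positivity
    nlinarith

theorem linearSymbol_le (ε β δ : ℝ) (hδ : 0 ≤ δ) (ξ : ℤ × ℤ) :
    linearSymbol ε β δ ξ ≤ (|β - 1| + δ) * freqWeight ξ ^ 3 - ε * freqNorm ξ ^ 4 := by
  have h1 : (β - 1) * (ξ.1 : ℝ) ^ 2 ≤ |β - 1| * freqWeight ξ ^ 3 := by
    have hW := one_le_freqWeight ξ
    have : (ξ.1 : ℝ) ^ 2 ≤ freqWeight ξ ^ 3 := by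
      calc (ξ.1 : ℝ) ^ 2 = |(ξ.1 : ℝ)| ^ 2 := (sq_abs _).symm
        _ ≤ freqWeight ξ ^ 2 := by
          gcongr; exact (abs_fst_le_freqNorm ξ).trans (freqNorm_le_freqWeight ξ)
        _ ≤ freqWeight ξ ^ 3 := pow_le_pow_right₀ hW (by norm_num)
    exact mul_le_mul (le_abs_self _) this (sq_nonneg _) (abs_nonneg _)
  have h2 : δ * freqNorm ξ ^ 3 ≤ δ * freqWeight ξ ^ 3 := by
    have := freqNorm_nonneg ξ
    gcongr; exact freqNorm_le_freqWeight ξ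
  unfold linearSymbol
  nlinarith [sq_nonneg (ξ.2 : ℝ)]

/-- Half of the dissipation absorbs every term of order at most three. The other half is kept, since
the energy bound needs it against the Dirichlet kernel error. -/
theorem exists_linearSymbol_le (β δ : ℝ) {ε : ℝ} (hε : 0 < ε) (hδ : 0 ≤ δ) (P : ℝ) (hP : 0 ≤ P) :
    ∃ K : ℝ, 0 ≤ K ∧ ∀ ξ, linearSymbol ε β δ ξ + P * freqWeight ξ ^ 3 ≤
      K - ε / 2 * freqNorm ξ ^ 4 := by
  obtain ⟨K, hK, h⟩ := exists_cube_le (|β - 1| + δ + P) (by positivity) (half_pos hε)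
  refine ⟨K, hK, fun ξ ↦ ?_⟩
  have h1 := h (freqNorm ξ) (freqNorm_nonneg ξ)
  have h2 := linearSymbol_le ε β δ hδ ξ
  unfold freqWeight at *
  nlinarith

/-- Serves only to sum series containing the symbol, with the H² bound as majorant. -/
theorem abs_linearSymbol_le (ε β δ : ℝ) (ξ : ℤ × ℤ) :
    |linearSymbol ε β δ ξ| ≤ (|β - 1| + 1 + |δ| + |ε|) * freqWeight ξ ^ 4 := by
  have hW := one_le_freqWeight ξ
  have hN := freqNorm_nonneg ξ
  have hNW := freqNorm_le_freqWeight ξ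
  have h24 : freqWeight ξ ^ 2 ≤ freqWeight ξ ^ 4 := pow_le_pow_right₀ hW (by norm_num)
  have h34 : freqWeight ξ ^ 3 ≤ freqWeight ξ ^ 4 := pow_le_pow_right₀ hW (by norm_num)
  have h1 : |(β - 1) * (ξ.1 : ℝ) ^ 2| ≤ |β - 1| * freqWeight ξ ^ 4 := by
    rw [abs_mul, abs_pow]
    gcongr
    exact (pow_le_pow_left₀ (abs_nonneg _) ((abs_fst_le_freqNorm ξ).trans hNW) 2).trans h24
  have h2 : |(ξ.2 : ℝ) ^ 2| ≤ 1 * freqWeight ξ ^ 4 := by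
    rw [abs_pow, one_mul]
    exact (pow_le_pow_left₀ (abs_nonneg _) ((abs_snd_le_freqNorm ξ).trans hNW) 2).trans h24
  have h3 : |δ * freqNorm ξ ^ 3| ≤ |δ| * freqWeight ξ ^ 4 := by
    rw [abs_mul, abs_of_nonneg (pow_nonneg hN 3)]
    gcongr
    exact (pow_le_pow_left₀ hN hNW 3).trans h34
  have h4 : |ε * freqNorm ξ ^ 4| ≤ |ε| * freqWeight ξ ^ 4 := by
    rw [abs_mul, abs_of_nonneg (pow_nonneg hN 4)]
    gcongr
  unfold linearSymbol
  have a1 := abs_sub ((β - 1) * (ξ.1 : ℝ) ^ 2 - (ξ.2 : ℝ) ^ 2 + δ * freqNorm ξ ^ 3)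
    (ε * freqNorm ξ ^ 4)
  have a2 := abs_add_le ((β - 1) * (ξ.1 : ℝ) ^ 2 - (ξ.2 : ℝ) ^ 2) (δ * freqNorm ξ ^ 3)
  have a3 := abs_sub ((β - 1) * (ξ.1 : ℝ) ^ 2) ((ξ.2 : ℝ) ^ 2)
  linarith

/-! ### Differential inequalities in integrated form -/

/-- `y` is a primitive of the integrable function `G` on `[a, b]`. -/
def IsPrimitiveOn (y G : ℝ → ℝ) (a b : ℝ) : Prop :=
  IntervalIntegrable G volume a b ∧ ∀ t ∈ Set.Icc a b, y t = y a + ∫ s in a..t, G s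

namespace IsPrimitiveOn

variable {y G z H : ℝ → ℝ} {a b : ℝ}

theorem continuousOn (h : IsPrimitiveOn y G a b) (hab : a ≤ b) : ContinuousOn y (Set.Icc a b) := by
  have h1 : ContinuousOn (fun t ↦ y a + ∫ s in a..t, G s) (Set.Icc a b) := by
    refine continuousOn_const.add ?_
    have := intervalIntegral.continuousOn_primitive_interval (f := G) (μ := volume) (a := a) (b := b)
      (by rw [← intervalIntegrable_iff']; exact h.1)
    rwa [Set.uIcc_of_le hab] at this
  exact h1.congr fun t ht ↦ h.2 t ht

theorem mono (h : IsPrimitiveOn y G a b) {c : ℝ} (hc : c ∈ Set.Icc a b) :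
    IntervalIntegrable G volume a c :=
  h.1.mono_set (by
    rw [Set.uIcc_of_le hc.1, Set.uIcc_of_le (hc.1.trans hc.2)]
    exact Set.Icc_subset_Icc_right hc.2)

theorem sub_eq (h : IsPrimitiveOn y G a b) {s t : ℝ} (hs : s ∈ Set.Icc a b)
    (ht : t ∈ Set.Icc a b) :
    IntervalIntegrable G volume s t ∧ y t - y s = ∫ r in s..t, G r := by
  have h1 := h.mono hs
  have h2 := h.mono ht
  refine ⟨h1.symm.trans h2, ?_⟩
  rw [h.2 t ht, h.2 s hs, ← intervalIntegral.integral_interval_sub_left h2 h1]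
  ring

theorem add (h : IsPrimitiveOn y G a b) (h' : IsPrimitiveOn z H a b) :
    IsPrimitiveOn (fun t ↦ y t + z t) (fun t ↦ G t + H t) a b := by
  refine ⟨h.1.add h'.1, fun t ht ↦ ?_⟩
  dsimp only
  rw [intervalIntegral.integral_add (h.mono ht) (h'.mono ht), h.2 t ht, h'.2 t ht]
  ring

theorem of_hasDerivAt (hab : a ≤ b) (hy : ContinuousOn y (Set.Icc a b))
    (hG : ContinuousOn G (Set.Icc a b)) (hd : ∀ t ∈ Set.Ioo a b, HasDerivAt y (G t) t) :
    IsPrimitiveOn y G a b := by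
  have key : ∀ t ∈ Set.Icc a b, IntervalIntegrable G volume a t := fun t ht ↦ by
    apply ContinuousOn.intervalIntegrable
    rw [Set.uIcc_of_le ht.1]
    exact hG.mono (Set.Icc_subset_Icc_right ht.2)
  refine ⟨key b ⟨hab, le_rfl⟩, fun t ht ↦ ?_⟩
  rw [intervalIntegral.integral_eq_sub_of_hasDerivAt_of_le ht.1
    (hy.mono (Set.Icc_subset_Icc_right ht.2))
    (fun s hs ↦ hd s ⟨hs.1, hs.2.trans_le ht.2⟩) (key t ht)]
  ring

/-- Sum and integral are exchanged by a uniform bound on ∑ |g i|. Energies are infinite series, and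
this form avoids differentiating them term by term. -/
theorem tsum {ι : Type*} [Countable ι] {f g : ι → ℝ → ℝ} {B : ℝ} (hab : a ≤ b)
    (hfg : ∀ i, IsPrimitiveOn (f i) (g i) a b)
    (hfs : ∀ t ∈ Set.Icc a b, Summable fun i ↦ f i t)
    (hgs : ∀ t ∈ Set.Icc a b, Summable fun i ↦ |g i t|)
    (hgB : ∀ t ∈ Set.Icc a b, ∑' i, |g i t| ≤ B) :
    IsPrimitiveOn (fun t ↦ ∑' i, f i t) (fun t ↦ ∑' i, g i t) a b := by
  have main : ∀ t ∈ Set.Icc a b, IntervalIntegrable (fun t ↦ ∑' i, g i t) volume a t ∧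
      ∑' i, f i t = (∑' i, f i a) + ∫ s in a..t, ∑' i, g i s := by
    intro t ht
    have hI : ∀ i, Integrable (g i) (volume.restrict (Set.Ioc a t)) := fun i ↦
      (intervalIntegrable_iff_integrableOn_Ioc_of_le ht.1).mp ((hfg i).mono ht)
    have hS : Summable fun i ↦ ∫ s in Set.Ioc a t, ‖g i s‖ := by
      refine summable_of_sum_le (c := B * (t - a))
        (fun i ↦ integral_nonneg fun s ↦ norm_nonneg _) fun u ↦ ?_
      rw [← integral_finsetSum _ fun i _ ↦ (hI i).norm]
      have h1 : ∫ s in Set.Ioc a t, ∑ i ∈ u, ‖g i s‖ ≤ ∫ _ in Set.Ioc a t, B := by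
        refine setIntegral_mono_on (integrable_finsetSum _ fun i _ ↦ (hI i).norm)
          (integrable_const _) measurableSet_Ioc fun s hs ↦ ?_
        have hs' : s ∈ Set.Icc a b := ⟨hs.1.le, hs.2.trans ht.2⟩
        exact ((hgs s hs').sum_le_tsum u fun i _ ↦ abs_nonneg _).trans (hgB s hs')
      refine h1.trans (le_of_eq ?_)
      simp [ht.1, mul_comm]
    have hH := hasSum_integral_of_summable_integral_norm hI hS
    have hmeas : Integrable (fun s ↦ ∑' i, g i s) (volume.restrict (Set.Ioc a t)) := by
      refine Integrable.mono' (integrable_const B) ?_ ?_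
      · refine aestronglyMeasurable_of_tendsto_ae (atTop : Filter (Finset ι))
          (f := fun u s ↦ ∑ i ∈ u, g i s)
          (fun u ↦ Finset.aestronglyMeasurable_fun_sum u fun i _ ↦ (hI i).1) ?_
        refine (ae_restrict_iff' measurableSet_Ioc).mpr (Eventually.of_forall fun s hs ↦ ?_)
        exact ((hgs s ⟨hs.1.le, hs.2.trans ht.2⟩).of_abs).hasSum
      · refine (ae_restrict_iff' measurableSet_Ioc).mpr (Eventually.of_forall fun s hs ↦ ?_)
        have hs' : s ∈ Set.Icc a b := ⟨hs.1.le, hs.2.trans ht.2⟩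
        have h1 : Summable fun i ↦ ‖g i s‖ := hgs s hs'
        have h2 : ∑' i, ‖g i s‖ ≤ B := hgB s hs'
        exact (norm_tsum_le_tsum_norm h1).trans h2
    refine ⟨(intervalIntegrable_iff_integrableOn_Ioc_of_le ht.1).mpr hmeas, ?_⟩
    rw [intervalIntegral.integral_of_le ht.1, ← hH.tsum_eq]
    have e : ∀ i, ∫ s in Set.Ioc a t, g i s = f i t - f i a := fun i ↦ by
      rw [← intervalIntegral.integral_of_le ht.1, (hfg i).2 t ht]
      ring
    simp only [e]
    rw [(hfs t ht).tsum_sub (hfs a ⟨le_rfl, hab⟩)]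
    ring
  exact ⟨(main b ⟨hab, le_rfl⟩).1, fun t ht ↦ (main t ht).2⟩

/-- A quantity that does not increase above the level `M` stays below `M`. -/
theorem le_of_nonpos_above (h : IsPrimitiveOn y G a b) {M : ℝ} (ha : y a ≤ M)
    (hG : ∀ t ∈ Set.Icc a b, M < y t → G t ≤ 0) {t : ℝ} (ht : t ∈ Set.Icc a b) : y t ≤ M := by
  by_contra! hlt
  have hcont : ContinuousOn y (Set.Icc a t) :=
    (h.continuousOn (ht.1.trans ht.2)).mono (Set.Icc_subset_Icc_right ht.2)
  -- After the last time s in `S` the function stays above `M`, so it cannot increase from s to t.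
  set S := {s ∈ Set.Icc a t | y s ≤ M} with hS
  have hSc : IsClosed S := hcont.preimage_isClosed_of_isClosed isClosed_Icc isClosed_Iic
  have hScomp : IsCompact S := isCompact_Icc.of_isClosed_subset hSc fun s hs ↦ hs.1
  have hne : S.Nonempty := ⟨a, ⟨le_rfl, ht.1⟩, ha⟩
  obtain ⟨s, hsS, hmax⟩ := hScomp.exists_isGreatest hne
  have hsab : s ∈ Set.Icc a b := ⟨hsS.1.1, hsS.1.2.trans ht.2⟩
  obtain ⟨hI, he⟩ := h.sub_eq hsab ht
  have : ∫ r in s..t, G r ≤ 0 := by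
    rw [intervalIntegral.integral_of_le hsS.1.2]
    refine setIntegral_nonpos measurableSet_Ioc fun r hr ↦ hG r ⟨hsab.1.trans hr.1.le,
      hr.2.trans ht.2⟩ ?_
    by_contra! hr'
    exact absurd (hmax ⟨⟨hsab.1.trans hr.1.le, hr.2⟩, hr'⟩) (not_le.mpr hr.1)
  linarith [hsS.2]

/-- A quantity whose growth rate is at most `M` while it is below `B` stays below `B` for the time
it needs to get there. -/
theorem le_of_le_below (h : IsPrimitiveOn y G a b) {M B₀ B : ℝ} (hM : 0 ≤ M) (ha : y a ≤ B₀)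
    (hG : ∀ t ∈ Set.Icc a b, y t ≤ B → G t ≤ M) (hB : B₀ + M * (b - a) < B) {t : ℝ}
    (ht : t ∈ Set.Icc a b) : y t ≤ B := by
  by_contra! hlt
  have hcont : ContinuousOn y (Set.Icc a t) :=
    (h.continuousOn (ht.1.trans ht.2)).mono (Set.Icc_subset_Icc_right ht.2)
  -- Up to the first time in `S` the growth rate is at most `M`, which leaves too little time to
  -- reach `B`.
  set S := {s ∈ Set.Icc a t | B ≤ y s} with hS
  have hSc : IsClosed S := hcont.preimage_isClosed_of_isClosed isClosed_Icc isClosed_Ici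
  have hScomp : IsCompact S := isCompact_Icc.of_isClosed_subset hSc fun s hs ↦ hs.1
  have hne : S.Nonempty := ⟨t, ⟨ht.1, le_rfl⟩, hlt.le⟩
  obtain ⟨s, hsS, hmin⟩ := hScomp.exists_isLeast hne
  have hsab : s ∈ Set.Icc a b := ⟨hsS.1.1, hsS.1.2.trans ht.2⟩
  obtain ⟨hI, he⟩ := h.sub_eq ⟨le_rfl, ht.1.trans ht.2⟩ hsab
  have : ∫ r in a..s, G r ≤ ∫ _ in a..s, M := by
    refine intervalIntegral.integral_mono_on_of_le_Ioo hsS.1.1 hI intervalIntegrable_const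
      fun r hr ↦ hG r ⟨hr.1.le, hr.2.le.trans hsab.2⟩ ?_
    by_contra! hr'
    exact absurd (hmin ⟨⟨hr.1.le, hr.2.le.trans hsS.1.2⟩, hr'.le⟩) (not_le.mpr hr.2)
  rw [intervalIntegral.integral_const, smul_eq_mul] at this
  have h2 : M * (s - a) ≤ M * (b - a) := by gcongr; exact hsab.2
  linarith [hsS.2]

/-- Grönwall's lemma with zero initial value. -/
theorem eq_zero_of_le_mul (h : IsPrimitiveOn y G a b) {K : ℝ} (hy : ∀ t ∈ Set.Icc a b, 0 ≤ y t)
    (ha : y a = 0) (hG : ∀ t ∈ Set.Icc a b, G t ≤ K * y t) {t : ℝ}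
    (ht : t ∈ Set.Icc a b) : y t = 0 := by
  have hab := ht.1.trans ht.2
  have hcont := h.continuousOn hab
  have hint : ∀ t ∈ Set.Icc a b, IntervalIntegrable y volume a t := fun t ht ↦ by
    apply ContinuousOn.intervalIntegrable
    rw [Set.uIcc_of_le ht.1]
    exact hcont.mono (Set.Icc_subset_Icc_right ht.2)
  have hle : ∀ t ∈ Set.Icc a b, y t ≤ K * ∫ s in a..t, y s := fun t ht ↦ by
    rw [h.2 t ht, ha, zero_add, ← intervalIntegral.integral_const_mul]
    exact intervalIntegral.integral_mono_on ht.1 (h.mono ht) ((hint t ht).const_mul K)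
      fun s hs ↦ hG s ⟨hs.1, hs.2.trans ht.2⟩
  have hpos : ∀ t ∈ Set.Icc a b, 0 ≤ ∫ s in a..t, y s := fun t ht ↦
    intervalIntegral.integral_nonneg ht.1 fun s hs ↦ hy s ⟨hs.1, hs.2.trans ht.2⟩
  have hY : ContinuousOn (fun t ↦ ∫ s in a..t, y s) (Set.Icc a b) := by
    have := intervalIntegral.continuousOn_primitive_interval (f := y) (μ := volume) (a := a) (b := b)
      (by rw [← intervalIntegrable_iff']; exact hint b ⟨hab, le_rfl⟩)
    rwa [Set.uIcc_of_le hab] at this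
  -- The function y need not be differentiable, but its primitive is, and y ≤ K ∫ y is a
  -- differential inequality for that primitive.
  have hg := norm_le_gronwallBound_of_norm_deriv_right_le (f := fun t ↦ ∫ s in a..t, y s) (f' := y)
    (δ := 0) (K := K) (ε := 0) (a := a) (b := b) hY (fun x hx ↦ by
      have hx' : x ∈ Set.Icc a b := ⟨hx.1, hx.2.le⟩
      have hmem : Set.Icc a b ∈ 𝓝[Set.Ioi x] x :=
        mem_of_superset (Icc_mem_nhdsGT hx.2) (Set.Icc_subset_Icc_left hx.1)
      have hcw : ContinuousWithinAt y (Set.Ioi x) x :=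
        (hcont x hx').mono_of_mem_nhdsWithin hmem
      exact intervalIntegral.integral_hasDerivWithinAt_right (hint x hx')
        ⟨Set.Icc a b, hmem, hcont.aestronglyMeasurable measurableSet_Icc⟩ hcw)
    (by simp) (fun x hx ↦ by
      have hx' : x ∈ Set.Icc a b := ⟨hx.1, hx.2.le⟩
      rw [add_zero, Real.norm_of_nonneg (hy x hx'), Real.norm_of_nonneg (hpos x hx')]
      exact hle x hx') t ht
  rw [gronwallBound_ε0_δ0, norm_le_zero_iff] at hg
  refine le_antisymm ?_ (hy t ht)
  have := hle t ht
  rwa [hg, mul_zero] at this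

end IsPrimitiveOn

/-! ### From solutions to their Fourier coefficients -/

theorem tsum_mul_reflect_le {f g : ℤ × ℤ → ℝ} (hf : Summable fun ξ ↦ f ξ ^ 2)
    (hg : Summable fun ξ ↦ g ξ ^ 2) (ξ : ℤ × ℤ) :
    Summable (fun ζ ↦ f ζ * g (ξ - ζ)) ∧
      ∑' ζ, f ζ * g (ξ - ζ) ≤ √(∑' ζ, f ζ ^ 2) * √(∑' ζ, g ζ ^ 2) := by
  have h1 : Summable fun ζ ↦ g (ξ - ζ) ^ 2 := (Equiv.subLeft ξ).summable_iff.mpr hg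
  have h2 : ∑' ζ, g (ξ - ζ) ^ 2 = ∑' ζ, g ζ ^ 2 := (Equiv.subLeft ξ).tsum_eq fun ζ ↦ g ζ ^ 2
  refine ⟨summable_mul_of_sq hf h1, ?_⟩
  rw [← h2]
  exact tsum_mul_le_sqrt_mul_sqrt hf h1

theorem sqrt_tsum_sq_fourierCoeff2 (u : L2Torus) :
    √(∑' ξ, ‖fourierCoeff2 u ξ‖ ^ 2) = (2 * Real.pi)⁻¹ * ‖u‖ := by
  have hpi := Real.two_pi_pos
  rw [(hasSum_sq_fourierCoeff2 u).tsum_eq, ← inv_pow, ← mul_pow, Real.sqrt_sq (by positivity)]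

/-- Polarisation u² - v² = (u - v)u + v(u - v), with Cauchy–Schwarz for each convolution. -/
theorem norm_fourierCoeff2_sq_sub_le (u v : L2Torus) (ξ : ℤ × ℤ) :
    ‖fourierCoeff2 (fun p ↦ u p ^ 2) ξ - fourierCoeff2 (fun p ↦ v p ^ 2) ξ‖ ≤
      (2 * Real.pi)⁻¹ * ‖u - v‖ * ((2 * Real.pi)⁻¹ * ‖u‖) +
        (2 * Real.pi)⁻¹ * ‖v‖ * ((2 * Real.pi)⁻¹ * ‖u - v‖) := by
  have hs := (hasSum_fourierCoeff2_sq u ξ).sub (hasSum_fourierCoeff2_sq v ξ)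
  have h1 := tsum_mul_reflect_le (hasSum_sq_fourierCoeff2 (u - v)).summable
    (hasSum_sq_fourierCoeff2 u).summable ξ
  have h2 := tsum_mul_reflect_le (hasSum_sq_fourierCoeff2 v).summable
    (hasSum_sq_fourierCoeff2 (u - v)).summable ξ
  rw [sqrt_tsum_sq_fourierCoeff2, sqrt_tsum_sq_fourierCoeff2] at h1 h2
  rw [← hs.tsum_eq]
  refine (tsum_of_norm_bounded (h1.1.add h2.1).hasSum fun ζ ↦ ?_).trans ?_
  · rw [← norm_mul, ← norm_mul]
    refine le_trans (le_of_eq ?_) (norm_add_le _ _)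
    rw [fourierCoeff2_sub, fourierCoeff2_sub]
    congr 1
    ring
  · rw [h1.1.tsum_add h2.1]
    exact add_le_add h1.2 h2.2

theorem continuous_fourierCoeff2_sq (ξ : ℤ × ℤ) :
    Continuous fun u : L2Torus ↦ fourierCoeff2 (fun p ↦ u p ^ 2) ξ := by
  rw [continuous_iff_continuousAt]
  intro v
  rw [ContinuousAt, tendsto_iff_norm_sub_tendsto_zero]
  refine squeeze_zero (fun u ↦ norm_nonneg _) (fun u ↦ norm_fourierCoeff2_sq_sub_le u v ξ) ?_
  have h : Continuous fun u : L2Torus ↦ (2 * Real.pi)⁻¹ * ‖u - v‖ * ((2 * Real.pi)⁻¹ * ‖u‖) +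
        (2 * Real.pi)⁻¹ * ‖v‖ * ((2 * Real.pi)⁻¹ * ‖u - v‖) := by fun_prop
  have := h.tendsto v
  simpa using this

theorem ofReal_norm_sq_le_sobolevSq (u : L2Torus) : ENNReal.ofReal (‖u‖ ^ 2) ≤ sobolevSq 2 u := by
  have h := (hasSum_sq_fourierCoeff2 u).mul_left ((2 * Real.pi) ^ 2)
  have hpi := Real.two_pi_pos
  rw [← mul_assoc, mul_inv_cancel₀ (by positivity), one_mul] at h
  rw [← h.tsum_eq, ENNReal.ofReal_tsum_of_nonneg (fun ξ ↦ by positivity) h.summable]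
  refine ENNReal.tsum_le_tsum fun ξ ↦ ENNReal.ofReal_le_ofReal ?_
  have h1 : 1 ≤ (1 + freqNorm ξ ^ 2) ^ 2 := one_le_pow₀ (by nlinarith [sq_nonneg (freqNorm ξ)])
  gcongr
  exact le_mul_of_one_le_left (sq_nonneg _) h1

theorem sobolevSq_le_two_mul (u v : L2Torus) :
    sobolevSq 2 u ≤ 2 * sobolevSq 2 (u - v) + 2 * sobolevSq 2 v := by
  rw [sobolevSq, sobolevSq, sobolevSq, ← ENNReal.tsum_mul_left, ← ENNReal.tsum_mul_left,
    ← ENNReal.tsum_add]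
  refine ENNReal.tsum_le_tsum fun ξ ↦ ?_
  have e2 : ∀ x : ℝ, 2 * ENNReal.ofReal x = ENNReal.ofReal (2 * x) := fun x ↦ by
    rw [ENNReal.ofReal_mul zero_le_two, ENNReal.ofReal_ofNat]
  rw [e2, e2, ← ENNReal.ofReal_add (by positivity) (by positivity)]
  apply ENNReal.ofReal_le_ofReal
  rw [fourierCoeff2_sub]
  have h1 : ‖fourierCoeff2 u ξ‖ ^ 2 ≤
      2 * ‖fourierCoeff2 u ξ - fourierCoeff2 v ξ‖ ^ 2 + 2 * ‖fourierCoeff2 v ξ‖ ^ 2 := by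
    have : ‖fourierCoeff2 u ξ‖ ≤
        ‖fourierCoeff2 u ξ - fourierCoeff2 v ξ‖ + ‖fourierCoeff2 v ξ‖ := by
      simpa using norm_add_le (fourierCoeff2 u ξ - fourierCoeff2 v ξ) (fourierCoeff2 v ξ)
    nlinarith [norm_nonneg (fourierCoeff2 u ξ),
      sq_nonneg (‖fourierCoeff2 u ξ - fourierCoeff2 v ξ‖ - ‖fourierCoeff2 v ξ‖)]
  have h2 : 0 ≤ (2 * Real.pi) ^ 2 * (1 + freqNorm ξ ^ 2) ^ 2 := by positivity
  have := mul_le_mul_of_nonneg_left h1 h2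
  linarith

/-- The inequality (1+x)² ≤ 2(1+x²), once squared, costs a factor 4, which (2π)² pays for. -/
theorem weight_four_le (u : L2Torus) (ξ : ℤ × ℤ) :
    freqWeight ξ ^ 4 * ‖fourierCoeff2 u ξ‖ ^ 2 ≤
      (2 * Real.pi) ^ 2 * ((1 + freqNorm ξ ^ 2) ^ 2 * ‖fourierCoeff2 u ξ‖ ^ 2) := by
  rw [← mul_assoc]
  gcongr
  have h1 : freqWeight ξ ^ 2 ≤ 2 * (1 + freqNorm ξ ^ 2) := by
    unfold freqWeight
    nlinarith [sq_nonneg (freqNorm ξ - 1)]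
  have h2 : (4 : ℝ) ≤ (2 * Real.pi) ^ 2 := by nlinarith [Real.pi_gt_three]
  calc freqWeight ξ ^ 4 = (freqWeight ξ ^ 2) ^ 2 := by ring
    _ ≤ (2 * (1 + freqNorm ξ ^ 2)) ^ 2 := pow_le_pow_left₀ (sq_nonneg _) h1 2
    _ = 4 * (1 + freqNorm ξ ^ 2) ^ 2 := by ring
    _ ≤ _ := by gcongr

theorem summable_weight_four {u : L2Torus} {R : ℝ} (hR : 0 ≤ R)
    (h : sobolevSq 2 u ≤ ENNReal.ofReal R) :
    Summable (fun ξ ↦ freqWeight ξ ^ 4 * ‖fourierCoeff2 u ξ‖ ^ 2) ∧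
      ∑' ξ, freqWeight ξ ^ 4 * ‖fourierCoeff2 u ξ‖ ^ 2 ≤ R := by
  have h0 : ∀ ξ, 0 ≤ freqWeight ξ ^ 4 * ‖fourierCoeff2 u ξ‖ ^ 2 := fun ξ ↦ by positivity
  have h1 : ∑' ξ, ENNReal.ofReal (freqWeight ξ ^ 4 * ‖fourierCoeff2 u ξ‖ ^ 2) ≤ ENNReal.ofReal R :=
    (ENNReal.tsum_le_tsum fun ξ ↦ ENNReal.ofReal_le_ofReal (weight_four_le u ξ)).trans h
  have hs : Summable (fun ξ ↦ freqWeight ξ ^ 4 * ‖fourierCoeff2 u ξ‖ ^ 2) := by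
    have := ENNReal.summable_toReal (ne_top_of_le_ne_top ENNReal.ofReal_ne_top h1)
    exact this.congr fun ξ ↦ ENNReal.toReal_ofReal (h0 ξ)
  refine ⟨hs, ?_⟩
  rw [← ENNReal.ofReal_tsum_of_nonneg h0 hs] at h1
  exact (ENNReal.ofReal_le_ofReal_iff hR).mp h1

/-- A family of sequences solving the Fourier transformed equation, locally bounded in the
Sobolev space of order two. -/
structure IsSpectralSolution (ε β δ : ℝ) (a q : ℝ → ℤ × ℤ → ℂ) : Prop where
  continuousOn : ∀ ξ, ContinuousOn (fun t ↦ a t ξ) (Set.Ici 0)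
  continuousOn_conv : ∀ ξ, ContinuousOn (fun t ↦ q t ξ) (Set.Ici 0)
  hasDerivAt : ∀ ξ t, 0 < t → HasDerivAt (fun t ↦ a t ξ)
    (-(Complex.I * (ξ.1 : ℂ) / 2) * q t ξ + (linearSymbol ε β δ ξ : ℂ) * a t ξ) t
  conv : ∀ t ξ, HasSum (fun ζ ↦ a t ζ * a t (ξ - ζ)) (q t ξ)
  neg : ∀ t ξ, a t (-ξ) = conj (a t ξ)
  bounded : ∀ T, ∃ B, 0 ≤ B ∧ ∀ t ∈ Set.Icc 0 T,
    Summable (fun ξ ↦ freqWeight ξ ^ 4 * ‖a t ξ‖ ^ 2) ∧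
      ∑' ξ, freqWeight ξ ^ 4 * ‖a t ξ‖ ^ 2 ≤ B

namespace IsSolution

variable {ε β δ : ℝ} {η₀ : L2Torus} {η : ℝ → L2Torus}

theorem continuousOn (h : IsSolution ε β δ η₀ η) : ContinuousOn η (Set.Ici 0) := by
  intro t ht
  have h1 := h.continuous_H2 t ht
  have h2 : Tendsto (fun s ↦ ENNReal.ofReal (‖η s - η t‖ ^ 2)) (𝓝[Set.Ici 0] t) (𝓝 0) :=
    tendsto_of_tendsto_of_tendsto_of_le_of_le tendsto_const_nhds h1 (fun _ ↦ zero_le)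
      fun s ↦ ofReal_norm_sq_le_sobolevSq _
  have h3 := (ENNReal.tendsto_toReal ENNReal.zero_ne_top).comp h2
  have h4 := h3.sqrt
  rw [ContinuousWithinAt, tendsto_iff_norm_sub_tendsto_zero]
  refine (h4.congr fun s ↦ ?_).trans (by simp)
  simp [Real.sqrt_sq]

/-- Continuity in H² bounds the norm near each time; compactness of [0, T] makes the bound uniform.
-/
theorem exists_sobolevSq_le (h : IsSolution ε β δ η₀ η) (T : ℝ) :
    ∃ B : ℝ, 0 ≤ B ∧ ∀ t ∈ Set.Icc 0 T, sobolevSq 2 (η t) ≤ ENNReal.ofReal B := by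
  refine isCompact_Icc.induction_on (p := fun S ↦
    ∃ B : ℝ, 0 ≤ B ∧ ∀ t ∈ S, sobolevSq 2 (η t) ≤ ENNReal.ofReal B) ?_ ?_ ?_ ?_
  · exact ⟨0, le_rfl, by simp⟩
  · rintro s t hst ⟨B, hB, h⟩
    exact ⟨B, hB, fun r hr ↦ h r (hst hr)⟩
  · rintro s t ⟨B, hB, h⟩ ⟨B', hB', h'⟩
    refine ⟨max B B', hB.trans (le_max_left _ _), ?_⟩
    rintro r (hr | hr)
    · exact (h r hr).trans (ENNReal.ofReal_le_ofReal (le_max_left _ _))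
    · exact (h' r hr).trans (ENNReal.ofReal_le_ofReal (le_max_right _ _))
  · intro t ht
    have h1 := (h.continuous_H2 t ht.1).eventually (Iic_mem_nhds zero_lt_one)
    have h2 : ∀ᶠ s in 𝓝[Set.Icc 0 T] t, sobolevSq 2 (η s - η t) ≤ 1 :=
      h1.filter_mono (nhdsWithin_mono _ fun s hs ↦ hs.1)
    refine ⟨_, h2, (2 * 1 + 2 * sobolevSq 2 (η t)).toReal, ENNReal.toReal_nonneg, fun s hs ↦ ?_⟩
    rw [ENNReal.ofReal_toReal]
    · refine (sobolevSq_le_two_mul (η s) (η t)).trans ?_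
      gcongr
      exact hs
    · exact ENNReal.add_ne_top.mpr ⟨by simp, ENNReal.mul_ne_top (by simp) (h.mem_H2 t ht.1).ne⟩

/-- Both terms of the time integrand depend continuously on η in L², so the integrated equation can
be differentiated mode by mode at positive times. -/
theorem isSpectralSolution (h : IsSolution ε β δ η₀ η) :
    IsSpectralSolution ε β δ (fun t ξ ↦ fourierCoeff2 (η t) ξ)
      (fun t ξ ↦ fourierCoeff2 (fun p ↦ η t p ^ 2) ξ) := by
  have hc : ∀ ξ, ContinuousOn (fun t ↦ fourierCoeff2 (η t) ξ) (Set.Ici 0) := fun ξ ↦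
    (continuous_fourierCoeff2 ξ).comp_continuousOn h.continuousOn
  have hq : ∀ ξ, ContinuousOn (fun t ↦ fourierCoeff2 (fun p ↦ η t p ^ 2) ξ) (Set.Ici 0) := fun ξ ↦
    (continuous_fourierCoeff2_sq ξ).comp_continuousOn h.continuousOn
  refine ⟨hc, hq, fun ξ t ht ↦ ?_, fun t ξ ↦ hasSum_fourierCoeff2_sq _ _,
    fun t ξ ↦ fourierCoeff2_neg _ _, fun T ↦ ?_⟩
  · set r : ℝ → ℂ := fun t ↦ -(Complex.I * (ξ.1 : ℂ) / 2) * fourierCoeff2 (fun p ↦ η t p ^ 2) ξ +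
      (linearSymbol ε β δ ξ : ℂ) * fourierCoeff2 (η t) ξ with hr
    have hrc : ContinuousOn r (Set.Ici 0) :=
      (continuousOn_const.mul (hq ξ)).add (continuousOn_const.mul (hc ξ))
    have hnhds : Set.Ici (0 : ℝ) ∈ 𝓝 t := Ici_mem_nhds ht
    have hint : IntervalIntegrable r volume 0 t := by
      apply ContinuousOn.intervalIntegrable
      rw [Set.uIcc_of_le ht.le]
      exact hrc.mono fun s hs ↦ hs.1
    have hd := (intervalIntegral.integral_hasDerivAt_right hint
      ⟨Set.Ici 0, hnhds, hrc.aestronglyMeasurable measurableSet_Ici⟩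
      (hrc.continuousAt hnhds)).const_add (fourierCoeff2 η₀ ξ)
    refine hd.congr_of_eventuallyEq ?_
    filter_upwards [hnhds] with s hs
    exact h.equation s hs ξ
  · obtain ⟨B, hB, hb⟩ := h.exists_sobolevSq_le T
    exact ⟨B, hB, fun t ht ↦ summable_weight_four hB (hb t ht)⟩

end IsSolution

/-! ### Weighted energy identity and bounds for its right-hand side -/

/-- The weighted energy identity. -/
theorem isPrimitiveOn_weighted_energy {x r : ℝ → ℤ × ℤ → ℂ} {ψ : ℤ × ℤ → ℝ} {a b n B : ℝ}
    (hab : a ≤ b) (hψ0 : ∀ ξ, 0 ≤ ψ ξ) (hψn : ∀ ξ, ψ ξ ≤ n)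
    (hx : ∀ ξ, ContinuousOn (fun t ↦ x t ξ) (Set.Icc a b))
    (hr : ∀ ξ, ContinuousOn (fun t ↦ r t ξ) (Set.Icc a b))
    (hd : ∀ ξ, ∀ t ∈ Set.Ioo a b, HasDerivAt (fun t ↦ x t ξ) (r t ξ) t)
    (hxs : ∀ t ∈ Set.Icc a b, Summable fun ξ ↦ ‖x t ξ‖ ^ 2)
    (hxB : ∀ t ∈ Set.Icc a b, ∑' ξ, ‖x t ξ‖ ^ 2 ≤ B)
    (hrs : ∀ t ∈ Set.Icc a b, Summable fun ξ ↦ ‖x t ξ‖ * ‖r t ξ‖)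
    (hrB : ∀ t ∈ Set.Icc a b, ∑' ξ, ‖x t ξ‖ * ‖r t ξ‖ ≤ B) :
    IsPrimitiveOn (fun t ↦ ∑' ξ, Real.exp (2 * (t - a) * ψ ξ) * ‖x t ξ‖ ^ 2)
      (fun t ↦ ∑' ξ, Real.exp (2 * (t - a) * ψ ξ) *
        (2 * ψ ξ * ‖x t ξ‖ ^ 2 + 2 * (conj (x t ξ) * r t ξ).re)) a b := by
  -- The bound ψ ≤ n keeps the exponential weights bounded on [a, b], so unweighted summability
  -- dominates everything.
  have hn : 0 ≤ n := (hψ0 0).trans (hψn 0)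
  have hexp : ∀ t ∈ Set.Icc a b, ∀ ξ, Real.exp (2 * (t - a) * ψ ξ) ≤ Real.exp (2 * (b - a) * n) := by
    intro t ht ξ
    have h1 : 0 ≤ t - a := sub_nonneg.mpr ht.1
    have h2 : t - a ≤ b - a := by linarith [ht.2]
    have := hψ0 ξ
    have := hψn ξ
    gcongr
  have hg : ∀ t ∈ Set.Icc a b, ∀ ξ, |Real.exp (2 * (t - a) * ψ ξ) *
        (2 * ψ ξ * ‖x t ξ‖ ^ 2 + 2 * (conj (x t ξ) * r t ξ).re)| ≤
      Real.exp (2 * (b - a) * n) * (2 * n * ‖x t ξ‖ ^ 2 + 2 * (‖x t ξ‖ * ‖r t ξ‖)) := by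
    intro t ht ξ
    rw [abs_mul, abs_of_pos (Real.exp_pos _)]
    refine mul_le_mul (hexp t ht ξ) ?_ (abs_nonneg _) (Real.exp_pos _).le
    refine (abs_add_le _ _).trans (add_le_add ?_ ?_)
    · rw [abs_of_nonneg (by have := hψ0 ξ; positivity)]
      have := hψn ξ
      gcongr
    · rw [abs_mul, abs_two]
      gcongr
      refine (Complex.abs_re_le_norm _).trans (le_of_eq ?_)
      rw [norm_mul, RCLike.norm_conj]
  have hgs : ∀ t ∈ Set.Icc a b, Summable fun ξ ↦
      Real.exp (2 * (b - a) * n) * (2 * n * ‖x t ξ‖ ^ 2 + 2 * (‖x t ξ‖ * ‖r t ξ‖)) := fun t ht ↦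
    (((hxs t ht).mul_left _).add ((hrs t ht).mul_left _)).mul_left _
  have hgs' : ∀ t ∈ Set.Icc a b, Summable fun ξ ↦ |Real.exp (2 * (t - a) * ψ ξ) *
        (2 * ψ ξ * ‖x t ξ‖ ^ 2 + 2 * (conj (x t ξ) * r t ξ).re)| := fun t ht ↦
    Summable.of_nonneg_of_le (fun ξ ↦ abs_nonneg _) (hg t ht) (hgs t ht)
  have hE : ∀ ξ, Continuous fun t ↦ Real.exp (2 * (t - a) * ψ ξ) := fun ξ ↦ by fun_prop
  refine IsPrimitiveOn.tsum (B := Real.exp (2 * (b - a) * n) * (2 * n * B + 2 * B)) hab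
    (fun ξ ↦ ?_) (fun t ht ↦ ?_) hgs' fun t ht ↦ ?_
  · refine IsPrimitiveOn.of_hasDerivAt hab ?_ ?_ fun t ht ↦ ?_
    · exact (hE ξ).continuousOn.mul ((hx ξ).norm.pow 2)
    · refine (hE ξ).continuousOn.mul ((continuousOn_const.mul ((hx ξ).norm.pow 2)).add
        (continuousOn_const.mul ?_))
      exact Complex.continuous_re.comp_continuousOn
        ((Complex.continuous_conj.comp_continuousOn (hx ξ)).mul (hr ξ))
    · have h1 : HasDerivAt (fun t ↦ Real.exp (2 * (t - a) * ψ ξ))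
          (Real.exp (2 * (t - a) * ψ ξ) * (2 * ψ ξ)) t := by
        have : HasDerivAt (fun t ↦ 2 * (t - a) * ψ ξ) (2 * ψ ξ) t := by
          have := (((hasDerivAt_id t).sub_const a).const_mul 2).mul_const (ψ ξ)
          simpa using this
        exact this.exp
      have h2 : HasDerivAt (fun t ↦ ‖x t ξ‖ ^ 2) (2 * (conj (x t ξ) * r t ξ).re) t := by
        have := (hd ξ t ht).norm_sq
        refine this.congr_deriv ?_
        rw [real_inner_eq_re_inner ℂ, RCLike.inner_apply, mul_comm (r t ξ)]
        rfl
      refine (h1.mul h2).congr_deriv ?_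
      ring
  · refine Summable.of_nonneg_of_le (fun ξ ↦ by positivity) (fun ξ ↦ ?_) ((hxs t ht).mul_left
      (Real.exp (2 * (b - a) * n)))
    gcongr ?_ * _
    exact hexp t ht ξ
  · refine ((hgs' t ht).tsum_le_tsum (hg t ht) (hgs t ht)).trans ?_
    rw [tsum_mul_left, ((hxs t ht).mul_left _).tsum_add ((hrs t ht).mul_left _), tsum_mul_left,
      tsum_mul_left]
    have := hxB t ht
    have := hrB t ht
    gcongr

section Weights

variable {f : ℤ × ℤ → ℝ}

theorem weight_mul_le {j k : ℕ} (hjk : j ≤ k) (f : ℤ × ℤ → ℝ) (ξ : ℤ × ℤ) :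
    freqWeight ξ ^ j * f ξ ^ 2 ≤ freqWeight ξ ^ k * f ξ ^ 2 := by
  have := pow_le_pow_right₀ (one_le_freqWeight ξ) hjk
  gcongr

theorem summable_weight_mono {j k : ℕ} (hjk : j ≤ k)
    (hf : Summable fun ξ ↦ freqWeight ξ ^ k * f ξ ^ 2) :
    Summable fun ξ ↦ freqWeight ξ ^ j * f ξ ^ 2 :=
  Summable.of_nonneg_of_le (fun ξ ↦ by have := freqWeight_pos ξ; positivity)
    (weight_mul_le hjk f) hf

theorem tsum_weight_mono {j k : ℕ} (hjk : j ≤ k)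
    (hf : Summable fun ξ ↦ freqWeight ξ ^ k * f ξ ^ 2) :
    ∑' ξ, freqWeight ξ ^ j * f ξ ^ 2 ≤ ∑' ξ, freqWeight ξ ^ k * f ξ ^ 2 :=
  (summable_weight_mono hjk hf).tsum_le_tsum (weight_mul_le hjk f) hf

theorem summable_sq_of_weight {k : ℕ} (hf : Summable fun ξ ↦ freqWeight ξ ^ k * f ξ ^ 2) :
    Summable fun ξ ↦ f ξ ^ 2 := by
  simpa using summable_weight_mono (Nat.zero_le k) hf

theorem tsum_sq_le_weight {k : ℕ} (hf : Summable fun ξ ↦ freqWeight ξ ^ k * f ξ ^ 2) :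
    ∑' ξ, f ξ ^ 2 ≤ ∑' ξ, freqWeight ξ ^ k * f ξ ^ 2 := by
  simpa using tsum_weight_mono (Nat.zero_le k) hf

theorem freqNorm_mul_sq_le {k : ℕ} (hk : 2 ≤ k) (f : ℤ × ℤ → ℝ) (ξ : ℤ × ℤ) :
    (freqNorm ξ * f ξ) ^ 2 ≤ freqWeight ξ ^ k * f ξ ^ 2 := by
  refine le_trans ?_ (weight_mul_le hk f ξ)
  rw [mul_pow]
  have := freqNorm_nonneg ξ
  gcongr
  exact freqNorm_le_freqWeight ξ

theorem summable_freqNorm_mul_sq {k : ℕ} (hk : 2 ≤ k)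
    (hf : Summable fun ξ ↦ freqWeight ξ ^ k * f ξ ^ 2) :
    Summable fun ξ ↦ (freqNorm ξ * f ξ) ^ 2 :=
  Summable.of_nonneg_of_le (fun _ ↦ sq_nonneg _) (freqNorm_mul_sq_le hk f) hf

theorem tsum_freqNorm_mul_sq_le {k : ℕ} (hk : 2 ≤ k)
    (hf : Summable fun ξ ↦ freqWeight ξ ^ k * f ξ ^ 2) :
    ∑' ξ, (freqNorm ξ * f ξ) ^ 2 ≤ ∑' ξ, freqWeight ξ ^ k * f ξ ^ 2 :=
  (summable_freqNorm_mul_sq hk hf).tsum_le_tsum (freqNorm_mul_sq_le hk f) hf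

end Weights

section RightHandSide

variable {x Q : ℤ × ℤ → ℂ} {f d g : ℤ × ℤ → ℝ}

/-- The nonlinear term of the energy balance is controlled by the trilinear estimate. -/
theorem tsum_freqNorm_mul_conv_le {k : ℕ} (hk : 2 ≤ k) (hf0 : ∀ ξ, 0 ≤ f ξ) (hd0 : ∀ ξ, 0 ≤ d ξ)
    (hg0 : ∀ ξ, 0 ≤ g ξ) (hf : Summable fun ξ ↦ freqWeight ξ ^ k * f ξ ^ 2) (hd : Summable d)
    (hg : Summable fun ξ ↦ g ξ ^ 2) :
    (Summable fun ξ ↦ freqNorm ξ * f ξ * ∑' ζ, d ζ * g (ξ - ζ)) ∧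
      ∑' ξ, freqNorm ξ * f ξ * ∑' ζ, d ζ * g (ξ - ζ) ≤
        √(∑' ξ, freqWeight ξ ^ k * f ξ ^ 2) * (∑' ξ, d ξ) * √(∑' ξ, g ξ ^ 2) := by
  have h0 : ∀ ξ, 0 ≤ freqNorm ξ * f ξ := fun ξ ↦ mul_nonneg (freqNorm_nonneg ξ) (hf0 ξ)
  refine ⟨summable_mul_conv h0 hd0 hg0 (summable_freqNorm_mul_sq hk hf) hd hg, ?_⟩
  refine (tsum_trilinear_le h0 hd0 hg0 (summable_freqNorm_mul_sq hk hf) hd hg).trans ?_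
  have : 0 ≤ ∑' ξ, d ξ := tsum_nonneg hd0
  gcongr ?_ * _ * _
  exact Real.sqrt_le_sqrt (tsum_freqNorm_mul_sq_le hk hf)

/-- The factor 2 of the energy balance cancels the 1/2 in η η_x = (η²)_x / 2, and |ξ₁| ≤ |ξ|. -/
theorem two_mul_re_conj_mul_le (ε β δ : ℝ) (ξ : ℤ × ℤ) (z w : ℂ) :
    2 * (conj z * (-(Complex.I * (ξ.1 : ℂ) / 2) * w + (linearSymbol ε β δ ξ : ℂ) * z)).re ≤
      2 * linearSymbol ε β δ ξ * ‖z‖ ^ 2 + freqNorm ξ * ‖z‖ * ‖w‖ := by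
  have e : 2 * (conj z * (-(Complex.I * (ξ.1 : ℂ) / 2) * w + (linearSymbol ε β δ ξ : ℂ) * z)).re =
      2 * linearSymbol ε β δ ξ * ‖z‖ ^ 2 + (-(conj z * (Complex.I * (ξ.1 : ℂ)) * w)).re := by
    have h1 : conj z * (-(Complex.I * (ξ.1 : ℂ) / 2) * w + (linearSymbol ε β δ ξ : ℂ) * z) =
        ((linearSymbol ε β δ ξ * ‖z‖ ^ 2 : ℝ) : ℂ) +
          ((1 / 2 : ℝ) : ℂ) * -(conj z * (Complex.I * (ξ.1 : ℂ)) * w) := by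
      have : z * conj z = ((‖z‖ ^ 2 : ℝ) : ℂ) := by
        rw [Complex.mul_conj, Complex.normSq_eq_norm_sq]
      rw [Complex.ofReal_mul, ← this]
      push_cast
      ring
    rw [h1, Complex.add_re, Complex.ofReal_re, Complex.re_ofReal_mul]
    ring
  rw [e]
  have h := (Complex.re_le_norm (-(conj z * (Complex.I * (ξ.1 : ℂ)) * w)))
  rw [norm_neg, norm_mul, norm_mul, norm_mul, RCLike.norm_conj, Complex.norm_I, one_mul,
    Complex.norm_intCast] at h
  have h2 : ‖z‖ * |(ξ.1 : ℝ)| * ‖w‖ ≤ freqNorm ξ * ‖z‖ * ‖w‖ := by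
    rw [mul_comm ‖z‖]
    gcongr
    exact abs_fst_le_freqNorm ξ
  linarith

theorem norm_mul_norm_rhs_le (ε β δ : ℝ) (ξ : ℤ × ℤ) (z w : ℂ) :
    ‖z‖ * ‖-(Complex.I * (ξ.1 : ℂ) / 2) * w + (linearSymbol ε β δ ξ : ℂ) * z‖ ≤
      freqNorm ξ * ‖z‖ * ‖w‖ + (|β - 1| + 1 + |δ| + |ε|) * (freqWeight ξ ^ 4 * ‖z‖ ^ 2) := by
  have h := norm_add_le (-(Complex.I * (ξ.1 : ℂ) / 2) * w) ((linearSymbol ε β δ ξ : ℂ) * z)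
  rw [norm_mul, norm_neg, norm_div, norm_mul, Complex.norm_I, one_mul, Complex.norm_intCast,
    norm_mul, Complex.norm_real, Complex.norm_ofNat, Real.norm_eq_abs] at h
  have h1 := abs_fst_le_freqNorm ξ
  have h2 := abs_linearSymbol_le ε β δ ξ
  have h3 : |(ξ.1 : ℝ)| / 2 ≤ freqNorm ξ := by linarith [abs_nonneg (ξ.1 : ℝ)]
  calc _ ≤ ‖z‖ * (|(ξ.1 : ℝ)| / 2 * ‖w‖ + |linearSymbol ε β δ ξ| * ‖z‖) := by gcongr
    _ ≤ ‖z‖ * (freqNorm ξ * ‖w‖ + (|β - 1| + 1 + |δ| + |ε|) * freqWeight ξ ^ 4 * ‖z‖) := by gcongr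
    _ = _ := by ring

theorem summable_norm_mul_norm_rhs (ε β δ : ℝ) {B D : ℝ} (hd0 : ∀ ξ, 0 ≤ d ξ)
    (hg0 : ∀ ξ, 0 ≤ g ξ) (hx : Summable fun ξ ↦ freqWeight ξ ^ 4 * ‖x ξ‖ ^ 2)
    (hxB : ∑' ξ, freqWeight ξ ^ 4 * ‖x ξ‖ ^ 2 ≤ B) (hd : Summable d) (hdD : ∑' ξ, d ξ ≤ D)
    (hg : Summable fun ξ ↦ g ξ ^ 2) (hgB : ∑' ξ, g ξ ^ 2 ≤ B)
    (hQ : ∀ ξ, ‖Q ξ‖ ≤ ∑' ζ, d ζ * g (ξ - ζ)) :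
    (Summable fun ξ ↦ ‖x ξ‖ *
        ‖-(Complex.I * (ξ.1 : ℂ) / 2) * Q ξ + (linearSymbol ε β δ ξ : ℂ) * x ξ‖) ∧
      ∑' ξ, ‖x ξ‖ * ‖-(Complex.I * (ξ.1 : ℂ) / 2) * Q ξ + (linearSymbol ε β δ ξ : ℂ) * x ξ‖ ≤
        B * D + (|β - 1| + 1 + |δ| + |ε|) * B := by
  obtain ⟨h1, h2⟩ := tsum_freqNorm_mul_conv_le (f := fun ξ ↦ ‖x ξ‖) (k := 4) (by norm_num)
    (fun ξ ↦ norm_nonneg _) hd0 hg0 hx hd hg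
  have hle : ∀ ξ, ‖x ξ‖ * ‖-(Complex.I * (ξ.1 : ℂ) / 2) * Q ξ + (linearSymbol ε β δ ξ : ℂ) * x ξ‖ ≤
      freqNorm ξ * ‖x ξ‖ * (∑' ζ, d ζ * g (ξ - ζ)) +
        (|β - 1| + 1 + |δ| + |ε|) * (freqWeight ξ ^ 4 * ‖x ξ‖ ^ 2) := fun ξ ↦ by
    refine (norm_mul_norm_rhs_le ε β δ ξ (x ξ) (Q ξ)).trans ?_
    have := freqNorm_nonneg ξ
    have := hQ ξ
    gcongr
  have hs := h1.add (hx.mul_left (|β - 1| + 1 + |δ| + |ε|))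
  have hs' := Summable.of_nonneg_of_le (fun ξ ↦ by positivity) hle hs
  refine ⟨hs', (hs'.tsum_le_tsum hle hs).trans ?_⟩
  rw [h1.tsum_add (hx.mul_left _), tsum_mul_left]
  have hB : 0 ≤ B := (tsum_nonneg fun ξ ↦ sq_nonneg (g ξ)).trans hgB
  have hd1 : 0 ≤ ∑' ξ, d ξ := tsum_nonneg hd0
  have hD : 0 ≤ D := hd1.trans hdD
  have h3 : √(∑' ξ, freqWeight ξ ^ 4 * ‖x ξ‖ ^ 2) * (∑' ξ, d ξ) * √(∑' ξ, g ξ ^ 2) ≤ B * D :=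
    calc _ ≤ √B * D * √B := by gcongr
      _ = √B * √B * D := by ring
      _ = B * D := by rw [Real.mul_self_sqrt hB]
  gcongr
  exact h2.trans h3

end RightHandSide

/-! ### Propagation of oddness -/

namespace IsSpectralSolution

variable {ε β δ : ℝ} {a q : ℝ → ℤ × ℤ → ℂ}

theorem norm_conv_le (h : IsSpectralSolution ε β δ a q) {t : ℝ}
    (ha : Summable fun ξ ↦ ‖a t ξ‖ ^ 2) (ξ : ℤ × ℤ) :
    ‖q t ξ‖ ≤ ∑' ζ, ‖a t ζ‖ * ‖a t (ξ - ζ)‖ := by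
  rw [← (h.conv t ξ).tsum_eq]
  have := (tsum_mul_reflect_le (f := fun ξ ↦ ‖a t ξ‖) (g := fun ξ ↦ ‖a t ξ‖) ha ha ξ).1
  refine tsum_of_norm_bounded this.hasSum fun ζ ↦ ?_
  rw [norm_mul]

theorem exists_bound (h : IsSpectralSolution ε β δ a q) (T : ℝ) :
    ∃ B D, 0 ≤ B ∧ 0 ≤ D ∧ ∀ t ∈ Set.Icc 0 T,
      (Summable fun ξ ↦ freqWeight ξ ^ 4 * ‖a t ξ‖ ^ 2) ∧
      (∑' ξ, freqWeight ξ ^ 4 * ‖a t ξ‖ ^ 2 ≤ B) ∧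
      (Summable fun ξ ↦ ‖a t ξ‖) ∧ ∑' ξ, ‖a t ξ‖ ≤ D := by
  obtain ⟨B, hB, hb⟩ := h.bounded T
  refine ⟨B, √weightConst * √B, hB, by positivity, fun t ht ↦ ?_⟩
  obtain ⟨h1, h2⟩ := hb t ht
  have h3 := summable_weight_mono (f := fun ξ ↦ ‖a t ξ‖) (j := 3) (k := 4) (by norm_num) h1
  refine ⟨h1, h2, summable_of_summable_weight h3, (tsum_le_sqrt_weight h3).trans ?_⟩
  gcongr
  exact (tsum_weight_mono (f := fun ξ ↦ ‖a t ξ‖) (by norm_num) h1).trans h2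

/-- Reflection of the first frequency. -/
def reflectFst : ℤ × ℤ ≃ ℤ × ℤ := (Equiv.neg ℤ).prodCongr (Equiv.refl ℤ)

theorem reflectFst_apply (ξ : ℤ × ℤ) : reflectFst ξ = (-ξ.1, ξ.2) := rfl

theorem reflectFst_sub (ξ ζ : ℤ × ℤ) : reflectFst (ξ - ζ) = reflectFst ξ - reflectFst ζ := by
  simp only [reflectFst_apply, Prod.fst_sub, Prod.snd_sub, Prod.mk_sub_mk, Prod.mk.injEq, and_true]
  ring

theorem freqNorm_reflectFst (ξ : ℤ × ℤ) : freqNorm (reflectFst ξ) = freqNorm ξ := by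
  simp [freqNorm, reflectFst_apply]

theorem linearSymbol_reflectFst (ε β δ : ℝ) (ξ : ℤ × ℤ) :
    linearSymbol ε β δ (reflectFst ξ) = linearSymbol ε β δ ξ := by
  unfold linearSymbol
  rw [freqNorm_reflectFst]
  simp [reflectFst_apply]

theorem freqWeight_reflectFst (ξ : ℤ × ℤ) : freqWeight (reflectFst ξ) = freqWeight ξ := by
  rw [freqWeight, freqNorm_reflectFst, freqWeight]

/-- With R the reflection and e = a + a∘R, the identity a a' - Ra Ra' = e a' - Ra e' shows that the
evenness defect of q is linear in the oddness defect e of a. -/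
theorem norm_conv_sub_reflect_le (h : IsSpectralSolution ε β δ a q) {t : ℝ}
    (ha : Summable fun ξ ↦ ‖a t ξ‖ ^ 2)
    (he : Summable fun ξ ↦ ‖a t ξ + a t (reflectFst ξ)‖ ^ 2) (ξ : ℤ × ℤ) :
    ‖q t ξ - q t (reflectFst ξ)‖ ≤ ∑' ζ, (‖a t ζ‖ + ‖a t (reflectFst ζ)‖) *
      ‖a t (ξ - ζ) + a t (reflectFst (ξ - ζ))‖ := by
  have h1 : HasSum (fun ζ ↦ a t (reflectFst ζ) * a t (reflectFst (ξ - ζ)))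
      (q t (reflectFst ξ)) := by
    have := reflectFst.hasSum_iff.mpr (h.conv t (reflectFst ξ))
    refine this.congr_fun fun ζ ↦ ?_
    rw [Function.comp, reflectFst_sub]
  have ha' : Summable fun ξ ↦ ‖a t (reflectFst ξ)‖ ^ 2 := reflectFst.summable_iff.mpr ha
  have hs1 := (tsum_mul_reflect_le (f := fun ξ ↦ ‖a t ξ + a t (reflectFst ξ)‖)
    (g := fun ξ ↦ ‖a t ξ‖) he ha ξ).1
  have hs2 := (tsum_mul_reflect_le (f := fun ξ ↦ ‖a t (reflectFst ξ)‖)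
    (g := fun ξ ↦ ‖a t ξ + a t (reflectFst ξ)‖) ha' he ξ).1
  have hs3 := (tsum_mul_reflect_le (f := fun ξ ↦ ‖a t ξ‖)
    (g := fun ξ ↦ ‖a t ξ + a t (reflectFst ξ)‖) ha he ξ).1
  have e1 : ∑' ζ, ‖a t ζ + a t (reflectFst ζ)‖ * ‖a t (ξ - ζ)‖ =
      ∑' ζ, ‖a t ζ‖ * ‖a t (ξ - ζ) + a t (reflectFst (ξ - ζ))‖ := by
    rw [← (Equiv.subLeft ξ).tsum_eq]
    refine tsum_congr fun ζ ↦ ?_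
    simp only [Equiv.subLeft_apply, sub_sub_cancel]
    ring
  rw [← ((h.conv t ξ).sub h1).tsum_eq]
  refine (tsum_of_norm_bounded (hs1.add hs2).hasSum fun ζ ↦ ?_).trans (le_of_eq ?_)
  · rw [← norm_mul, ← norm_mul]
    refine le_trans (le_of_eq ?_) (norm_sub_le _ _)
    congr 1
    ring
  · rw [hs1.tsum_add hs2, e1, ← hs3.tsum_add hs2]
    exact tsum_congr fun ζ ↦ by ring

/-- Oddness in the first variable is propagated by the evolution. -/
theorem odd (h : IsSpectralSolution ε β δ a q) (hε : 0 < ε) (hδ : 0 ≤ δ)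
    (h0 : ∀ ξ, a 0 (reflectFst ξ) = -a 0 ξ) {t : ℝ} (ht : 0 ≤ t) (ξ : ℤ × ℤ) :
    a t (reflectFst ξ) = -a t ξ := by
  obtain ⟨B, D, hB, hD, hb⟩ := h.exists_bound t
  -- The defect e solves the same equation with `Q` in place of q; the sign in `Q` comes from ξ₁
  -- changing sign under reflection.
  set e : ℝ → ℤ × ℤ → ℂ := fun s ξ ↦ a s ξ + a s (reflectFst ξ) with he
  set Q : ℝ → ℤ × ℤ → ℂ := fun s ξ ↦ q s ξ - q s (reflectFst ξ) with hQ
  have hsub : Set.Icc 0 t ⊆ Set.Ici 0 := fun s hs ↦ hs.1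
  have haR : ∀ s ∈ Set.Icc 0 t, (Summable fun ξ ↦ freqWeight ξ ^ 4 * ‖a s (reflectFst ξ)‖ ^ 2) ∧
      ∑' ξ, freqWeight ξ ^ 4 * ‖a s (reflectFst ξ)‖ ^ 2 ≤ B := by
    intro s hs
    have e1 : ∀ ξ, freqWeight ξ ^ 4 * ‖a s (reflectFst ξ)‖ ^ 2 =
        freqWeight (reflectFst ξ) ^ 4 * ‖a s (reflectFst ξ)‖ ^ 2 := fun ξ ↦ by
      rw [freqWeight_reflectFst]
    simp only [e1]
    refine ⟨reflectFst.summable_iff.mpr (hb s hs).1, ?_⟩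
    exact (reflectFst.tsum_eq fun ξ ↦ freqWeight ξ ^ 4 * ‖a s ξ‖ ^ 2).le.trans (hb s hs).2.1
  have hele : ∀ s ξ, freqWeight ξ ^ 4 * ‖e s ξ‖ ^ 2 ≤ 2 * (freqWeight ξ ^ 4 * ‖a s ξ‖ ^ 2) +
      2 * (freqWeight ξ ^ 4 * ‖a s (reflectFst ξ)‖ ^ 2) := fun s ξ ↦ by
    have h1 : ‖e s ξ‖ ^ 2 ≤ 2 * ‖a s ξ‖ ^ 2 + 2 * ‖a s (reflectFst ξ)‖ ^ 2 := by
      have := norm_add_le (a s ξ) (a s (reflectFst ξ))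
      nlinarith [norm_nonneg (e s ξ), sq_nonneg (‖a s ξ‖ - ‖a s (reflectFst ξ)‖)]
    have h2 := mul_le_mul_of_nonneg_left h1 (pow_nonneg (freqWeight_pos ξ).le 4)
    linarith
  have hes : ∀ s ∈ Set.Icc 0 t, (Summable fun ξ ↦ freqWeight ξ ^ 4 * ‖e s ξ‖ ^ 2) ∧
      ∑' ξ, freqWeight ξ ^ 4 * ‖e s ξ‖ ^ 2 ≤ 4 * B := by
    intro s hs
    have hsum := ((hb s hs).1.mul_left 2).add ((haR s hs).1.mul_left 2)
    have hE : Summable fun ξ ↦ freqWeight ξ ^ 4 * ‖e s ξ‖ ^ 2 :=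
      Summable.of_nonneg_of_le (fun ξ ↦ by positivity) (hele s) hsum
    refine ⟨hE, (hE.tsum_le_tsum (hele s) hsum).trans ?_⟩
    rw [((hb s hs).1.mul_left 2).tsum_add ((haR s hs).1.mul_left 2), tsum_mul_left, tsum_mul_left]
    linarith [(hb s hs).2.1, (haR s hs).2]
  have hes2 : ∀ s ∈ Set.Icc 0 t, Summable fun ξ ↦ ‖e s ξ‖ ^ 2 := fun s hs ↦
    summable_sq_of_weight (f := fun ξ ↦ ‖e s ξ‖) (hes s hs).1
  have heB : ∀ s ∈ Set.Icc 0 t, ∑' ξ, ‖e s ξ‖ ^ 2 ≤ 4 * B := fun s hs ↦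
    (tsum_sq_le_weight (f := fun ξ ↦ ‖e s ξ‖) (hes s hs).1).trans (hes s hs).2
  have hd : ∀ s ∈ Set.Icc 0 t, (Summable fun ζ ↦ ‖a s ζ‖ + ‖a s (reflectFst ζ)‖) ∧
      ∑' ζ, (‖a s ζ‖ + ‖a s (reflectFst ζ)‖) ≤ 2 * D := by
    intro s hs
    have h1 : Summable fun ζ ↦ ‖a s (reflectFst ζ)‖ := reflectFst.summable_iff.mpr (hb s hs).2.2.1
    have h2 : ∑' ζ, ‖a s (reflectFst ζ)‖ = ∑' ζ, ‖a s ζ‖ := reflectFst.tsum_eq fun ζ ↦ ‖a s ζ‖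
    refine ⟨(hb s hs).2.2.1.add h1, ?_⟩
    rw [(hb s hs).2.2.1.tsum_add h1, h2]
    linarith [(hb s hs).2.2.2]
  have hQle : ∀ s ∈ Set.Icc 0 t, ∀ ξ, ‖Q s ξ‖ ≤ ∑' ζ, (‖a s ζ‖ + ‖a s (reflectFst ζ)‖) *
      ‖e s (ξ - ζ)‖ := fun s hs ξ ↦ h.norm_conv_sub_reflect_le
    (summable_sq_of_weight (f := fun ξ ↦ ‖a s ξ‖) (hb s hs).1) (hes2 s hs) ξ
  have hrhs := fun s (hs : s ∈ Set.Icc 0 t) ↦ summable_norm_mul_norm_rhs (x := e s) (Q := Q s)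
    ε β δ (fun ξ ↦ by positivity) (fun ξ ↦ norm_nonneg (e s ξ)) (hes s hs).1 (hes s hs).2
    (hd s hs).1 (hd s hs).2 (hes2 s hs) (heB s hs) (hQle s hs)
  set B' := max (4 * B) (4 * B * (2 * D) + (|β - 1| + 1 + |δ| + |ε|) * (4 * B)) with hB'
  -- The weight ψ = 0 gives the plain energy of the defect, to which Grönwall applies.
  have hprim := isPrimitiveOn_weighted_energy (x := e) (a := 0) (b := t) (n := 0) (B := B')
    (ψ := fun _ ↦ 0)
    (r := fun s ξ ↦ -(Complex.I * (ξ.1 : ℂ) / 2) * Q s ξ + (linearSymbol ε β δ ξ : ℂ) * e s ξ) ht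
    (fun _ ↦ le_rfl) (fun _ ↦ le_rfl)
    (fun ξ ↦ ((h.continuousOn ξ).add (h.continuousOn (reflectFst ξ))).mono hsub)
    (fun ξ ↦ ((continuousOn_const.mul ((h.continuousOn_conv ξ).sub
      (h.continuousOn_conv (reflectFst ξ)))).add (continuousOn_const.mul
        ((h.continuousOn ξ).add (h.continuousOn (reflectFst ξ))))).mono hsub)
    (fun ξ s hs ↦ by
      refine ((h.hasDerivAt ξ s hs.1).add (h.hasDerivAt (reflectFst ξ) s hs.1)).congr_deriv ?_
      rw [linearSymbol_reflectFst]
      simp only [hQ, he, reflectFst_apply]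
      push_cast
      ring)
    hes2 (fun s hs ↦ (heB s hs).trans (le_max_left _ _)) (fun s hs ↦ (hrhs s hs).1)
    (fun s hs ↦ (hrhs s hs).2.trans (le_max_right _ _))
  simp only [mul_zero, Real.exp_zero, one_mul, zero_mul, zero_add] at hprim
  -- The nonlinear term is at most 2D ∑ (1+|ξ|)³|e|², so a cubic perturbation of size D has to be
  -- absorbed in the symbol.
  obtain ⟨K, hK, hKle⟩ := exists_linearSymbol_le β δ hε hδ D hD
  have hzero := hprim.eq_zero_of_le_mul (K := 2 * K) (t := t)
    (fun s hs ↦ tsum_nonneg fun ξ ↦ sq_nonneg _) (by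
      simp only [he, h0]
      simp) (fun s hs ↦ by
      obtain ⟨hN1, hN2⟩ := tsum_freqNorm_mul_conv_le (f := fun ξ ↦ ‖e s ξ‖) (k := 3) (by norm_num)
        (fun ξ ↦ norm_nonneg _) (fun ξ ↦ by positivity) (fun ξ ↦ norm_nonneg (e s ξ))
        (summable_weight_mono (f := fun ξ ↦ ‖e s ξ‖) (by norm_num) (hes s hs).1)
        (hd s hs).1 (hes2 s hs)
      have hW3 := summable_weight_mono (f := fun ξ ↦ ‖e s ξ‖) (j := 3) (by norm_num) (hes s hs).1
      have hW0 := tsum_sq_le_weight (f := fun ξ ↦ ‖e s ξ‖) hW3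
      have hN3 : ∑' ξ, freqNorm ξ * ‖e s ξ‖ * ∑' ζ, (‖a s ζ‖ + ‖a s (reflectFst ζ)‖) *
          ‖e s (ξ - ζ)‖ ≤ ∑' ξ, 2 * D * (freqWeight ξ ^ 3 * ‖e s ξ‖ ^ 2) := by
        refine hN2.trans ?_
        rw [tsum_mul_left]
        set X := ∑' ξ, freqWeight ξ ^ 3 * ‖e s ξ‖ ^ 2
        have hX : 0 ≤ X := tsum_nonneg fun ξ ↦ by have := freqWeight_pos ξ; positivity
        calc _ ≤ √X * (2 * D) * √X := by gcongr; exact (hd s hs).2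
          _ = √X * √X * (2 * D) := by ring
          _ = 2 * D * X := by rw [Real.mul_self_sqrt hX, mul_comm]
      have hG : ∀ ξ, 2 * (conj (e s ξ) * (-(Complex.I * (ξ.1 : ℂ) / 2) * Q s ξ +
          (linearSymbol ε β δ ξ : ℂ) * e s ξ)).re ≤ 2 * linearSymbol ε β δ ξ * ‖e s ξ‖ ^ 2 +
            freqNorm ξ * ‖e s ξ‖ * ∑' ζ, (‖a s ζ‖ + ‖a s (reflectFst ζ)‖) * ‖e s (ξ - ζ)‖ :=
        fun ξ ↦ by
          refine (two_mul_re_conj_mul_le ε β δ ξ (e s ξ) (Q s ξ)).trans ?_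
          have := freqNorm_nonneg ξ
          have := hQle s hs ξ
          gcongr
      have hlin : Summable fun ξ ↦ 2 * linearSymbol ε β δ ξ * ‖e s ξ‖ ^ 2 := by
        refine Summable.of_norm_bounded
          ((hes s hs).1.mul_left (2 * (|β - 1| + 1 + |δ| + |ε|))) fun ξ ↦ ?_
        rw [norm_mul, norm_mul, Real.norm_ofNat, Real.norm_eq_abs,
          Real.norm_of_nonneg (sq_nonneg ‖e s ξ‖)]
        have := mul_le_mul_of_nonneg_right (abs_linearSymbol_le ε β δ ξ) (sq_nonneg ‖e s ξ‖)
        linarith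
      have hGs : Summable fun ξ ↦ 2 * (conj (e s ξ) * (-(Complex.I * (ξ.1 : ℂ) / 2) * Q s ξ +
          (linearSymbol ε β δ ξ : ℂ) * e s ξ)).re := by
        refine Summable.of_norm_bounded ((hrhs s hs).1.mul_left 2) fun ξ ↦ ?_
        rw [norm_mul, Real.norm_ofNat]
        gcongr
        refine (Complex.abs_re_le_norm _).trans (le_of_eq ?_)
        rw [norm_mul, RCLike.norm_conj]
      refine (hGs.tsum_le_tsum hG (hlin.add hN1)).trans ?_
      rw [hlin.tsum_add hN1, ← tsum_mul_left]
      refine (add_le_add_right hN3 _).trans ?_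
      rw [← hlin.tsum_add (hW3.mul_left _)]
      refine (hlin.add (hW3.mul_left _)).tsum_le_tsum (fun ξ ↦ ?_) ((hes2 s hs).mul_left _)
      have h1 := hKle ξ
      have h2 : 0 ≤ ε / 2 * freqNorm ξ ^ 4 := by positivity
      have h3 : linearSymbol ε β δ ξ + D * freqWeight ξ ^ 3 ≤ K := by linarith
      have := mul_le_mul_of_nonneg_right h3 (sq_nonneg ‖e s ξ‖)
      linarith)
    ⟨ht, le_rfl⟩
  have hz : ‖e t ξ‖ ^ 2 = 0 := by
    have := (hes2 t ⟨ht, le_rfl⟩).le_tsum ξ (fun ζ _ ↦ sq_nonneg ‖e t ζ‖)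
    exact le_antisymm (this.trans hzero.le) (sq_nonneg _)
  have hz2 : e t ξ = 0 := by simpa using hz
  exact eq_neg_of_add_eq_zero_right hz2

end IsSpectralSolution

/-! ### Cancellation of the nonlinearity and the Dirichlet kernel estimate -/

/-- The quadratic nonlinearity does not contribute to the energy balance. -/
theorem hasSum_mul_conj_conv {a q : ℤ × ℤ → ℂ} (hneg : ∀ ξ, a (-ξ) = conj (a ξ))
    (hq : ∀ ξ, HasSum (fun ζ ↦ a ζ * a (ξ - ζ)) (q ξ))
    (ha : Summable fun ξ ↦ freqWeight ξ ^ 4 * ‖a ξ‖ ^ 2) :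
    HasSum (fun ξ : ℤ × ℤ ↦ (ξ.1 : ℂ) * (conj (a ξ) * q ξ)) 0 := by
  have hW3 := summable_weight_mono (f := fun ξ ↦ ‖a ξ‖) (j := 3) (k := 4) (by norm_num) ha
  have hd := summable_of_summable_weight hW3
  have h2 := summable_sq_of_weight (f := fun ξ ↦ ‖a ξ‖) ha
  have htri := summable_trilinear (f := fun ξ ↦ freqNorm ξ * ‖a ξ‖) (d := fun ξ ↦ ‖a ξ‖)
    (g := fun ξ ↦ ‖a ξ‖) (fun ξ ↦ mul_nonneg (freqNorm_nonneg ξ) (norm_nonneg _))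
    (fun ξ ↦ norm_nonneg _) (fun ξ ↦ norm_nonneg _)
    (summable_freqNorm_mul_sq (f := fun ξ ↦ ‖a ξ‖) (k := 4) (by norm_num) ha) hd h2
  set g : (ℤ × ℤ) × (ℤ × ℤ) → ℂ := fun p ↦ a (-p.1) * (a p.2 * a (p.1 - p.2)) with hg
  set F : (ℤ × ℤ) × (ℤ × ℤ) → ℂ := fun p ↦ (p.1.1 : ℂ) * g p with hF
  have hFs : Summable F := by
    refine Summable.of_norm_bounded htri fun p ↦ ?_
    rw [hF, hg]
    simp only [norm_mul, hneg, RCLike.norm_conj, Complex.norm_intCast]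
    have := abs_fst_le_freqNorm p.1
    rw [← mul_assoc]
    gcongr
  -- The product `g` is symmetric in the three frequencies -ξ, ζ, ξ-ζ, whose sum is zero. The two
  -- involutions permute them, so the weights of `F`, `F ∘ σ₁`, `F ∘ σ₂` add up to ξ₁ - ζ₁ + (ζ₁ -
  -- ξ₁) = 0.
  let σ₁ : (ℤ × ℤ) × (ℤ × ℤ) ≃ (ℤ × ℤ) × (ℤ × ℤ) :=
    ⟨fun p ↦ (-p.2, -p.1), fun p ↦ (-p.2, -p.1), fun p ↦ by simp, fun p ↦ by simp⟩
  let σ₂ : (ℤ × ℤ) × (ℤ × ℤ) ≃ (ℤ × ℤ) × (ℤ × ℤ) :=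
    ⟨fun p ↦ (p.2 - p.1, p.2), fun p ↦ (p.2 - p.1, p.2), fun p ↦ by simp, fun p ↦ by simp⟩
  have g1 : ∀ p, g (σ₁ p) = g p := fun p ↦ by
    simp only [hg, σ₁, Equiv.coe_fn_mk, neg_neg]
    rw [show -p.2 - -p.1 = p.1 - p.2 by abel]
    ring
  have g2 : ∀ p, g (σ₂ p) = g p := fun p ↦ by
    simp only [hg, σ₂, Equiv.coe_fn_mk, neg_sub]
    rw [show p.2 - p.1 - p.2 = -p.1 by abel]
    ring
  have t1 : ∑' p, F (σ₁ p) = ∑' p, F p := σ₁.tsum_eq F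
  have t2 : ∑' p, F (σ₂ p) = ∑' p, F p := σ₂.tsum_eq F
  have s1 : Summable fun p ↦ F (σ₁ p) := σ₁.summable_iff.mpr hFs
  have s2 : Summable fun p ↦ F (σ₂ p) := σ₂.summable_iff.mpr hFs
  have hzero : ∑' p, F p = 0 := by
    have h3 : ∑' p, (F p + F (σ₁ p) + F (σ₂ p)) = 0 := by
      rw [← tsum_zero]
      refine tsum_congr fun p ↦ ?_
      simp only [hF, g1, g2]
      simp only [σ₁, σ₂, Equiv.coe_fn_mk, Prod.fst_neg, Prod.fst_sub]
      push_cast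
      ring
    rw [(hFs.add s1).tsum_add s2, hFs.tsum_add s1, t1, t2] at h3
    have h4 : (3 : ℂ) * ∑' p, F p = 0 := by rw [← h3]; ring
    simpa using h4
  have hrow : ∀ ξ : ℤ × ℤ, HasSum (fun ζ ↦ F (ξ, ζ)) ((ξ.1 : ℂ) * (conj (a ξ) * q ξ)) := fun ξ ↦ by
    have := ((hq ξ).mul_left (conj (a ξ))).mul_left (ξ.1 : ℂ)
    refine this.congr_fun fun ζ ↦ ?_
    simp only [hF, hg, hneg]
  have := hFs.hasSum.prod_fiberwise hrow
  rwa [hzero] at this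

/-- Young's inequality for m²x and n²y. When m or n is zero the convention `0⁻¹ = 0` kills the right
side, and the hypotheses kill the left. -/
theorem two_mul_le_inv_sq_mul (m n : ℤ) {x y : ℝ} (hm : m = 0 → x = 0)
    (hn : n = 0 → y = 0) :
    2 * (x * y) ≤ (((m : ℝ) ^ 2)⁻¹ * ((n : ℝ) ^ 2)⁻¹) *
      ((m : ℝ) ^ 4 * x ^ 2 + (n : ℝ) ^ 4 * y ^ 2) := by
  rcases eq_or_ne m 0 with rfl | hm0
  · simp [hm rfl]
  rcases eq_or_ne n 0 with rfl | hn0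
  · simp [hn rfl]
  have hm' : (0 : ℝ) < (m : ℝ) ^ 2 := by positivity
  have hn' : (0 : ℝ) < (n : ℝ) ^ 2 := by positivity
  rw [← mul_inv, inv_mul_eq_div, le_div_iff₀ (by positivity)]
  nlinarith [sq_nonneg ((m : ℝ) ^ 2 * x - (n : ℝ) ^ 2 * y)]

theorem summable_int_inv_sq_prod :
    Summable fun p : ℤ × ℤ ↦ ((p.1 : ℝ) ^ 2)⁻¹ * ((p.2 : ℝ) ^ 2)⁻¹ := by
  have h : Summable fun n : ℤ ↦ ((n : ℝ) ^ 2)⁻¹ := by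
    simpa using Real.summable_one_div_int_pow.mpr one_lt_two
  exact h.mul_of_nonneg h (fun m ↦ by positivity) (fun m ↦ by positivity)

/-- The weight `(mn)⁻²` restricted to `L < |m| + |n|`. -/
noncomputable def tailWeight (L : ℤ) (m n : ℤ) : ℝ≥0∞ :=
  if L < |m| + |n| then ENNReal.ofReal (((m : ℝ) ^ 2)⁻¹ * ((n : ℝ) ^ 2)⁻¹) else 0

theorem exists_tailWeight_le {κ : ℝ} (hκ : 0 < κ) :
    ∃ L : ℤ, 0 ≤ L ∧ ∑' m, ∑' n, tailWeight L m n ≤ ENNReal.ofReal κ := by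
  set f : ℤ × ℤ → ℝ≥0∞ := fun p ↦ ENNReal.ofReal (((p.1 : ℝ) ^ 2)⁻¹ * ((p.2 : ℝ) ^ 2)⁻¹) with hf
  have hfs : ∑' p, f p ≠ ⊤ := by
    rw [hf, ← ENNReal.ofReal_tsum_of_nonneg (fun p ↦ by positivity) summable_int_inv_sq_prod]
    exact ENNReal.ofReal_ne_top
  have ht := ENNReal.tendsto_tsum_compl_atTop_zero hfs
  obtain ⟨s, hs⟩ := (ht.eventually (Iic_mem_nhds (ENNReal.ofReal_pos.mpr hκ))).exists
  -- This `L` dominates |m| + |n| for every pair in s, so the condition L < |m| + |n| forces the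
  -- pair outside s, where the sum is small.
  refine ⟨∑ p ∈ s, (|p.1| + |p.2|), Finset.sum_nonneg fun p _ ↦ by positivity, ?_⟩
  rw [← ENNReal.tsum_prod (f := fun m n ↦ tailWeight (∑ p ∈ s, (|p.1| + |p.2|)) m n)]
  refine le_trans ?_ hs
  have e : ∑' p : {p // p ∉ s}, f p = ∑' p, ({p | p ∉ s} : Set (ℤ × ℤ)).indicator f p :=
    tsum_subtype ({p | p ∉ s} : Set (ℤ × ℤ)) f
  rw [e]
  refine ENNReal.tsum_le_tsum fun p ↦ ?_
  unfold tailWeight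
  split_ifs with h
  · rw [Set.indicator_of_mem]
    intro hp
    exact absurd (Finset.single_le_sum (f := fun p : ℤ × ℤ ↦ |p.1| + |p.2|)
      (fun q _ ↦ by positivity) hp) (not_le.mpr h)
  · exact zero_le

theorem tsum_tailWeight_mul_le (L : ℤ) (h : ℤ → ℤ → ℝ≥0∞) :
    ∑' m, ∑' l, ∑' n, tailWeight L m n * (h m l + h n l) ≤
      2 * ((∑' m, ∑' n, tailWeight L m n) * ∑' m, ∑' l, h m l) := by
  have e1 : ∑' m, ∑' l, ∑' n, tailWeight L m n * h m l =
      ∑' m, ∑' n, tailWeight L m n * ∑' l, h m l := by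
    refine tsum_congr fun m ↦ ?_
    rw [ENNReal.tsum_comm]
    exact tsum_congr fun n ↦ ENNReal.tsum_mul_left
  have e2 : ∑' m, ∑' l, ∑' n, tailWeight L m n * h n l =
      ∑' m, ∑' n, tailWeight L m n * ∑' l, h n l := by
    refine tsum_congr fun m ↦ ?_
    rw [ENNReal.tsum_comm]
    exact tsum_congr fun n ↦ ENNReal.tsum_mul_left
  have hle : ∀ m, ∑' l, h m l ≤ ∑' m, ∑' l, h m l := fun m ↦
    ENNReal.le_tsum (f := fun m ↦ ∑' l, h m l) m
  simp only [mul_add, ENNReal.tsum_add]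
  rw [e1, e2, two_mul, ← ENNReal.tsum_mul_right]
  simp only [← ENNReal.tsum_mul_right]
  exact add_le_add
    (ENNReal.tsum_le_tsum fun m ↦ ENNReal.tsum_le_tsum fun n ↦ mul_le_mul' le_rfl (hle m))
    (ENNReal.tsum_le_tsum fun m ↦ ENNReal.tsum_le_tsum fun n ↦ mul_le_mul' le_rfl (hle n))

/-- Partial sums of an odd sequence over an interval only see the part that is not symmetric. -/
theorem norm_sum_Icc_shift_le {b : ℤ → ℂ} (hb : ∀ n, b (-n) = -b n) (L m : ℤ) :
    ‖∑ k ∈ Finset.Icc (-L) L, b (k - m)‖ ≤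
      ∑ n ∈ (Finset.Icc (-L - m) (L - m)).filter (fun n ↦ L < |m| + |n|), ‖b n‖ := by
  have e1 : ∑ k ∈ Finset.Icc (-L) L, b (k - m) = ∑ n ∈ Finset.Icc (-L - m) (L - m), b n := by
    refine Finset.sum_bij' (fun k _ ↦ k - m) (fun n _ ↦ n + m) ?_ ?_ ?_ ?_ ?_ <;> (simp; try omega)
  rw [e1, ← Finset.sum_filter_add_sum_filter_not _ (fun n ↦ L < |m| + |n|)]
  -- Integers with |n| ≤ L - |m| all lie in the shifted window and form a symmetric set, on which an
  -- odd sequence sums to zero.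
  have hz : ∑ n ∈ (Finset.Icc (-L - m) (L - m)).filter (fun n ↦ ¬ L < |m| + |n|), b n = 0 := by
    have h1 : ∑ n ∈ (Finset.Icc (-L - m) (L - m)).filter (fun n ↦ ¬ L < |m| + |n|), b n =
        ∑ n ∈ (Finset.Icc (-L - m) (L - m)).filter (fun n ↦ ¬ L < |m| + |n|), b (-n) := by
      refine Finset.sum_bij' (fun n _ ↦ -n) (fun n _ ↦ -n) ?_ ?_ ?_ ?_ ?_
      · intro n hn
        simp only [Finset.mem_filter, Finset.mem_Icc, abs_neg] at hn ⊢
        refine ⟨?_, hn.2⟩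
        rcases abs_cases m with h | h <;> rcases abs_cases n with h' | h' <;> omega
      · intro n hn
        simp only [Finset.mem_filter, Finset.mem_Icc, abs_neg] at hn ⊢
        refine ⟨?_, hn.2⟩
        rcases abs_cases m with h | h <;> rcases abs_cases n with h' | h' <;> omega
      all_goals simp
    simp only [hb, Finset.sum_neg_distrib] at h1
    exact self_eq_neg.mp h1
  rw [hz, add_zero]
  exact norm_sum_le _ _

/-- The sum of the low modes of the square of an odd function, i.e. its mean against a Dirichlet
kernel, is small compared with the fourth order seminorm. -/
theorem exists_norm_sum_conv_le {κ : ℝ} (hκ : 0 < κ) :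
    ∃ L : ℤ, 0 ≤ L ∧ ∀ a q : ℤ × ℤ → ℂ, (∀ ξ, a (-ξ) = conj (a ξ)) →
      (∀ m l, a (-m, l) = -a (m, l)) →
      (∀ ξ, HasSum (fun ζ ↦ a ζ * a (ξ - ζ)) (q ξ)) →
      (Summable fun ξ ↦ freqWeight ξ ^ 4 * ‖a ξ‖ ^ 2) →
      ‖∑ k ∈ Finset.Icc (-L) L, q (k, 0)‖ ≤ κ * ∑' ξ, freqNorm ξ ^ 4 * ‖a ξ‖ ^ 2 := by
  obtain ⟨L, hL, hLκ⟩ := exists_tailWeight_le hκ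
  refine ⟨L, hL, fun a q hneg hodd hq ha ↦ ?_⟩
  have hN : Summable fun ξ ↦ freqNorm ξ ^ 4 * ‖a ξ‖ ^ 2 := by
    refine Summable.of_nonneg_of_le (fun ξ ↦ by positivity) (fun ξ ↦ ?_) ha
    have := freqNorm_nonneg ξ
    gcongr
    exact freqNorm_le_freqWeight ξ
  have hz : ∀ l, a (0, l) = 0 := fun l ↦ by
    have := hodd 0 l
    rw [neg_zero] at this
    exact self_eq_neg.mp this
  have hrefl : ∀ n l, ‖a (n, -l)‖ = ‖a (n, l)‖ := fun n l ↦ by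
    have h1 := hneg (-n, l)
    rw [Prod.neg_mk, neg_neg] at h1
    rw [h1, RCLike.norm_conj, hodd, norm_neg]
  have hS := hasSum_sum (s := Finset.Icc (-L) L) fun k _ ↦ hq (k, 0)
  set h : ℤ → ℤ → ℝ≥0∞ := fun m l ↦ ENNReal.ofReal ((m : ℝ) ^ 4 * ‖a (m, l)‖ ^ 2) with hh
  -- Summing over k before (m, l) is essential: oddness cancels all but the pairs with L < |m| +
  -- |n|, and Young's inequality on these yields the small tail weight.
  have hterm : ∀ m l, 2 * ENNReal.ofReal ‖∑ k ∈ Finset.Icc (-L) L, a (m, l) * a ((k, 0) - (m, l))‖ ≤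
      ∑' n, tailWeight L m n * (h m l + h n l) := by
    intro m l
    have h1 := norm_sum_Icc_shift_le (b := fun n ↦ a (n, -l)) (fun n ↦ hodd n (-l)) L m
    have e2 : ENNReal.ofReal 2 = 2 := by simp
    have h2 : 2 * ENNReal.ofReal ‖∑ k ∈ Finset.Icc (-L) L, a (m, l) * a ((k, 0) - (m, l))‖ ≤
        ENNReal.ofReal (∑ n ∈ (Finset.Icc (-L - m) (L - m)).filter (fun n ↦ L < |m| + |n|),
          2 * (‖a (m, l)‖ * ‖a (n, l)‖)) := by
      rw [← e2, ← ENNReal.ofReal_mul zero_le_two]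
      apply ENNReal.ofReal_le_ofReal
      rw [← Finset.mul_sum, ← Finset.mul_sum, ← Finset.mul_sum, norm_mul]
      simp only [hrefl] at h1
      simp only [Prod.mk_sub_mk, zero_sub]
      gcongr
    refine h2.trans ?_
    rw [ENNReal.ofReal_sum_of_nonneg fun n _ ↦ by positivity]
    refine le_trans (Finset.sum_le_sum fun n hn ↦ ?_) (ENNReal.sum_le_tsum _)
    rw [tailWeight, if_pos (Finset.mem_filter.mp hn).2, hh, ← ENNReal.ofReal_add (by positivity)
      (by positivity), ← ENNReal.ofReal_mul (by positivity)]
    apply ENNReal.ofReal_le_ofReal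
    exact two_mul_le_inv_sq_mul m n (fun h0 ↦ by rw [h0, hz, norm_zero])
      (fun h0 ↦ by rw [h0, hz, norm_zero])
  have hH : ∑' m, ∑' l, h m l ≤ ENNReal.ofReal (∑' ξ, freqNorm ξ ^ 4 * ‖a ξ‖ ^ 2) := by
    rw [ENNReal.ofReal_tsum_of_nonneg (fun ξ ↦ by positivity) hN,
      ← ENNReal.tsum_prod (f := fun m l ↦ h m l)]
    refine ENNReal.tsum_le_tsum fun p ↦ ENNReal.ofReal_le_ofReal ?_
    have h1 : (p.1 : ℝ) ^ 4 ≤ freqNorm p ^ 4 := by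
      rw [show (p.1 : ℝ) ^ 4 = |(p.1 : ℝ)| ^ 4 from (Even.pow_abs ⟨2, rfl⟩ _).symm]
      exact pow_le_pow_left₀ (abs_nonneg _) (abs_fst_le_freqNorm p) 4
    gcongr
  have htot : ∑' ζ : ℤ × ℤ, ENNReal.ofReal ‖∑ k ∈ Finset.Icc (-L) L, a ζ * a ((k, 0) - ζ)‖ ≤
      ENNReal.ofReal (κ * ∑' ξ, freqNorm ξ ^ 4 * ‖a ξ‖ ^ 2) := by
    have h2 : 2 * ∑' ζ : ℤ × ℤ, ENNReal.ofReal ‖∑ k ∈ Finset.Icc (-L) L, a ζ * a ((k, 0) - ζ)‖ ≤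
        2 * ENNReal.ofReal (κ * ∑' ξ, freqNorm ξ ^ 4 * ‖a ξ‖ ^ 2) := by
      rw [← ENNReal.tsum_mul_left, ENNReal.tsum_prod' (f := fun ζ : ℤ × ℤ ↦
        2 * ENNReal.ofReal ‖∑ k ∈ Finset.Icc (-L) L, a ζ * a ((k, 0) - ζ)‖)]
      refine (ENNReal.tsum_le_tsum fun m ↦ ENNReal.tsum_le_tsum fun l ↦ hterm m l).trans ?_
      refine (tsum_tailWeight_mul_le L h).trans ?_
      rw [ENNReal.ofReal_mul hκ.le]
      gcongr
    rwa [ENNReal.mul_le_mul_iff_right (by simp) (by simp)] at h2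
  have hfin : Summable fun ζ : ℤ × ℤ ↦ ‖∑ k ∈ Finset.Icc (-L) L, a ζ * a ((k, 0) - ζ)‖ := by
    have := ENNReal.summable_toReal (ne_top_of_le_ne_top ENNReal.ofReal_ne_top htot)
    exact this.congr fun ζ ↦ ENNReal.toReal_ofReal (norm_nonneg _)
  rw [← ENNReal.ofReal_tsum_of_nonneg (fun ζ ↦ norm_nonneg _) hfin,
    ENNReal.ofReal_le_ofReal_iff (mul_nonneg hκ.le (tsum_nonneg fun ξ ↦ by positivity))] at htot
  rw [← hS.tsum_eq]
  exact (norm_tsum_le_tsum_norm hfin).trans htot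

/-! ### The uniform energy bound -/

namespace IsSpectralSolution

variable {ε β δ : ℝ} {a q : ℝ → ℤ × ℤ → ℂ}

/-- The quantities needed to run energy estimates on `[0, T]`. -/
theorem exists_energy_bound (h : IsSpectralSolution ε β δ a q) (T : ℝ) :
    ∃ B, ∀ t ∈ Set.Icc 0 T, (Summable fun ξ ↦ ‖a t ξ‖ ^ 2) ∧ (∑' ξ, ‖a t ξ‖ ^ 2 ≤ B) ∧
      (Summable fun ξ ↦ ‖a t ξ‖ *
        ‖-(Complex.I * (ξ.1 : ℂ) / 2) * q t ξ + (linearSymbol ε β δ ξ : ℂ) * a t ξ‖) ∧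
      ∑' ξ, ‖a t ξ‖ *
        ‖-(Complex.I * (ξ.1 : ℂ) / 2) * q t ξ + (linearSymbol ε β δ ξ : ℂ) * a t ξ‖ ≤ B := by
  obtain ⟨B, D, hB, hD, hb⟩ := h.exists_bound T
  refine ⟨max B (B * D + (|β - 1| + 1 + |δ| + |ε|) * B), fun t ht ↦ ?_⟩
  obtain ⟨h1, h2, h3, h4⟩ := hb t ht
  have h5 := summable_sq_of_weight (f := fun ξ ↦ ‖a t ξ‖) h1
  have h6 := (tsum_sq_le_weight (f := fun ξ ↦ ‖a t ξ‖) h1).trans h2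
  have h7 := summable_norm_mul_norm_rhs (x := a t) (Q := q t) ε β δ (fun ξ ↦ norm_nonneg (a t ξ))
    (fun ξ ↦ norm_nonneg (a t ξ)) h1 h2 h3 h4 h5 h6 (h.norm_conv_le h5)
  exact ⟨h5, h6.trans (le_max_left _ _), h7.1, h7.2.trans (le_max_right _ _)⟩

theorem continuousOn_rhs (h : IsSpectralSolution ε β δ a q) (ξ : ℤ × ℤ) :
    ContinuousOn (fun t ↦ -(Complex.I * (ξ.1 : ℂ) / 2) * q t ξ +
      (linearSymbol ε β δ ξ : ℂ) * a t ξ) (Set.Ici 0) :=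
  (continuousOn_const.mul (h.continuousOn_conv ξ)).add
    (continuousOn_const.mul (h.continuousOn ξ))

theorem summable_weight (h : IsSpectralSolution ε β δ a q) {t : ℝ} (ht : 0 ≤ t) :
    Summable fun ξ ↦ freqWeight ξ ^ 4 * ‖a t ξ‖ ^ 2 := by
  obtain ⟨B, -, hb⟩ := h.bounded t
  exact (hb t ⟨ht, le_rfl⟩).1

theorem summable_sq (h : IsSpectralSolution ε β δ a q) {t : ℝ} (ht : 0 ≤ t) :
    Summable fun ξ ↦ ‖a t ξ‖ ^ 2 :=
  summable_sq_of_weight (f := fun ξ ↦ ‖a t ξ‖) (h.summable_weight ht)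

theorem isPrimitiveOn_energy (h : IsSpectralSolution ε β δ a q) {T : ℝ} (hT : 0 ≤ T) :
    IsPrimitiveOn (fun t ↦ ∑' ξ, ‖a t ξ‖ ^ 2)
      (fun t ↦ ∑' ξ, 2 * (conj (a t ξ) * (-(Complex.I * (ξ.1 : ℂ) / 2) * q t ξ +
        (linearSymbol ε β δ ξ : ℂ) * a t ξ)).re) 0 T := by
  obtain ⟨B, hb⟩ := h.exists_energy_bound T
  have hsub : Set.Icc 0 T ⊆ Set.Ici 0 := fun s hs ↦ hs.1
  have := isPrimitiveOn_weighted_energy (x := a) (n := 0) (ψ := fun _ ↦ 0) hT (fun _ ↦ le_rfl)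
    (fun _ ↦ le_rfl) (fun ξ ↦ (h.continuousOn ξ).mono hsub)
    (fun ξ ↦ (h.continuousOn_rhs ξ).mono hsub) (fun ξ s hs ↦ h.hasDerivAt ξ s hs.1)
    (fun s hs ↦ (hb s hs).1) (fun s hs ↦ (hb s hs).2.1) (fun s hs ↦ (hb s hs).2.2.1)
    (fun s hs ↦ (hb s hs).2.2.2)
  simpa only [mul_zero, Real.exp_zero, one_mul, zero_mul, zero_add] using this

theorem summable_linearSymbol_mul (h : IsSpectralSolution ε β δ a q) {t : ℝ} (ht : 0 ≤ t) :
    Summable fun ξ ↦ linearSymbol ε β δ ξ * ‖a t ξ‖ ^ 2 := by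
  refine Summable.of_norm_bounded
    ((h.summable_weight ht).mul_left (|β - 1| + 1 + |δ| + |ε|)) fun ξ ↦ ?_
  rw [norm_mul, Real.norm_eq_abs, Real.norm_of_nonneg (sq_nonneg ‖a t ξ‖), ← mul_assoc]
  gcongr
  exact abs_linearSymbol_le ε β δ ξ

/-- Only the linear part survives, because the pairing of η with (η²)_x vanishes. -/
theorem tsum_energy_rate (h : IsSpectralSolution ε β δ a q) {t : ℝ} (ht : 0 ≤ t) :
    ∑' ξ, 2 * (conj (a t ξ) * (-(Complex.I * (ξ.1 : ℂ) / 2) * q t ξ +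
        (linearSymbol ε β δ ξ : ℂ) * a t ξ)).re =
      2 * ∑' ξ, linearSymbol ε β δ ξ * ‖a t ξ‖ ^ 2 := by
  have h1 := (hasSum_mul_conj_conv (h.neg t) (h.conv t) (h.summable_weight ht)).mul_left (-Complex.I)
  have h2 := Complex.hasSum_re h1
  have h3 := h2.add ((h.summable_linearSymbol_mul ht).hasSum.mul_left 2)
  rw [mul_zero, Complex.zero_re, zero_add] at h3
  rw [← h3.tsum_eq]
  refine tsum_congr fun ξ ↦ ?_
  have e : conj (a t ξ) * (-(Complex.I * (ξ.1 : ℂ) / 2) * q t ξ +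
        (linearSymbol ε β δ ξ : ℂ) * a t ξ) =
      ((1 / 2 : ℝ) : ℂ) * (-Complex.I * ((ξ.1 : ℂ) * (conj (a t ξ) * q t ξ))) +
        ((linearSymbol ε β δ ξ * ‖a t ξ‖ ^ 2 : ℝ) : ℂ) := by
    have : a t ξ * conj (a t ξ) = ((‖a t ξ‖ ^ 2 : ℝ) : ℂ) := by
      rw [Complex.mul_conj, Complex.normSq_eq_norm_sq]
    rw [Complex.ofReal_mul, ← this]
    push_cast
    ring
  rw [e, Complex.add_re, Complex.ofReal_re, Complex.re_ofReal_mul]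
  ring

theorem norm_le_sqrt_energy (h : IsSpectralSolution ε β δ a q) {t : ℝ} (ht : 0 ≤ t) (ξ : ℤ × ℤ) :
    ‖a t ξ‖ ≤ √(∑' ξ, ‖a t ξ‖ ^ 2) :=
  Real.le_sqrt_of_sq_le ((h.summable_sq ht).le_tsum ξ fun _ _ ↦ sq_nonneg _)

/-- Crude bound for the pairing of a sequence with the background function
`-2 γ ∑_{1 ≤ k ≤ L} sin (k x) / k`. -/
theorem abs_backgroundPairing_le (γ : ℝ) (S : Finset ℤ) (w : ℤ → ℝ) {u : ℤ × ℤ → ℂ} {r : ℝ}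
    (hu : ∀ ξ, ‖u ξ‖ ≤ r) :
    |∑ k ∈ S, γ / k * w k * (u (k, 0)).im| ≤ (∑ k ∈ S, |γ / k * w k|) * r := by
  refine (Finset.abs_sum_le_sum_abs _ _).trans ?_
  rw [Finset.sum_mul]
  refine Finset.sum_le_sum fun k _ ↦ ?_
  rw [abs_mul]
  gcongr
  exact (Complex.abs_im_le_norm _).trans (hu _)

/-- Dividing by k cancels the derivative in (η²)_x: each mode contributes γ Re q(k,0), and with S =
{0 < |k| ≤ L} these add up to the Dirichlet kernel without its zero mode. -/
theorem isPrimitiveOn_backgroundPairing (h : IsSpectralSolution ε β δ a q) {T : ℝ} (hT : 0 ≤ T)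
    (γ : ℝ) {S : Finset ℤ} (hS : ∀ k ∈ S, k ≠ 0) :
    IsPrimitiveOn (fun t ↦ -2 * ∑ k ∈ S, γ / k * (a t (k, 0)).im)
      (fun t ↦ γ * ∑ k ∈ S, (q t (k, 0)).re -
        2 * ∑ k ∈ S, γ / k * linearSymbol ε β δ (k, 0) * (a t (k, 0)).im) 0 T := by
  have hsub : Set.Icc 0 T ⊆ Set.Ici 0 := fun s hs ↦ hs.1
  have him : ∀ k : ℤ, ContinuousOn (fun t ↦ (a t (k, 0)).im) (Set.Icc 0 T) := fun k ↦
    Complex.continuous_im.comp_continuousOn ((h.continuousOn (k, 0)).mono hsub)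
  have hre : ∀ k : ℤ, ContinuousOn (fun t ↦ (q t (k, 0)).re) (Set.Icc 0 T) := fun k ↦
    Complex.continuous_re.comp_continuousOn ((h.continuousOn_conv (k, 0)).mono hsub)
  refine IsPrimitiveOn.of_hasDerivAt hT ?_ ?_ fun t ht ↦ ?_
  · exact continuousOn_const.mul
      (continuousOn_finsetSum _ fun k _ ↦ continuousOn_const.mul (him k))
  · exact (continuousOn_const.mul (continuousOn_finsetSum _ fun k _ ↦ hre k)).sub
      (continuousOn_const.mul (continuousOn_finsetSum _ fun k _ ↦ continuousOn_const.mul (him k)))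
  · have hd : ∀ k ∈ S, HasDerivAt (fun t ↦ γ / k * (a t (k, 0)).im)
        (-(γ / 2) * (q t (k, 0)).re + γ / k * linearSymbol ε β δ (k, 0) * (a t (k, 0)).im) t := by
      intro k hk
      have h1 := (h.hasDerivAt (k, 0) t ht.1)
      have h2 := (Complex.imCLM.hasFDerivAt.comp_hasDerivAt t h1).const_mul (γ / k)
      refine h2.congr_deriv ?_
      have hk0 : (k : ℝ) ≠ 0 := by exact_mod_cast hS k hk
      rw [Complex.imCLM_apply, Complex.add_im, Complex.im_ofReal_mul]
      have e : -(Complex.I * ((k : ℤ) : ℂ) / 2) * q t (k, 0) =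
          ((-(k / 2 : ℝ) : ℝ) : ℂ) * (Complex.I * q t (k, 0)) := by
        push_cast
        ring
      rw [e, Complex.im_ofReal_mul, Complex.I_mul_im]
      field_simp
    refine ((HasDerivAt.fun_sum hd).const_mul (-2)).congr_deriv ?_
    rw [Finset.sum_add_distrib, ← Finset.mul_sum]
    ring

theorem conv_zero (h : IsSpectralSolution ε β δ a q) (t : ℝ) :
    (q t (0, 0)).re = ∑' ξ, ‖a t ξ‖ ^ 2 := by
  have h1 := Complex.hasSum_re (h.conv t (0, 0))
  rw [← h1.tsum_eq]
  refine tsum_congr fun ξ ↦ ?_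
  rw [show ((0, 0) : ℤ × ℤ) - ξ = -ξ from zero_sub ξ, h.neg, Complex.mul_conj,
    Complex.normSq_eq_norm_sq, Complex.ofReal_re]

/-- Uniform in time bound of the energy of solutions that are odd in the first variable. -/
theorem exists_energy_le (β : ℝ) (hε : 0 < ε) (hδ : 0 ≤ δ) {Y₀ : ℝ} (hY₀ : 0 ≤ Y₀) :
    ∃ C, 0 ≤ C ∧ ∀ a q : ℝ → ℤ × ℤ → ℂ, IsSpectralSolution ε β δ a q →
      (∀ ξ, a 0 (reflectFst ξ) = -a 0 ξ) → ∑' ξ, ‖a 0 ξ‖ ^ 2 ≤ Y₀ →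
      ∀ t, 0 ≤ t → ∑' ξ, ‖a t ξ‖ ^ 2 ≤ C := by
  obtain ⟨A, hA, hlam⟩ := exists_linearSymbol_le β δ hε hδ 0 le_rfl
  -- The part 2A beats the linear growth 2A‖a‖²; the remaining 2 gives damping -2‖a‖² against the
  -- forcing 2c₁‖a‖.
  set γ := 2 * A + 2 with hγ
  have hγ0 : 0 < γ := by positivity
  -- With κ = ε/γ the kernel error γκZ equals the available dissipation 2(ε/2)Z, where Z = ∑
  -- |ξ|⁴|a|².
  obtain ⟨L, hL, hR⟩ := exists_norm_sum_conv_le (div_pos hε hγ0)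
  set S := (Finset.Icc (-L) L).erase 0 with hS
  set c₁ := ∑ k ∈ S, |γ / k * linearSymbol ε β δ (k, 0)| with hc₁
  set c₂ := ∑ k ∈ S, |γ / k * 1| with hc₂
  have hc₁0 : 0 ≤ c₁ := Finset.sum_nonneg fun _ _ ↦ abs_nonneg _
  have hc₂0 : 0 ≤ c₂ := Finset.sum_nonneg fun _ _ ↦ abs_nonneg _
  -- The functional lies between w² - 2c₂w and w² + 2c₂w ≤ 2w² + c₂², w being the ℓ² norm of a.
  -- Hence it starts below `M`, exceeds `M` only if w ≥ c₁, and being at most `M` forces w² ≤ 2M +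
  -- 4c₂².
  set M := 2 * Y₀ + 2 * c₁ ^ 2 + c₂ ^ 2 with hM
  refine ⟨2 * M + 4 * c₂ ^ 2, by positivity, fun a q h hodd hY t ht ↦ ?_⟩
  have hprim := (h.isPrimitiveOn_energy ht).add (h.isPrimitiveOn_backgroundPairing ht γ
    (S := S) fun k hk ↦ Finset.ne_of_mem_erase hk)
  have hy0 : ∀ s, 0 ≤ ∑' ξ, ‖a s ξ‖ ^ 2 := fun s ↦ tsum_nonneg fun ξ ↦ sq_nonneg _
  have hsq : ∀ s, √(∑' ξ, ‖a s ξ‖ ^ 2) ^ 2 = ∑' ξ, ‖a s ξ‖ ^ 2 := fun s ↦ Real.sq_sqrt (hy0 s)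
  have hpair : ∀ s, 0 ≤ s → |∑ k ∈ S, γ / k * (a s (k, 0)).im| ≤
      c₂ * √(∑' ξ, ‖a s ξ‖ ^ 2) := fun s hs ↦ by
    have := abs_backgroundPairing_le γ S (fun _ ↦ 1) (h.norm_le_sqrt_energy hs)
    simpa only [mul_one, hc₂] using this
  have hbar : ∀ s ∈ Set.Icc 0 t, ∑' ξ, ‖a s ξ‖ ^ 2 +
      -2 * ∑ k ∈ S, γ / k * (a s (k, 0)).im ≤ M := fun s hs ↦ by
    refine hprim.le_of_nonpos_above ?_ ?_ hs
    · have h1 := (abs_le.mp (hpair 0 le_rfl)).1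
      have h2 := hsq 0
      nlinarith [sq_nonneg (√(∑' ξ, ‖a 0 ξ‖ ^ 2) - c₂)]
    · intro r hr hlt
      have hr0 := hr.1
      have h1 := (abs_le.mp (hpair r hr0)).1
      have h2 := hsq r
      set w := √(∑' ξ, ‖a r ξ‖ ^ 2) with hw
      have hw0 : 0 ≤ w := Real.sqrt_nonneg _
      have hwc : c₁ ≤ w := by
        have : c₁ ^ 2 ≤ w ^ 2 := by nlinarith [sq_nonneg (w - c₂)]
        exact (sq_le_sq₀ hc₁0 hw0).mp this
      have hlin := (abs_le.mp (abs_backgroundPairing_le γ S (fun k ↦ linearSymbol ε β δ (k, 0))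
        (h.norm_le_sqrt_energy hr0))).1
      have hodd' : ∀ m l, a r (-m, l) = -a r (m, l) := fun m l ↦ h.odd hε hδ hodd hr0 (m, l)
      have hRr := hR (a r) (q r) (h.neg r) hodd' (h.conv r) (h.summable_weight hr0)
      -- The zero mode missing from `S` is the mean of η², which produces the damping.
      have hsplit : ∑ k ∈ S, (q r (k, 0)).re =
          (∑ k ∈ Finset.Icc (-L) L, q r (k, 0)).re - w ^ 2 := by
        rw [Complex.re_sum, h2, ← h.conv_zero r, eq_sub_iff_add_eq,
          Finset.sum_erase_add _ _ (Finset.mem_Icc.mpr ⟨by omega, hL⟩)]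
      have hre := (Complex.re_le_norm (∑ k ∈ Finset.Icc (-L) L, q r (k, 0))).trans hRr
      have hN : Summable fun ξ ↦ freqNorm ξ ^ 4 * ‖a r ξ‖ ^ 2 := by
        refine Summable.of_nonneg_of_le (fun ξ ↦ by positivity) (fun ξ ↦ ?_) (h.summable_weight hr0)
        have := freqNorm_nonneg ξ
        gcongr
        exact freqNorm_le_freqWeight ξ
      set Z := ∑' ξ, freqNorm ξ ^ 4 * ‖a r ξ‖ ^ 2 with hZ
      have hlamZ : ∑' ξ, linearSymbol ε β δ ξ * ‖a r ξ‖ ^ 2 ≤ A * w ^ 2 - ε / 2 * Z := by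
        rw [h2, hZ, ← tsum_mul_left, ← tsum_mul_left,
          ← ((h.summable_sq hr0).mul_left _).tsum_sub (hN.mul_left _)]
        refine (h.summable_linearSymbol_mul hr0).tsum_le_tsum (fun ξ ↦ ?_)
          (((h.summable_sq hr0).mul_left _).sub (hN.mul_left _))
        have h3 := hlam ξ
        rw [zero_mul, add_zero] at h3
        have := mul_le_mul_of_nonneg_right h3 (sq_nonneg ‖a r ξ‖)
        linarith
      rw [h.tsum_energy_rate hr0, hsplit]
      have h5 : γ * (∑ k ∈ Finset.Icc (-L) L, q r (k, 0)).re ≤ ε * Z := by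
        have := mul_le_mul_of_nonneg_left hre hγ0.le
        rwa [← mul_assoc, mul_div_cancel₀ _ hγ0.ne'] at this
      have h6 : c₁ * w ≤ w * w := by gcongr
      simp only [← hc₁, ← hw] at hlin
      nlinarith
  have h1 := hbar t ⟨ht, le_rfl⟩
  have h2 := (abs_le.mp (hpair t ht)).2
  have h3 := hsq t
  nlinarith [sq_nonneg (√(∑' ξ, ‖a t ξ‖ ^ 2) - 2 * c₂)]

end IsSpectralSolution

/-! ### Gevrey smoothing at a uniform rate -/

/-- The truncated frequency `min |ξ| n`; it is bounded and subadditive. -/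
noncomputable def truncFreq (n : ℝ) (ξ : ℤ × ℤ) : ℝ := min (freqNorm ξ) n

theorem truncFreq_nonneg {n : ℝ} (hn : 0 ≤ n) (ξ : ℤ × ℤ) : 0 ≤ truncFreq n ξ :=
  le_min (freqNorm_nonneg ξ) hn

/-- If either term on the right is truncated, that side is already at least n; otherwise it is the
triangle inequality. -/
theorem truncFreq_le_add {n : ℝ} (hn : 0 ≤ n) (ξ ζ : ℤ × ℤ) :
    truncFreq n ξ ≤ truncFreq n ζ + truncFreq n (ξ - ζ) := by
  have h := freqNorm_add_le ζ (ξ - ζ)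
  rw [add_sub_cancel] at h
  have h1 := freqNorm_nonneg ζ
  have h2 := freqNorm_nonneg (ξ - ζ)
  unfold truncFreq
  rcases le_total (freqNorm ζ) n with h3 | h3 <;> rcases le_total (freqNorm (ξ - ζ)) n with h4 | h4
  · rw [min_eq_left h3, min_eq_left h4]
    exact (min_le_left _ _).trans h
  · rw [min_eq_left h3, min_eq_right h4]
    linarith [min_le_right (freqNorm ξ) n]
  · rw [min_eq_right h3, min_eq_left h4]
    linarith [min_le_right (freqNorm ξ) n]
  · rw [min_eq_right h3, min_eq_right h4]
    linarith [min_le_right (freqNorm ξ) n]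

namespace IsSpectralSolution

variable {ε β δ : ℝ} {a q : ℝ → ℤ × ℤ → ℂ}

/-- The rate of change of a truncated Gevrey norm is controlled by the Gevrey norm itself. -/
theorem gevrey_rate_le (h : IsSpectralSolution ε β δ a q) {n s t K P B : ℝ} (hn : 0 ≤ n)
    (hs : 0 ≤ s) (ht : 0 ≤ t) (hK0 : 0 ≤ K) (hP : √weightConst * √B ≤ P)
    (hK : ∀ ξ, 2 * freqNorm ξ + 2 * linearSymbol ε β δ ξ + P * freqWeight ξ ^ 3 ≤ K)
    (hy : ∑' ξ, Real.exp (2 * s * truncFreq n ξ) * ‖a t ξ‖ ^ 2 ≤ B)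
    (hG : Summable fun ξ ↦ Real.exp (2 * s * truncFreq n ξ) *
      (2 * truncFreq n ξ * ‖a t ξ‖ ^ 2 + 2 * (conj (a t ξ) * (-(Complex.I * (ξ.1 : ℂ) / 2) * q t ξ +
        (linearSymbol ε β δ ξ : ℂ) * a t ξ)).re)) :
    ∑' ξ, Real.exp (2 * s * truncFreq n ξ) *
      (2 * truncFreq n ξ * ‖a t ξ‖ ^ 2 + 2 * (conj (a t ξ) * (-(Complex.I * (ξ.1 : ℂ) / 2) * q t ξ +
        (linearSymbol ε β δ ξ : ℂ) * a t ξ)).re) ≤ K * B := by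
  set v : ℤ × ℤ → ℝ := fun ξ ↦ Real.exp (s * truncFreq n ξ) with hv
  set b : ℤ × ℤ → ℝ := fun ξ ↦ v ξ * ‖a t ξ‖ with hb
  have hv0 : ∀ ξ, 0 < v ξ := fun ξ ↦ Real.exp_pos _
  have hv2 : ∀ ξ, Real.exp (2 * s * truncFreq n ξ) = v ξ ^ 2 := fun ξ ↦ by
    rw [hv, ← Real.exp_nat_mul]
    congr 1
    push_cast
    ring
  have hb0 : ∀ ξ, 0 ≤ b ξ := fun ξ ↦ mul_nonneg (hv0 ξ).le (norm_nonneg _)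
  have hvle : ∀ ξ, v ξ ≤ Real.exp (s * n) := fun ξ ↦ by
    rw [hv]
    have : truncFreq n ξ ≤ n := min_le_right _ _
    dsimp only
    gcongr
  have hvmul : ∀ ξ ζ, v ξ ≤ v ζ * v (ξ - ζ) := fun ξ ζ ↦ by
    rw [hv]
    dsimp only
    rw [← Real.exp_add, ← mul_add]
    have := truncFreq_le_add hn ξ ζ
    gcongr
  -- Qualitative only: the bound depends on n, but it justifies the sums; the final estimate does
  -- not involve n.
  have hW4 : Summable fun ξ ↦ freqWeight ξ ^ 4 * b ξ ^ 2 := by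
    refine Summable.of_nonneg_of_le (fun ξ ↦ by have := freqWeight_pos ξ; positivity) (fun ξ ↦ ?_)
      ((h.summable_weight ht).mul_left (Real.exp (s * n) ^ 2))
    have := pow_le_pow_left₀ (hv0 ξ).le (hvle ξ) 2
    have h1 := mul_le_mul_of_nonneg_right this
      (mul_nonneg (pow_nonneg (freqWeight_pos ξ).le 4) (sq_nonneg ‖a t ξ‖))
    simp only [hb, mul_pow]
    linarith
  have hW3 := summable_weight_mono (j := 3) (k := 4) (by norm_num) hW4
  have hb1 := summable_of_summable_weight hW3
  have hb2 := summable_sq_of_weight hW4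
  have hyb : ∑' ξ, b ξ ^ 2 ≤ B := by
    refine le_trans (le_of_eq (tsum_congr fun ξ ↦ ?_)) hy
    rw [hv2, hb, mul_pow]
  have hq : ∀ ξ, v ξ * ‖q t ξ‖ ≤ ∑' ζ, b ζ * b (ξ - ζ) := fun ξ ↦ by
    have h1 := h.norm_conv_le (h.summable_sq ht) ξ
    have h2 := (tsum_mul_reflect_le (h.summable_sq ht) (h.summable_sq ht) ξ).1
    have h3 := (tsum_mul_reflect_le hb2 hb2 ξ).1
    refine (mul_le_mul_of_nonneg_left h1 (hv0 ξ).le).trans ?_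
    rw [← tsum_mul_left]
    refine (h2.mul_left _).tsum_le_tsum (fun ζ ↦ ?_) h3
    have := mul_le_mul_of_nonneg_right (hvmul ξ ζ)
      (mul_nonneg (norm_nonneg (a t ζ)) (norm_nonneg (a t (ξ - ζ))))
    simp only [hb]
    linarith
  obtain ⟨hN1, hN2⟩ := tsum_freqNorm_mul_conv_le (k := 3) (by norm_num) hb0 hb0 hb0 hW3 hb1 hb2
  have hN3 : ∑' ξ, freqNorm ξ * b ξ * ∑' ζ, b ζ * b (ξ - ζ) ≤
      ∑' ξ, P * (freqWeight ξ ^ 3 * b ξ ^ 2) := by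
    refine hN2.trans ?_
    have hl1 := tsum_le_sqrt_weight hW3
    rw [tsum_mul_left]
    set X := ∑' ξ, freqWeight ξ ^ 3 * b ξ ^ 2
    have hX : 0 ≤ X := tsum_nonneg fun ξ ↦ by have := freqWeight_pos ξ; positivity
    calc _ ≤ √X * (√weightConst * √X) * √B := by
          gcongr ?_ * ?_ * ?_
          exact Real.sqrt_le_sqrt hyb
      _ = (√weightConst * √B) * (√X * √X) := by ring
      _ ≤ P * X := by rw [Real.mul_self_sqrt hX]; gcongr
  have hlin : Summable fun ξ ↦ (2 * freqNorm ξ + 2 * linearSymbol ε β δ ξ) * b ξ ^ 2 := by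
    refine Summable.of_norm_bounded
      (hW4.mul_left (2 + 2 * (|β - 1| + 1 + |δ| + |ε|))) fun ξ ↦ ?_
    rw [norm_mul, Real.norm_eq_abs, Real.norm_of_nonneg (sq_nonneg (b ξ)), ← mul_assoc]
    gcongr
    have h1 := abs_linearSymbol_le ε β δ ξ
    have h2 : freqNorm ξ ≤ freqWeight ξ ^ 4 :=
      (freqNorm_le_freqWeight ξ).trans (le_self_pow₀ (one_le_freqWeight ξ) (by norm_num))
    have h3 := freqNorm_nonneg ξ
    have h4 := abs_le.mp h1
    rw [abs_le]
    constructor <;> nlinarith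
  have hle : ∀ ξ, Real.exp (2 * s * truncFreq n ξ) *
      (2 * truncFreq n ξ * ‖a t ξ‖ ^ 2 + 2 * (conj (a t ξ) * (-(Complex.I * (ξ.1 : ℂ) / 2) * q t ξ +
        (linearSymbol ε β δ ξ : ℂ) * a t ξ)).re) ≤
      (2 * freqNorm ξ + 2 * linearSymbol ε β δ ξ) * b ξ ^ 2 +
        freqNorm ξ * b ξ * ∑' ζ, b ζ * b (ξ - ζ) := fun ξ ↦ by
    have h1 := two_mul_re_conj_mul_le ε β δ ξ (a t ξ) (q t ξ)
    have h2 : truncFreq n ξ ≤ freqNorm ξ := min_le_left _ _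
    have h3 := freqNorm_nonneg ξ
    rw [hv2]
    calc _ ≤ v ξ ^ 2 * (2 * freqNorm ξ * ‖a t ξ‖ ^ 2 + (2 * linearSymbol ε β δ ξ * ‖a t ξ‖ ^ 2 +
          freqNorm ξ * ‖a t ξ‖ * ‖q t ξ‖)) := by gcongr
      _ = (2 * freqNorm ξ + 2 * linearSymbol ε β δ ξ) * b ξ ^ 2 +
          freqNorm ξ * b ξ * (v ξ * ‖q t ξ‖) := by simp only [hb]; ring
      _ ≤ _ := by
          have := hb0 ξ
          have := hq ξ
          gcongr
  refine (hG.tsum_le_tsum hle (hlin.add hN1)).trans ?_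
  rw [hlin.tsum_add hN1]
  refine (add_le_add_right hN3 _).trans ?_
  rw [← hlin.tsum_add (hW3.mul_left _)]
  refine ((hlin.add (hW3.mul_left _)).tsum_le_tsum (fun ξ ↦ ?_) (hb2.mul_left K)).trans ?_
  · have := mul_le_mul_of_nonneg_right (hK ξ) (sq_nonneg (b ξ))
    linarith
  · rw [tsum_mul_left]
    gcongr

/-- A solution bounded by `C` gains Gevrey regularity at a uniform rate. -/
theorem exists_truncated_gevrey_le (β : ℝ) (hε : 0 < ε) (hδ : 0 ≤ δ) {C B : ℝ} (hC : 0 ≤ C)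
    (hCB : C < B) :
    ∃ τ, 0 < τ ∧ ∀ a q : ℝ → ℤ × ℤ → ℂ, IsSpectralSolution ε β δ a q → ∀ t₀, 0 ≤ t₀ →
      ∑' ξ, ‖a t₀ ξ‖ ^ 2 ≤ C → ∀ s ∈ Set.Icc 0 τ, ∀ n, 0 ≤ n →
        ∑' ξ, Real.exp (2 * s * truncFreq n ξ) * ‖a (t₀ + s) ξ‖ ^ 2 ≤ B := by
  have hB : 0 < B := hC.trans_lt hCB
  set P := √weightConst * √B with hP
  -- After doubling, P/2 covers the nonlinear term and 1 covers the 2|ξ| coming from the growth of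
  -- the weight, as |ξ| ≤ (1+|ξ|)³.
  obtain ⟨K, hK0, hK⟩ := exists_linearSymbol_le β δ hε hδ (P / 2 + 1) (by positivity)
  have hK' : ∀ ξ, 2 * freqNorm ξ + 2 * linearSymbol ε β δ ξ + P * freqWeight ξ ^ 3 ≤ 2 * K := by
    intro ξ
    have h1 := hK ξ
    have h2 : freqNorm ξ ≤ freqWeight ξ ^ 3 :=
      (freqNorm_le_freqWeight ξ).trans (le_self_pow₀ (one_le_freqWeight ξ) (by norm_num))
    have h3 : 0 ≤ ε / 2 * freqNorm ξ ^ 4 := by positivity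
    linarith
  -- At rate 2KB the norm gains at most (B - C)/2 in time τ. The +1 keeps the denominator positive
  -- when K = 0.
  set τ := (B - C) / (2 * (2 * K * B + 1)) with hτ
  have hτ0 : 0 < τ := div_pos (sub_pos.mpr hCB) (by positivity)
  refine ⟨τ, hτ0, fun a q h t₀ ht₀ hy₀ s hs n hn ↦ ?_⟩
  obtain ⟨B', hb⟩ := h.exists_energy_bound (t₀ + τ)
  have hsub : Set.Icc t₀ (t₀ + τ) ⊆ Set.Ici 0 := fun r hr ↦ ht₀.trans hr.1
  have hsub' : Set.Icc t₀ (t₀ + τ) ⊆ Set.Icc 0 (t₀ + τ) := Set.Icc_subset_Icc_left ht₀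
  have hprim := isPrimitiveOn_weighted_energy (x := a) (n := n) (ψ := truncFreq n)
    (a := t₀) (b := t₀ + τ) (by linarith) (truncFreq_nonneg hn)
    (fun _ ↦ min_le_right _ _) (fun ξ ↦ (h.continuousOn ξ).mono hsub)
    (fun ξ ↦ (h.continuousOn_rhs ξ).mono hsub)
    (fun ξ r hr ↦ h.hasDerivAt ξ r (ht₀.trans_lt hr.1))
    (fun r hr ↦ (hb r (hsub' hr)).1) (fun r hr ↦ (hb r (hsub' hr)).2.1)
    (fun r hr ↦ (hb r (hsub' hr)).2.2.1) (fun r hr ↦ (hb r (hsub' hr)).2.2.2)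
  have key := hprim.le_of_le_below (M := 2 * K * B) (B₀ := C) (B := B) (t := t₀ + s) (by positivity)
    (by simpa using hy₀) (fun r hr hle ↦ ?_) ?_ ⟨by linarith [hs.1], by linarith [hs.2]⟩
  · simpa using key
  · refine h.gevrey_rate_le hn (sub_nonneg.mpr hr.1) (ht₀.trans hr.1) (by positivity) le_rfl hK' hle ?_
    obtain ⟨h1, -, h2, -⟩ := hb r (hsub' hr)
    refine Summable.of_norm_bounded (((h1.mul_left (2 * n)).add (h2.mul_left 2)).mul_left
      (Real.exp (2 * (r - t₀) * n))) fun ξ ↦ ?_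
    have h3 : truncFreq n ξ ≤ n := min_le_right _ _
    have h4 := truncFreq_nonneg hn ξ
    have h5 : 0 ≤ r - t₀ := sub_nonneg.mpr hr.1
    rw [norm_mul, Real.norm_of_nonneg (Real.exp_pos _).le]
    gcongr
    refine (norm_add_le _ _).trans (add_le_add ?_ ?_)
    · rw [Real.norm_of_nonneg (by positivity)]
      gcongr
    · rw [norm_mul, Real.norm_ofNat]
      gcongr
      refine (Complex.abs_re_le_norm _).trans (le_of_eq ?_)
      rw [norm_mul, RCLike.norm_conj]
  · rw [add_sub_cancel_left, hτ]
    have h1 : 2 * K * B * ((B - C) / (2 * (2 * K * B + 1))) ≤ (B - C) / 2 := by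
      rw [mul_div_assoc', div_le_div_iff₀ (by positivity) two_pos]
      nlinarith [sub_pos.mpr hCB, mul_nonneg hK0 hB.le]
    linarith

/-- The truncated bound does not depend on n, so it passes to finite partial sums of the full Gevrey
norm and then to the whole sum. -/
theorem exists_gevrey_le (β : ℝ) (hε : 0 < ε) (hδ : 0 ≤ δ) {C B : ℝ} (hC : 0 ≤ C) (hCB : C < B) :
    ∃ τ, 0 < τ ∧ ∀ a q : ℝ → ℤ × ℤ → ℂ, IsSpectralSolution ε β δ a q → ∀ t₀, 0 ≤ t₀ →
      ∑' ξ, ‖a t₀ ξ‖ ^ 2 ≤ C → ∀ s ∈ Set.Icc 0 τ,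
        (Summable fun ξ ↦ Real.exp (2 * s * freqNorm ξ) * ‖a (t₀ + s) ξ‖ ^ 2) ∧
          ∑' ξ, Real.exp (2 * s * freqNorm ξ) * ‖a (t₀ + s) ξ‖ ^ 2 ≤ B := by
  obtain ⟨τ, hτ, hle⟩ := exists_truncated_gevrey_le β hε hδ hC hCB
  refine ⟨τ, hτ, fun a q h t₀ ht₀ hy₀ s hs ↦ ?_⟩
  have hfin : ∀ u : Finset (ℤ × ℤ),
      ∑ ξ ∈ u, Real.exp (2 * s * freqNorm ξ) * ‖a (t₀ + s) ξ‖ ^ 2 ≤ B := by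
    intro u
    -- At this level the truncation is inactive on every frequency of u.
    set n := ∑ ξ ∈ u, freqNorm ξ with hn
    have hn0 : 0 ≤ n := Finset.sum_nonneg fun ξ _ ↦ freqNorm_nonneg ξ
    have hsum : Summable fun ξ ↦ Real.exp (2 * s * truncFreq n ξ) * ‖a (t₀ + s) ξ‖ ^ 2 := by
      refine Summable.of_nonneg_of_le (fun ξ ↦ by positivity) (fun ξ ↦ ?_)
        ((h.summable_sq (add_nonneg ht₀ hs.1)).mul_left (Real.exp (2 * s * n)))
      have h3 : truncFreq n ξ ≤ n := min_le_right _ _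
      have := hs.1
      gcongr
    refine le_trans (le_of_eq (Finset.sum_congr rfl fun ξ hξ ↦ ?_))
      ((hsum.sum_le_tsum u fun ξ _ ↦ by positivity).trans (hle a q h t₀ ht₀ hy₀ s hs n hn0))
    rw [truncFreq, min_eq_left (Finset.single_le_sum (fun ζ _ ↦ freqNorm_nonneg ζ) hξ)]
  have hsum := summable_of_sum_le (fun ξ ↦ by positivity) hfin
  exact ⟨hsum, hsum.tsum_le_of_sum_le hfin⟩

end IsSpectralSolution

/-! ### Analytic extension to the strip -/

/-- A sum of exponentials of continuous linear forms is analytic where it converges with some room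
to spare. -/
theorem analyticAt_tsum_exp {ι E : Type*} [NormedAddCommGroup E] [NormedSpace ℂ E] (c : ι → ℂ)
    (L : ι → E →L[ℂ] ℂ) (z₀ : E) {ρ : ℝ} (hρ : 0 < ρ)
    (h : Summable fun i ↦ ‖c i * Complex.exp (L i z₀)‖ * Real.exp (‖L i‖ * ρ)) :
    AnalyticAt ℂ (fun z ↦ ∑' i, c i * Complex.exp (L i z)) z₀ := by
  set d : ι → ℂ := fun i ↦ c i * Complex.exp (L i z₀) with hd
  have hexp : ∀ x : ℝ, HasSum (fun n : ℕ ↦ x ^ n / n.factorial) (Real.exp x) := fun x ↦ by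
    rw [Real.exp_eq_exp_ℝ]
    exact NormedSpace.expSeries_div_hasSum_exp x
  have hcexp : ∀ x : ℂ, HasSum (fun n : ℕ ↦ x ^ n / n.factorial) (Complex.exp x) := fun x ↦ by
    rw [Complex.exp_eq_exp_ℂ]
    exact NormedSpace.expSeries_div_hasSum_exp x
  -- Absolute convergence of the double series from expanding each exponential at z₀; it allows
  -- regrouping by degree n.
  have hB : Summable fun p : ι × ℕ ↦ ‖d p.1‖ * ((‖L p.1‖ * ρ) ^ p.2 / p.2.factorial) := by
    rw [summable_prod_of_nonneg fun p ↦ by positivity]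
    refine ⟨fun i ↦ Summable.mul_left ‖d i‖ (hexp (‖L i‖ * ρ)).summable, h.congr fun i ↦ ?_⟩
    dsimp only
    rw [tsum_mul_left, (hexp (‖L i‖ * ρ)).tsum_eq]
  have hBswap : Summable fun p : ℕ × ι ↦ ‖d p.2‖ * ((‖L p.2‖ * ρ) ^ p.1 / p.1.factorial) :=
    hB.prod_symm
  have hBn : ∀ n : ℕ, Summable fun i ↦ ‖d i‖ * ((‖L i‖ * ρ) ^ n / n.factorial) := fun n ↦
    hBswap.prod_factor n
  set p : ι → FormalMultilinearSeries ℂ E ℂ := fun i n ↦ (d i * (n.factorial : ℂ)⁻¹) •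
    (ContinuousMultilinearMap.mkPiAlgebraFin ℂ n ℂ).compContinuousLinearMap (fun _ ↦ L i) with hp
  have hpn : ∀ i n, ‖p i n‖ * ρ ^ n ≤ ‖d i‖ * ((‖L i‖ * ρ) ^ n / n.factorial) := by
    intro i n
    have h1 := (ContinuousMultilinearMap.mkPiAlgebraFin ℂ n ℂ).norm_compContinuousLinearMap_le
      (fun _ ↦ L i)
    rw [ContinuousMultilinearMap.norm_mkPiAlgebraFin, one_mul, Finset.prod_const,
      Finset.card_univ, Fintype.card_fin] at h1
    rw [hp]
    dsimp only
    rw [norm_smul, norm_mul, norm_inv, Complex.norm_natCast]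
    calc _ ≤ ‖d i‖ * (n.factorial : ℝ)⁻¹ * ‖L i‖ ^ n * ρ ^ n := by gcongr
      _ = _ := by rw [mul_pow]; ring
  have hps : ∀ n, Summable fun i ↦ ‖p i n‖ := fun n ↦ by
    have h1 : Summable fun i ↦ ‖p i n‖ * ρ ^ n :=
      Summable.of_nonneg_of_le (fun i ↦ by positivity) (fun i ↦ hpn i n) (hBn n)
    have h2 := h1.mul_right ((ρ ^ n)⁻¹)
    refine h2.congr fun i ↦ ?_
    rw [mul_assoc, mul_inv_cancel₀ (pow_ne_zero n hρ.ne'), mul_one]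
  have happ : ∀ i n w, p i n (fun _ ↦ w) = d i * (L i w ^ n / n.factorial) := fun i n w ↦ by
    rw [hp]
    simp only [smul_apply,
      ContinuousMultilinearMap.compContinuousLinearMap_apply,
      ContinuousMultilinearMap.mkPiAlgebraFin_apply, List.ofFn_const, List.prod_replicate,
      smul_eq_mul]
    ring
  refine ⟨fun n ↦ ∑' i, p i n, ENNReal.ofReal ρ, ?_, ENNReal.ofReal_pos.mpr hρ, ?_⟩
  · refine FormalMultilinearSeries.le_radius_of_bound _ (r := ρ.toNNReal)
      (∑' i, ‖d i‖ * Real.exp (‖L i‖ * ρ)) fun n ↦ ?_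
    rw [Real.coe_toNNReal _ hρ.le]
    calc ‖∑' i, p i n‖ * ρ ^ n ≤ (∑' i, ‖p i n‖) * ρ ^ n := by
          gcongr
          exact norm_tsum_le_tsum_norm (hps n)
      _ = ∑' i, ‖p i n‖ * ρ ^ n := tsum_mul_right.symm
      _ ≤ ∑' i, ‖d i‖ * Real.exp (‖L i‖ * ρ) := by
          refine ((hps n).mul_right _).tsum_le_tsum (fun i ↦ (hpn i n).trans ?_) h
          gcongr
          exact Real.pow_div_factorial_le_exp _ (by positivity) n
  · intro w hw
    have hw' : ‖w‖ ≤ ρ := by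
      rw [Metric.mem_eball, edist_zero_right, ← ofReal_norm] at hw
      exact ((ENNReal.ofReal_lt_ofReal_iff hρ).mp hw).le
    have hG : Summable fun p : ι × ℕ ↦ d p.1 * (L p.1 w ^ p.2 / p.2.factorial) := by
      refine Summable.of_norm_bounded hB fun p ↦ ?_
      rw [norm_mul, norm_div, norm_pow, Complex.norm_natCast]
      have : ‖L p.1 w‖ ≤ ‖L p.1‖ * ρ := ((L p.1).le_opNorm w).trans (by gcongr)
      gcongr
    have hG' : Summable fun p : ℕ × ι ↦ d p.2 * (L p.2 w ^ p.1 / p.1.factorial) :=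
      hG.prod_symm
    have h1 := hG.hasSum.prod_fiberwise fun i ↦ (hcexp (L i w)).mul_left (d i)
    have h2 := hG'.hasSum.prod_fiberwise fun n ↦ (hG'.prod_factor n).hasSum
    have h3 : ∑' p : ℕ × ι, d p.2 * (L p.2 w ^ p.1 / p.1.factorial) =
        ∑' i, c i * Complex.exp (L i (z₀ + w)) := by
      have h4 : ∑' p : ℕ × ι, d p.2 * (L p.2 w ^ p.1 / p.1.factorial) =
          ∑' p : ι × ℕ, d p.1 * (L p.1 w ^ p.2 / p.2.factorial) :=
        (Equiv.prodComm ℕ ι).tsum_eq fun p : ι × ℕ ↦ d p.1 * (L p.1 w ^ p.2 / p.2.factorial)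
      rw [h4, ← h1.tsum_eq]
      refine tsum_congr fun i ↦ ?_
      rw [hd, map_add, Complex.exp_add]
      ring
    rw [h3] at h2
    refine h2.congr_fun fun n ↦ ?_
    rw [ContinuousMultilinearMap.tsum_eval (hps n).of_norm]
    exact tsum_congr fun i ↦ happ i n w

theorem exists_freqWeight_cube_le_exp {κ : ℝ} (hκ : 0 < κ) :
    ∃ K, 0 ≤ K ∧ ∀ ξ, freqWeight ξ ^ 3 ≤ K * Real.exp (κ * freqNorm ξ) := by
  -- The coefficient κ⁴/24 is chosen to match the degree four term of the exponential series.
  obtain ⟨K, hK, h⟩ := exists_cube_le 1 zero_le_one (ε := κ ^ 4 / 24) (by positivity)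
  refine ⟨K + 1, by positivity, fun ξ ↦ ?_⟩
  have hN := freqNorm_nonneg ξ
  have h1 := h (freqNorm ξ) hN
  have h2 := Real.pow_div_factorial_le_exp (κ * freqNorm ξ) (by positivity) 4
  have h3 : (1 : ℝ) ≤ Real.exp (κ * freqNorm ξ) := Real.one_le_exp (by positivity)
  have h4 : κ ^ 4 / 24 * freqNorm ξ ^ 4 = (κ * freqNorm ξ) ^ 4 / (Nat.factorial 4 : ℕ) := by
    norm_num [Nat.factorial]
    ring
  unfold freqWeight
  nlinarith

/-- The loss of radius σ - r pays for the cubic weight that the passage from ℓ² to ℓ¹ requires. -/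
theorem summable_exp_mul_norm {c : ℤ × ℤ → ℂ} {σ r : ℝ} (hr : r < σ)
    (hc : Summable fun ξ ↦ Real.exp (2 * σ * freqNorm ξ) * ‖c ξ‖ ^ 2) :
    Summable fun ξ ↦ Real.exp (r * freqNorm ξ) * ‖c ξ‖ := by
  obtain ⟨K, hK, h⟩ := exists_freqWeight_cube_le_exp (κ := 2 * (σ - r)) (by linarith)
  refine summable_of_summable_weight
    (Summable.of_nonneg_of_le (fun ξ ↦ by have := freqWeight_pos ξ; positivity) (fun ξ ↦ ?_)
      (hc.mul_left K))
  have e : Real.exp (2 * σ * freqNorm ξ) =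
      Real.exp (2 * (σ - r) * freqNorm ξ) * Real.exp (r * freqNorm ξ) ^ 2 := by
    rw [← Real.exp_nat_mul, ← Real.exp_add]
    congr 1
    push_cast
    ring
  rw [e, mul_pow]
  have := mul_le_mul_of_nonneg_right (h ξ)
    (mul_nonneg (sq_nonneg (Real.exp (r * freqNorm ξ))) (sq_nonneg ‖c ξ‖))
  linarith

/-- The linear form `z ↦ i ξ · z`. -/
noncomputable def phaseForm (ξ : ℤ × ℤ) : ℂ × ℂ →L[ℂ] ℂ :=
  (Complex.I * (ξ.1 : ℂ)) • ContinuousLinearMap.fst ℂ ℂ ℂ +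
    (Complex.I * (ξ.2 : ℂ)) • ContinuousLinearMap.snd ℂ ℂ ℂ

theorem phaseForm_apply (ξ : ℤ × ℤ) (z : ℂ × ℂ) :
    phaseForm ξ z = Complex.I * (ξ.1 : ℂ) * z.1 + Complex.I * (ξ.2 : ℂ) * z.2 := by
  simp [phaseForm]

theorem norm_phaseForm_le (ξ : ℤ × ℤ) : ‖phaseForm ξ‖ ≤ 2 * freqNorm ξ := by
  refine ContinuousLinearMap.opNorm_le_bound _ (by have := freqNorm_nonneg ξ; positivity) fun z ↦ ?_
  rw [phaseForm_apply]
  refine (norm_add_le _ _).trans ?_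
  simp only [norm_mul, Complex.norm_I, one_mul, Complex.norm_intCast]
  have h1 := abs_fst_le_freqNorm ξ
  have h2 := abs_snd_le_freqNorm ξ
  have h3 := norm_fst_le z
  have h4 := norm_snd_le z
  have h5 := freqNorm_nonneg ξ
  calc |(ξ.1 : ℝ)| * ‖z.1‖ + |(ξ.2 : ℝ)| * ‖z.2‖ ≤ freqNorm ξ * ‖z‖ + freqNorm ξ * ‖z‖ := by gcongr
    _ = _ := by ring

/-- Cauchy–Schwarz in the Euclidean norm, which is why the strip is measured by the Euclidean length
of the imaginary part. -/
theorem norm_exp_phaseForm_le (ξ : ℤ × ℤ) (z : ℂ × ℂ) :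
    ‖Complex.exp (phaseForm ξ z)‖ ≤ Real.exp (√(z.1.im ^ 2 + z.2.im ^ 2) * freqNorm ξ) := by
  rw [Complex.norm_exp]
  apply Real.exp_le_exp.mpr
  have e : (phaseForm ξ z).re = -((ξ.1 : ℝ) * z.1.im + (ξ.2 : ℝ) * z.2.im) := by
    rw [phaseForm_apply]
    simp
    ring
  rw [e, freqNorm, ← Real.sqrt_mul (by positivity)]
  apply Real.le_sqrt_of_sq_le
  nlinarith [sq_nonneg ((ξ.1 : ℝ) * z.2.im - (ξ.2 : ℝ) * z.1.im)]

theorem torusChar_coe (ξ : ℤ × ℤ) (x y : ℝ) :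
    torusChar ξ ((x : AddCircle (2 * Real.pi)), (y : AddCircle (2 * Real.pi))) =
      Complex.exp (phaseForm ξ ((x : ℂ), (y : ℂ))) := by
  rw [torusChar_apply, fourier_coe_apply, fourier_coe_apply, phaseForm_apply, Complex.exp_add]
  have : ((2 * Real.pi : ℝ) : ℂ) ≠ 0 := two_pi_ne_zero_complex
  congr 2
  · push_cast at this ⊢
    field_simp
  · push_cast at this ⊢
    field_simp

/-- The preimage of a null set is a countable union of null pieces, one per period. -/
theorem quasiMeasurePreserving_coe_addCircle :
    Measure.QuasiMeasurePreserving (fun x : ℝ ↦ (x : AddCircle (2 * Real.pi))) volume volume := by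
  refine ⟨AddCircle.measurable_mk', Measure.AbsolutelyContinuous.mk fun s hs h0 ↦ ?_⟩
  rw [Measure.map_apply AddCircle.measurable_mk' hs]
  have hcover : (fun x : ℝ ↦ (x : AddCircle (2 * Real.pi))) ⁻¹' s = ⋃ n : ℤ,
      (fun x : ℝ ↦ (x : AddCircle (2 * Real.pi))) ⁻¹' s ∩
        Set.Ioc (n • (2 * Real.pi)) ((n + 1) • (2 * Real.pi)) := by
    rw [← Set.inter_iUnion, iUnion_Ioc_zsmul Real.two_pi_pos, Set.inter_univ]
  rw [hcover, measure_iUnion_null_iff]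
  intro n
  have h1 := (AddCircle.measurePreserving_mk (2 * Real.pi) (n • (2 * Real.pi))).measure_preimage
    hs.nullMeasurableSet
  rw [h0, Measure.restrict_apply (AddCircle.measurable_mk' hs)] at h1
  rw [add_smul, one_smul]
  exact h1

theorem ae_coe_torus {P : Torus2 → Prop} (h : ∀ᵐ p : Torus2, P p) :
    ∀ᵐ p : ℝ × ℝ, P ((p.1 : AddCircle (2 * Real.pi)), (p.2 : AddCircle (2 * Real.pi))) := by
  have hq : Measure.QuasiMeasurePreserving (fun p : ℝ × ℝ ↦
      ((p.1 : AddCircle (2 * Real.pi)), (p.2 : AddCircle (2 * Real.pi)))) volume volume := by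
    have h1 := quasiMeasurePreserving_coe_addCircle
    exact QuasiMeasurePreserving.prodMap h1 h1
  exact hq.ae h

/-- Gevrey regularity gives an analytic extension to a strip. -/
theorem analyticInStrip_of_summable {u : L2Torus} {σ : ℝ} (hσ : 0 < σ)
    (hu : Summable fun ξ ↦ Real.exp (2 * σ * freqNorm ξ) * ‖fourierCoeff2 u ξ‖ ^ 2) :
    AnalyticInStrip σ u := by
  refine ⟨fun z ↦ ∑' ξ, fourierCoeff2 u ξ * Complex.exp (phaseForm ξ z), fun z hz ↦ ?_, ?_⟩
  · set r := √(z.1.im ^ 2 + z.2.im ^ 2) with hr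
    have hrσ : r < σ := hz
    -- As ‖`phaseForm ξ`‖ ≤ 2|ξ|, this ρ costs e^{(σ-r)|ξ|/2}, so the total exponent r + (σ-r)/2
    -- stays below σ.
    refine analyticAt_tsum_exp _ _ z (ρ := (σ - r) / 4) (by linarith) ?_
    have hs := summable_exp_mul_norm (r := r + (σ - r) / 2) (by linarith) hu
    refine Summable.of_nonneg_of_le (fun ξ ↦ by positivity) (fun ξ ↦ ?_) hs
    rw [norm_mul, add_mul, Real.exp_add]
    have h1 := norm_exp_phaseForm_le ξ z
    have h2 := norm_phaseForm_le ξ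
    have h3 : Real.exp (‖phaseForm ξ‖ * ((σ - r) / 4)) ≤ Real.exp ((σ - r) / 2 * freqNorm ξ) := by
      apply Real.exp_le_exp.mpr
      nlinarith
    calc _ ≤ ‖fourierCoeff2 u ξ‖ * Real.exp (r * freqNorm ξ) *
          Real.exp ((σ - r) / 2 * freqNorm ξ) := by gcongr
      _ = _ := by ring
  · have hs := summable_exp_mul_norm hσ hu
    simp only [zero_mul, Real.exp_zero, one_mul] at hs
    filter_upwards [ae_coe_torus (ae_eq_tsum_torusChar u hs)] with p hp
    rw [hp]
    exact tsum_congr fun ξ ↦ by rw [torusChar_coe]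

/-! ### The width function and the conclusion -/

theorem Real.tanh_pos {t : ℝ} (ht : 0 < t) : 0 < Real.tanh t := by
  rw [Real.tanh_eq_sinh_div_cosh]
  exact div_pos (Real.sinh_pos_iff.mpr ht) (Real.cosh_pos t)

/-- The derivative of x cosh x - sinh x is x sinh x, nonnegative for x ≥ 0. -/
theorem Real.tanh_le_self {t : ℝ} (ht : 0 ≤ t) : Real.tanh t ≤ t := by
  have hd : ∀ x : ℝ, HasDerivAt (fun x ↦ x * Real.cosh x - Real.sinh x) (x * Real.sinh x) x := by
    intro x
    refine (((hasDerivAt_id x).mul (Real.hasDerivAt_cosh x)).sub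
      (Real.hasDerivAt_sinh x)).congr_deriv ?_
    simp
  have hmono : MonotoneOn (fun x ↦ x * Real.cosh x - Real.sinh x) (Set.Ici 0) := by
    refine monotoneOn_of_deriv_nonneg (convex_Ici 0)
      (fun x _ ↦ (hd x).continuousAt.continuousWithinAt)
      (fun x _ ↦ (hd x).differentiableAt.differentiableWithinAt) fun x hx ↦ ?_
    rw [interior_Ici] at hx
    rw [(hd x).deriv]
    exact mul_nonneg (le_of_lt hx) (Real.sinh_nonneg_iff.mpr (le_of_lt hx))
  have h := hmono (Set.self_mem_Ici) ht ht
  simp only [zero_mul, Real.sinh_zero, sub_zero] at h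
  rw [Real.tanh_eq_sinh_div_cosh, div_le_iff₀ (Real.cosh_pos t)]
  linarith

theorem stripWidth_pos {T₀ t : ℝ} (hT : 0 < T₀) (ht : 0 < t) : 0 < stripWidth T₀ t :=
  lt_min (Real.tanh_pos ht) (Real.tanh_pos (half_pos hT))

theorem stripWidth_le {T₀ t : ℝ} (hT : 0 < T₀) (ht : 0 < t) :
    stripWidth T₀ t ≤ min t (T₀ / 2) :=
  min_le_min (Real.tanh_le_self ht.le) (Real.tanh_le_self (half_pos hT).le)

theorem gevreySq_le {u : L2Torus} {σ s R : ℝ} (hσ : σ ≤ s)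
    (hs : Summable fun ξ ↦ Real.exp (2 * s * freqNorm ξ) * ‖fourierCoeff2 u ξ‖ ^ 2)
    (hR : ∑' ξ, Real.exp (2 * s * freqNorm ξ) * ‖fourierCoeff2 u ξ‖ ^ 2 ≤ R) :
    gevreySq σ u ≤ ENNReal.ofReal ((2 * Real.pi) ^ 2 * R) := by
  have h1 : gevreySq σ u ≤ ∑' ξ, ENNReal.ofReal
      ((2 * Real.pi) ^ 2 * (Real.exp (2 * s * freqNorm ξ) * ‖fourierCoeff2 u ξ‖ ^ 2)) := by
    refine ENNReal.tsum_le_tsum fun ξ ↦ ENNReal.ofReal_le_ofReal ?_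
    have := freqNorm_nonneg ξ
    gcongr
  refine h1.trans ?_
  rw [← ENNReal.ofReal_tsum_of_nonneg (fun ξ ↦ by positivity) (hs.mul_left _), tsum_mul_left]
  gcongr

theorem mainTheorem4 (ε β δ : ℝ) (hε : 0 < ε) (hβ : 0 < β) (hδ : 0 ≤ δ)
    (η₀ : L2Torus) (hη₀ : IsH2Odd η₀) :
    ∃ T₀ : ℝ, 0 < T₀ ∧ ∃ C : ℝ, ∀ η : ℝ → L2Torus, IsSolution ε β δ η₀ η →
      (∀ t : ℝ, 0 ≤ t → ‖η t‖ ≤ C) ∧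
      ∀ t : ℝ, 0 < t →
        gevreySq (stripWidth T₀ t) (η t) ≤ ENNReal.ofReal (1 + 2 * C ^ 2) ∧
        AnalyticInStrip (stripWidth T₀ t) (η t) := by
  have hpi := Real.two_pi_pos
  obtain ⟨Y, hY, hYle⟩ := IsSpectralSolution.exists_energy_le β hε hδ
    (Y₀ := ((2 * Real.pi) ^ 2)⁻¹ * ‖η₀‖ ^ 2) (by positivity)
  set C := 2 * Real.pi * √Y with hC
  have hC2 : C ^ 2 = (2 * Real.pi) ^ 2 * Y := by rw [hC, mul_pow, Real.sq_sqrt hY]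
  -- Multiplication by (2π)² turns this `B` into 1 + 2C²; the first summand makes Y < B even when Y
  -- = 0.
  obtain ⟨τ, hτ, hgev⟩ := IsSpectralSolution.exists_gevrey_le β hε hδ (C := Y)
    (B := ((2 * Real.pi) ^ 2)⁻¹ + 2 * Y) hY
    (by have : 0 < ((2 * Real.pi) ^ 2)⁻¹ := by positivity
        linarith)
  refine ⟨2 * τ, by positivity, C, fun η hη ↦ ?_⟩
  have hsol := hη.isSpectralSolution
  have hodd : ∀ ξ, fourierCoeff2 (η 0) (IsSpectralSolution.reflectFst ξ) =
      -fourierCoeff2 (η 0) ξ := fun ξ ↦ by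
    rw [hη.initial]
    exact fourierCoeff2_odd η₀ hη₀.2 ξ
  have hen : ∀ t, 0 ≤ t → ∑' ξ, ‖fourierCoeff2 (η t) ξ‖ ^ 2 ≤ Y :=
    hYle _ _ hsol hodd (by rw [hη.initial, (hasSum_sq_fourierCoeff2 η₀).tsum_eq])
  refine ⟨fun t ht ↦ ?_, fun t ht ↦ ?_⟩
  · have h1 := hen t ht
    rw [(hasSum_sq_fourierCoeff2 (η t)).tsum_eq, inv_mul_le_iff₀ (by positivity), ← hC2] at h1
    exact le_of_sq_le_sq h1 (by positivity)
  · set s := min t τ with hs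
    have hs0 : 0 < s := lt_min ht hτ
    have hts : 0 ≤ t - s := sub_nonneg.mpr (min_le_left _ _)
    have hσs : stripWidth (2 * τ) t ≤ s := by
      have := stripWidth_le (T₀ := 2 * τ) (by positivity) ht
      rwa [mul_div_cancel_left₀ _ two_ne_zero] at this
    obtain ⟨h1, h2⟩ := hgev _ _ hsol (t - s) hts (hen _ hts) s ⟨hs0.le, min_le_right _ _⟩
    rw [sub_add_cancel] at h1 h2
    refine ⟨?_, ?_⟩
    · refine (gevreySq_le hσs h1 h2).trans (le_of_eq ?_)
      rw [hC2, mul_add, mul_inv_cancel₀ (by positivity)]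
      congr 1
      ring
    · refine analyticInStrip_of_summable (stripWidth_pos (by positivity) ht) ?_
      refine Summable.of_nonneg_of_le (fun ξ ↦ by positivity) (fun ξ ↦ ?_) h1
      have := freqNorm_nonneg ξ
      gcongr
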